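/- Let $n,d\ge 1$ be integers, $\alpha>-1$ and $1<p<\infty$. Let $\mathbb B_n$ be the open unit ball of $\mathbb C^n$, write $\overline{w}z=\langle z,w\rangle=\sum_i z_i\overline{w_i}$, and let $dv_\alpha(z)=c_\alpha(1-|z|^2)^\alpha\,dV(z)$, where $dV$ is Lebesgue measure and $c_\alpha$ is chosen so that $v_\alpha(\mathbb B_n)=1$. Let $A^p_\alpha=A^p_\alpha(\mathbb B_n;\mathbb C^d)$ be the space of holomorphic $f:\mathbb B_n\to\mathbb C^d$ with $\|f\|_{A^p_\alpha}^p=\int_{\mathbb B_n}\|f(z)\|_p^p\,dv_\alpha(z)<\infty$, where $\|\cdot\|_p$ is the $\ell^p$-norm on $\mathbb C^d$. Let $\mu$ be a matrix-valued measure on $\mathbb B_n$, that is, a countably additive function on the Borel sets of $\mathbb B_n$ with values in the complex $d\times d$ matrices, with entries $\mu_{(i,j)}$, and let $|\mu|=\sum_{i,j=1}^d|\mu_{(i,j)}|$, where $|\mu_{(i,j)}|$ is the total variation of the complex measure $\mu_{(i,j)}$. Suppose that $|\mu|$ is $A^p_\alpha$-Carleson: there is a constant $C$ such that $$\int_{\mathbb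 B_n}\|f(z)\|_p^p\,d|\mu|(z)\le C\int_{\mathbb B_n}\|f(z)\|_p^p\,dv_\alpha(z)\qquad\text{for all } f\in A^p_\alpha .$$ Then there is a sequence of matrix-valued functions $B_k(\mu):\mathbb B_n\to\mathbb C^{d\times d}$, $k=0,1,2,\dots$, such that (i) every entry of every $B_k(\mu)$ is bounded, and uniformly continuous from $(\mathbb B_n,\rho)$ to $(\mathbb C,|\cdot|)$, where $\rho(z,w)=|\varphi_z(w)|$ is the pseudo-hyperbolic metric and $\varphi_z$ is the involutive automorphism of $\mathbb B_n$ that interchanges $z$ and $0$; (ii) the Toeplitz operators $$T_\mu f(z)=\int_{\mathbb B_n}\frac{d\mu(w)\,f(w)}{(1-\overline{w}z)^{n+1+\alpha}},\qquad T_{B_k(\mu)}f(z)=\int_{\mathbb B_n}\frac{B_k(\mu)(w)\,f(w)}{(1-\overline{w}z)^{n+1+\alpha}}\,dv_\alpha(w)$$ (integrals taken coordinate by coordinate and absolutely convergent for all $f\in A^p_\alpha$ and $z\in\mathbb B_n$) are bounded operators from $A^p_\alpha$ to $A^p_\alpha$, and $T_{B_k(\mu)}\to T_\mu$ in the operator norm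 of $\mathcal L(A^p_\alpha)$ as $k\to\infty$. -/

import Mathlib

open MeasureTheory Filter Topology
open scoped ENNReal NNReal

noncomputable section

/-! ### The unit ball, the weighted volume and the weighted Bergman space -/

/-- The open unit ball of `ℂⁿ` (Euclidean norm), as a type. It carries the subspace topology and
the Borel σ-algebra. -/
abbrev UnitBall (n : ℕ) : Type := Metric.ball (0 : EuclideanSpace ℂ (Fin n)) 1

/-- `ℂᵈ` with the norm `‖v‖_p = (∑ |v_i|^p)^(1/p)`. -/
abbrev CdLp (p : ℝ≥0∞) (d : ℕ) : Type := PiLp p (fun _ : Fin d => ℂ)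

/-- The measure `(1 - |z|²)^α dV(z)` on the unit ball, not yet normalized (`dV` is the restriction
to the ball of Lebesgue measure on `ℂⁿ`). -/
def rawWeightedVolume (n : ℕ) (α : ℝ) : Measure (UnitBall n) :=
  ((volume : Measure (EuclideanSpace ℂ (Fin n))).comap Subtype.val).withDensity
    (fun z => ENNReal.ofReal ((1 - ‖(z : EuclideanSpace ℂ (Fin n))‖ ^ 2) ^ α))

/-- The probability measure `dv_α(z) = c_α (1 - |z|²)^α dV(z)` (for `α > -1`), where `c_α` is the
reciprocal of the total mass of `(1 - |z|²)^α dV(z)`. -/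
def weightedVolume (n : ℕ) (α : ℝ) : Measure (UnitBall n) :=
  (rawWeightedVolume n α Set.univ)⁻¹ • rawWeightedVolume n α

/-- Holomorphic functions on the unit ball with values in `ℂᵈ`: since the ball is an open subset of
`ℂⁿ` but is treated as a type of its own, such a function is the restriction to the ball of a
function which is complex differentiable on the ball. -/
def IsHolomorphicOnBall {n d : ℕ} {p : ℝ≥0∞} [Fact (1 ≤ p)] (f : UnitBall n → CdLp p d) : Prop :=
  ∃ F : EuclideanSpace ℂ (Fin n) → CdLp p d,
    DifferentiableOn ℂ F (Metric.ball 0 1) ∧ ∀ z : UnitBall n, F z = f z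

/-- The holomorphic functions `f` on the ball with `∫ ‖f(z)‖_p^p dv_α(z) < ∞`. -/
def bergmanSubmodule (n d : ℕ) (α : ℝ) (p : ℝ≥0∞) [Fact (1 ≤ p)] :
    Submodule ℂ (UnitBall n → CdLp p d) where
  carrier := {f | IsHolomorphicOnBall f ∧ MemLp f p (weightedVolume n α)}
  add_mem' := by
    rintro f g ⟨⟨F, hF, hFf⟩, hf⟩ ⟨⟨G, hG, hGg⟩, hg⟩
    exact ⟨⟨F + G, hF.add hG, fun z => by simp [hFf, hGg]⟩, hf.add hg⟩
  zero_mem' := ⟨⟨0, differentiableOn_const 0, fun _ => rfl⟩, MemLp.zero⟩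
  smul_mem' := by
    rintro c f ⟨⟨F, hF, hFf⟩, hf⟩
    exact ⟨⟨c • F, hF.const_smul c, fun z => by simp [hFf]⟩, hf.const_smul c⟩

/-- The weighted Bergman space `A^p_α(𝔹ₙ; ℂᵈ)`. (A type of its own, so that it carries the norm
below and not the topology of pointwise convergence.) -/
def BergmanSpace (n d : ℕ) (α : ℝ) (p : ℝ≥0∞) [Fact (1 ≤ p)] : Type :=
  bergmanSubmodule n d α p

namespace BergmanSpace

variable {n d : ℕ} {α : ℝ} {p : ℝ≥0∞} [Fact (1 ≤ p)]

instance : AddCommGroup (BergmanSpace n d α p) :=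
  inferInstanceAs (AddCommGroup (bergmanSubmodule n d α p))

instance : Module ℂ (BergmanSpace n d α p) :=
  inferInstanceAs (Module ℂ (bergmanSubmodule n d α p))

/-- Elements of the Bergman space are functions on the ball. -/
instance : CoeFun (BergmanSpace n d α p) (fun _ => UnitBall n → CdLp p d) :=
  ⟨fun f => f.1⟩

/-- The inclusion of the Bergman space in `L^p_α(𝔹ₙ; ℂᵈ)`. -/
def toLpₗ : BergmanSpace n d α p →ₗ[ℂ] Lp (CdLp p d) p (weightedVolume n α) where
  toFun f := MemLp.toLp f.1 f.2.2
  map_add' _ _ := rfl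
  map_smul' _ _ := rfl

/-- The norm of the Bergman space is the norm of `L^p_α(𝔹ₙ; ℂᵈ)`. For `α > -1` only the zero
function has norm zero, by continuity of holomorphic functions. -/
instance : SeminormedAddCommGroup (BergmanSpace n d α p) :=
  SeminormedAddCommGroup.induced _ _ (toLpₗ (n := n) (d := d) (α := α) (p := p))

instance : NormedSpace ℂ (BergmanSpace n d α p) :=
  NormedSpace.induced ℂ _ _ (toLpₗ (n := n) (d := d) (α := α) (p := p))

theorem norm_def (f : BergmanSpace n d α p) :
    ‖f‖ = (eLpNorm f p (weightedVolume n α)).toReal :=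
  Lp.norm_toLp f.1 f.2.2

end BergmanSpace

/-! ### Matrix-valued measures -/

/-- A matrix-valued measure on the unit ball: a countably additive function on the Borel sets with
values in the complex `d × d` matrices (so that every entry is a complex measure). -/
abbrev MatrixMeasure (n d : ℕ) : Type := VectorMeasure (UnitBall n) (Matrix (Fin d) (Fin d) ℂ)

/-- The `(i, j)` entry `E ↦ μ(E)_(i,j)` of a matrix-valued measure. -/
def MatrixMeasure.entry {n d : ℕ} (μ : MatrixMeasure n d) (i j : Fin d) :
    ComplexMeasure (UnitBall n) :=
  VectorMeasure.mapRange μ (Matrix.entryAddMonoidHom ℂ i j) (continuous_id.matrix_elem i j)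

/-- The (scalar, positive) total variation `|μ| = ∑ i, ∑ j, |μ_(i,j)|` of a matrix-valued
measure, `|μ_(i,j)|` being the total variation of the complex measure `μ_(i,j)`. -/
def MatrixMeasure.totalVariation {n d : ℕ} (μ : MatrixMeasure n d) : Measure (UnitBall n) :=
  ∑ i, ∑ j, (μ.entry i j).variation

/-- A positive measure `ν` on the ball is Carleson for `A^p_α(𝔹ₙ; ℂᵈ)` if
`∫ ‖f‖_p^p dν ≤ C ∫ ‖f‖_p^p dv_α` for all `f` in `A^p_α(𝔹ₙ; ℂᵈ)`, with `C` independent of `f`. -/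
def IsBergmanCarleson (n d : ℕ) (α : ℝ) (p : ℝ≥0∞) [Fact (1 ≤ p)]
    (ν : Measure (UnitBall n)) : Prop :=
  ∃ C : ℝ≥0, ∀ f : BergmanSpace n d α p,
    ∫⁻ z, ‖f z‖ₑ ^ p.toReal ∂ν ≤ C * ∫⁻ z, ‖f z‖ₑ ^ p.toReal ∂(weightedVolume n α)

/-! ### Toeplitz operators -/

/-- `K(z, w) = (1 - w̄ z)^(-(n+1+α))`, where `w̄ z = ∑ i, z_i * conj w_i` (Mathlib's inner product
is conjugate linear in the first variable). The real part of the base is positive, and the power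
is the principal one. -/
def bergmanKernel (n : ℕ) (α : ℝ) (z w : UnitBall n) : ℂ :=
  1 / (1 - inner ℂ (w : EuclideanSpace ℂ (Fin n)) (z : EuclideanSpace ℂ (Fin n))) ^
    (((n : ℝ) + 1 + α : ℝ) : ℂ)

/-- `T` is the Toeplitz operator `T_μ` on `A^p_α(𝔹ₙ; ℂᵈ)`:
`T f(z) = ∫ dμ(w) f(w) / (1 - w̄ z)^(n+1+α)`, i.e. the `i`-th coordinate of `T f(z)` is
`∑ j, ∫ f_j(w) / (1 - w̄ z)^(n+1+α) dμ_(i,j)(w)`, all these integrals being absolutely convergent. -/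
def IsToeplitzOfMeasure {n d : ℕ} {α : ℝ} {p : ℝ≥0∞} [Fact (1 ≤ p)] (μ : MatrixMeasure n d)
    (T : BergmanSpace n d α p →L[ℂ] BergmanSpace n d α p) : Prop :=
  ∀ (f : BergmanSpace n d α p) (z : UnitBall n) (i : Fin d),
    (∀ j, (μ.entry i j).Integrable (fun w => f w j * bergmanKernel n α z w)) ∧
    T f z i = ∑ j, (μ.entry i j).integral (fun w => f w j * bergmanKernel n α z w)
      (ContinuousLinearMap.mul ℝ ℂ)

/-- `T` is the Toeplitz operator `T_φ = P_α M_φ` on `A^p_α(𝔹ₙ; ℂᵈ)` with matrix-valued symbol `φ`: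
`T f(z) = ∫ φ(w) f(w) / (1 - w̄ z)^(n+1+α) dv_α(w)`, coordinate by coordinate, the integrals being
absolutely convergent. -/
def IsToeplitzOfSymbol {n d : ℕ} {α : ℝ} {p : ℝ≥0∞} [Fact (1 ≤ p)]
    (φ : UnitBall n → Matrix (Fin d) (Fin d) ℂ)
    (T : BergmanSpace n d α p →L[ℂ] BergmanSpace n d α p) : Prop :=
  ∀ (f : BergmanSpace n d α p) (z : UnitBall n) (i : Fin d),
    (∀ j, Integrable (fun w => φ w i j * f w j * bergmanKernel n α z w) (weightedVolume n α)) ∧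
    T f z i = ∑ j, ∫ w, φ w i j * f w j * bergmanKernel n α z w ∂(weightedVolume n α)

/-! ### The pseudo-hyperbolic metric and the algebra of bounded uniformly continuous functions -/

/-- The automorphism of the ball interchanging `z` and `0`:
`φ_z(w) = (z - P_z w - (1 - |z|²)^(1/2) (w - P_z w)) / (1 - ⟨w, z⟩)`, where
`P_z w = (⟨w, z⟩ / |z|²) z` is the orthogonal projection of `w` to `ℂ z` (so `P_0 = 0`), and
`⟨w, z⟩ = ∑ i, w_i * conj z_i`. -/
def ballInvolution {n : ℕ} (z w : EuclideanSpace ℂ (Fin n)) : EuclideanSpace ℂ (Fin n) :=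
  let P : EuclideanSpace ℂ (Fin n) := (inner ℂ z w / ((‖z‖ ^ 2 : ℝ) : ℂ)) • z
  (1 / (1 - inner ℂ z w)) • (z - P - ((Real.sqrt (1 - ‖z‖ ^ 2) : ℝ) : ℂ) • (w - P))

/-- The pseudo-hyperbolic metric `ρ(z, w) = |φ_z(w)|` on the unit ball. -/
def pseudoHyperbolicDist {n : ℕ} (z w : UnitBall n) : ℝ :=
  ‖ballInvolution (z : EuclideanSpace ℂ (Fin n)) (w : EuclideanSpace ℂ (Fin n))‖

/-- The scalar functions on the unit ball which are bounded and uniformly continuous from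
the pseudo-hyperbolic metric to the usual metric of `ℂ`. -/
def boundedUniformAlgebra (n : ℕ) : Set (UnitBall n → ℂ) :=
  {a | (∃ C : ℝ, ∀ z, ‖a z‖ ≤ C) ∧
    ∀ ε > 0, ∃ δ > 0, ∀ z w, pseudoHyperbolicDist z w < δ → ‖a z - a w‖ < ε}

end

noncomputable section
-- A measure that satisfies the Carleson condition gives each hyperbolic box at most a constant
-- times the volume of the box, while a holomorphic function times the Bergman kernel is nearly
-- constant on a small box. Smearing `μ` over boxes of size `r` therefore yields a bounded,
-- uniformly continuous density whose Toeplitz operator differs from `T_μ` by `O(r)`.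
--
-- Write `δ(u) = 1 - |u|²`, `s = n + 1 + α`, `K` for the Bergman kernel. Each entry of `μ` is `h dν`
-- with `ν` its variation and `|h| ≤ 1` (`exists_density`). Testing the Carleson inequality on
-- powers of kernels gives `ν(box at w) ≤ C δ(w)^s` (`IsBergmanCarleson.exists_hypBox_le`). Take
-- probability densities `κ(·, u)` for `v_α`, supported in the box of size `r` at `u`
-- (`exists_isHypBoxMollifier`), and let `B(w) = ∫ κ(w, u) h(u) dν(u)`. Bounds on `κ` and the box
-- estimate put `B` in the algebra (`mem_boundedUniformAlgebra`); these bounds may blow up as `r →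
-- 0`.
--
-- With `φ = f_j K(z, ·)`, Fubini and `∫ κ(w, u) dv_α(w) = 1` turn the difference of the two
-- Toeplitz integrals into `∫∫ (φ(w) - φ(u)) κ(w, u) h(u) dv_α(w) dν(u)`. The mean value property
-- and the Schwarz lemma bound the oscillation of `φ` by `C r δ(u)^(-s) |K(z, u)| ∫ |f_j| dv_α`, the
-- integral being over a box of fixed size at `u` (`exists_enorm_mul_powKernel_sub_le`). Tonelli and
-- the box estimate then eliminate `ν`, leaving `C r ∫ |K(z, x)| |f_j(x)| dv_α(x)`
-- (`lintegral_hypBox_swap_le`). The integral operator with kernel `|K|` is bounded on `L^p` for `1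
-- < p < ∞`, by Schur's test and the Forelli–Rudin estimate (`exists_lintegral_powKernel_rpow_le`),
-- so the operator norm of the difference is `O(r)`.
--
-- Boxes replace pseudo-hyperbolic balls because, for a fixed centre, they are balls of a norm:
-- complex lines through the centre meet them in discs, and they are invariant under multiplication
-- of `w - u` by unimodular scalars. One-variable theorems apply on these lines and no automorphism
-- is needed, except to compare boxes with `ρ`.
-- Unitary coordinates and integrals on the line
-- Complete `e` to an orthonormal basis and separate its first coordinate: the resulting real linear
-- isometry preserves volume. Integrands that depend only on `⟨w, e⟩` and `|w|` are thereby reduced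
-- to one complex variable and a radial variable.
theorem exists_measurePreserving_prod {m : ℕ} (e : EuclideanSpace ℂ (Fin (m + 1))) (he : ‖e‖ = 1) :
    ∃ Φ : EuclideanSpace ℂ (Fin (m + 1)) → ℂ × EuclideanSpace ℂ (Fin m),
      MeasurePreserving Φ ∧ ∀ w, (Φ w).1 = inner ℂ e w ∧ ‖w‖ ^ 2 = ‖(Φ w).1‖ ^ 2 + ‖(Φ w).2‖ ^ 2 := by
  have horth : Orthonormal ℂ (({0} : Set (Fin (m + 1))).domRestrict fun _ => e) := by
    constructor
    · intro i; simpa using he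
    · intro i j hij
      exact absurd (Subsingleton.elim i j) hij
  obtain ⟨b, hb⟩ := horth.exists_orthonormalBasis_extension_of_card_eq (by simp)
  have hb0 : b 0 = e := hb 0 rfl
  have hnorm : ∀ w : EuclideanSpace ℂ (Fin (m + 1)), ‖w‖ ^ 2 = ‖b.repr w 0‖ ^ 2 +
      ‖(WithLp.toLp 2 fun i : Fin m => b.repr w i.succ : EuclideanSpace ℂ (Fin m))‖ ^ 2 := by
    intro w
    rw [← b.repr.norm_map w, EuclideanSpace.norm_sq_eq, EuclideanSpace.norm_sq_eq, Fin.sum_univ_succ]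
  let L : EuclideanSpace ℂ (Fin (m + 1)) →ₗ[ℝ] WithLp 2 (ℂ × EuclideanSpace ℂ (Fin m)) :=
    { toFun := fun w => WithLp.toLp 2 (b.repr w 0, WithLp.toLp 2 fun i : Fin m => b.repr w i.succ)
      map_add' := by
        intro x y
        rw [← WithLp.toLp_add]
        congr 1
        ext <;> simp
      map_smul' := by
        intro c x
        have : b.repr (c • x) = c • b.repr x := by
          have := b.repr.map_smul (c : ℂ) x
          simpa using this
        rw [this]
        rw [RingHom.id_apply, ← WithLp.toLp_smul]
        congr 1 }
  let I : EuclideanSpace ℂ (Fin (m + 1)) →ₗᵢ[ℝ] WithLp 2 (ℂ × EuclideanSpace ℂ (Fin m)) :=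
    { L with
      norm_map' := by
        intro w
        rw [← sq_eq_sq₀ (norm_nonneg _) (norm_nonneg _), hnorm w, WithLp.prod_norm_sq_eq_of_L2]
        rfl }
  have hfin : Module.finrank ℝ (EuclideanSpace ℂ (Fin (m + 1))) =
      Module.finrank ℝ (WithLp 2 (ℂ × EuclideanSpace ℂ (Fin m))) := by
    have h1 : ∀ k, Module.finrank ℝ (EuclideanSpace ℂ (Fin k)) = k * 2 := by
      intro k
      rw [(WithLp.linearEquiv 2 ℝ (Fin k → ℂ)).finrank_eq, Module.finrank_pi_fintype]
      simp
    rw [(WithLp.linearEquiv 2 ℝ (ℂ × EuclideanSpace ℂ (Fin m))).finrank_eq, Module.finrank_prod,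
      h1, h1]
    simp; ring
  let J := I.toLinearIsometryEquiv hfin
  refine ⟨fun w => WithLp.ofLp (J w),
    (WithLp.volume_preserving_ofLp ℂ (EuclideanSpace ℂ (Fin m))).comp J.measurePreserving, ?_⟩
  intro w
  refine ⟨?_, hnorm w⟩
  change b.repr w 0 = _
  rw [b.repr_apply_apply, hb0]

theorem lintegral_Ioo_comp_sub_left (a : ℝ) (f : ℝ → ℝ≥0∞) :
    ∫⁻ x in Set.Ioo 0 a, f (a - x) = ∫⁻ x in Set.Ioo 0 a, f x := by
  have h := (Measure.measurePreserving_sub_left (volume : Measure ℝ) a).setLIntegral_comp_preimage_emb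
    (MeasurableEquiv.subLeft a).measurableEmbedding f (Set.Ioo 0 a)
  simpa using h

theorem lintegral_Ioo_rpow {a b : ℝ} (ha : 0 ≤ a) (hb : -1 < b) :
    ∫⁻ x in Set.Ioo 0 a, ENNReal.ofReal (x ^ b) = ENNReal.ofReal (a ^ (b + 1) / (b + 1)) := by
  have hint : IntervalIntegrable (fun x : ℝ => x ^ b) volume 0 a :=
    intervalIntegral.intervalIntegrable_rpow' hb
  rw [intervalIntegrable_iff_integrableOn_Ioo_of_le ha] at hint
  rw [← ofReal_integral_eq_lintegral_ofReal hint, ← integral_Ioc_eq_integral_Ioo,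
    ← intervalIntegral.integral_of_le ha, integral_rpow (Or.inl hb)]
  · rw [Real.zero_rpow (by linarith), sub_zero]
  · filter_upwards [ae_restrict_mem measurableSet_Ioo] with x hx
    exact Real.rpow_nonneg hx.1.le _

theorem lintegral_Ioi_rpow_neg {a κ : ℝ} (ha : 0 < a) (hκ : 1 < κ) :
    ∫⁻ x in Set.Ioi a, ENNReal.ofReal (x ^ (-κ)) = ENNReal.ofReal (a ^ (1 - κ) / (κ - 1)) := by
  rw [← ofReal_integral_eq_lintegral_ofReal (integrableOn_Ioi_rpow_of_lt (by linarith) ha),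
    integral_Ioi_rpow_of_lt (by linarith) ha]
  · congr 1
    rw [show -κ + 1 = -(κ - 1) by ring, div_neg, neg_div, neg_neg, neg_sub]
  · filter_upwards [ae_restrict_mem measurableSet_Ioi] with x hx
    exact Real.rpow_nonneg (ha.trans hx).le _

theorem lintegral_add_abs_rpow_neg {a κ : ℝ} (ha : 0 < a) (hκ : 1 < κ) :
    ∫⁻ θ : ℝ, ENNReal.ofReal ((a + |θ|) ^ (-κ)) ≤ 2 * ENNReal.ofReal (a ^ (1 - κ) / (κ - 1)) := by
  have hpos : ∫⁻ θ in Set.Ioi (0 : ℝ), ENNReal.ofReal ((a + |θ|) ^ (-κ)) =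
      ENNReal.ofReal (a ^ (1 - κ) / (κ - 1)) := by
    rw [← lintegral_Ioi_rpow_neg ha hκ]
    have h := (measurePreserving_add_left (volume : Measure ℝ) a).setLIntegral_comp_preimage_emb
      (MeasurableEquiv.addLeft a).measurableEmbedding (fun x => ENNReal.ofReal (x ^ (-κ)))
      (Set.Ioi a)
    rw [← h]
    have : (fun x => a + x) ⁻¹' Set.Ioi a = Set.Ioi 0 := by ext; simp
    rw [this]
    refine setLIntegral_congr_fun measurableSet_Ioi fun x hx => ?_
    simp [abs_of_pos (Set.mem_Ioi.1 hx)]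
  have hneg : ∫⁻ θ in Set.Iio (0 : ℝ), ENNReal.ofReal ((a + |θ|) ^ (-κ)) =
      ENNReal.ofReal (a ^ (1 - κ) / (κ - 1)) := by
    rw [← hpos]
    have h := (Measure.measurePreserving_neg (volume : Measure ℝ)).setLIntegral_comp_preimage_emb
      (MeasurableEquiv.neg ℝ).measurableEmbedding (fun x => ENNReal.ofReal ((a + |x|) ^ (-κ)))
      (Set.Ioi 0)
    rw [← h]
    simp
  rw [← setLIntegral_univ, ← Set.Iio_union_Ici (a := (0 : ℝ))]
  refine (lintegral_union_le _ _ _).trans ?_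
  rw [hneg, setLIntegral_congr Ioi_ae_eq_Ici.symm, hpos, two_mul]

/-- Split at `ε`: below it the maximum is the constant `ε`, above it is `x`. The exponents are
balanced so that both pieces are multiples of `ε ^ (-t)`. -/
theorem lintegral_rpow_mul_max_rpow {b t ε : ℝ} (hb : -1 < b) (ht : 0 < t) (hε : 0 < ε) :
    ∫⁻ x in Set.Ioi 0, ENNReal.ofReal (x ^ b * (max x ε) ^ (-(1 + b + t))) ≤
      ENNReal.ofReal ((1 / (b + 1) + 1 / t) * ε ^ (-t)) := by
  have h1 : ∫⁻ x in Set.Ioo 0 ε, ENNReal.ofReal (x ^ b * (max x ε) ^ (-(1 + b + t))) =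
      ENNReal.ofReal (1 / (b + 1) * ε ^ (-t)) := by
    have : ∫⁻ x in Set.Ioo 0 ε, ENNReal.ofReal (x ^ b * (max x ε) ^ (-(1 + b + t))) =
        ∫⁻ x in Set.Ioo 0 ε, ENNReal.ofReal (x ^ b) * ENNReal.ofReal (ε ^ (-(1 + b + t))) := by
      refine setLIntegral_congr_fun measurableSet_Ioo fun x hx => ?_
      rw [max_eq_right hx.2.le, ENNReal.ofReal_mul (Real.rpow_nonneg hx.1.le _)]
    rw [this, lintegral_mul_const' _ _ ENNReal.ofReal_ne_top, lintegral_Ioo_rpow hε.le hb,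
      ← ENNReal.ofReal_mul (div_nonneg (Real.rpow_nonneg hε.le _) (by linarith))]
    congr 1
    rw [div_mul_eq_mul_div, ← Real.rpow_add hε, one_div_mul_eq_div]
    ring_nf
  have h2 : ∫⁻ x in Set.Ioi ε, ENNReal.ofReal (x ^ b * (max x ε) ^ (-(1 + b + t))) =
      ENNReal.ofReal (1 / t * ε ^ (-t)) := by
    have : ∫⁻ x in Set.Ioi ε, ENNReal.ofReal (x ^ b * (max x ε) ^ (-(1 + b + t))) =
        ∫⁻ x in Set.Ioi ε, ENNReal.ofReal (x ^ (-(1 + t))) := by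
      refine setLIntegral_congr_fun measurableSet_Ioi fun x hx => ?_
      rw [max_eq_left (le_of_lt hx), ← Real.rpow_add (hε.trans hx)]
      ring_nf
    rw [this, lintegral_Ioi_rpow_neg hε (by linarith)]
    congr 1
    rw [show 1 - (1 + t) = -t by ring, show 1 + t - 1 = t by ring]
    ring
  calc _ ≤ ∫⁻ x in Set.Ioo 0 ε ∪ Set.Ici ε,
        ENNReal.ofReal (x ^ b * (max x ε) ^ (-(1 + b + t))) := by
        refine lintegral_mono_set fun x hx => ?_
        rcases lt_or_ge x ε with h | h
        · exact Or.inl ⟨hx, h⟩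
        · exact Or.inr h
    _ ≤ _ := (lintegral_union_le _ _ _).trans (le_of_eq ?_)
  rw [h1, setLIntegral_congr Ioi_ae_eq_Ici.symm, h2, ← ENNReal.ofReal_add, add_mul]
  · have := Real.rpow_nonneg hε.le (-t)
    have : 0 < b + 1 := by linarith
    positivity
  · positivity

/-! ### Integrals over the disc in polar coordinates -/

theorem lintegral_complex_eq_polar {f : ℂ → ℝ≥0∞} (hf : Measurable f) :
    ∫⁻ ζ, f ζ = ∫⁻ ρ in Set.Ioi (0 : ℝ), ENNReal.ofReal ρ *
      ∫⁻ θ in Set.Ioo (-Real.pi) Real.pi, f (Complex.polarCoord.symm (ρ, θ)) := by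
  rw [← Complex.lintegral_comp_polarCoord_symm, polarCoord_target, Measure.volume_eq_prod,
    ← Measure.prod_restrict, lintegral_prod]
  · refine lintegral_congr fun ρ => ?_
    simp only [smul_eq_mul]
    rw [lintegral_const_mul' _ _ ENNReal.ofReal_ne_top]
  · refine Measurable.aemeasurable ?_
    have : Measurable fun p : ℝ × ℝ => Complex.polarCoord.symm p := by
      simp only [Complex.polarCoord_symm_apply]
      fun_prop
    exact (measurable_fst.ennreal_ofReal).smul (hf.comp this)

/-- Quantities comparable within a factor 2 have comparable powers; `|b|` covers both signs of the
exponent. -/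
theorem rpow_le_two_rpow_abs_mul {a x b : ℝ} (ha : 0 < a) (h1 : a / 2 ≤ x) (h2 : x ≤ 2 * a) :
    x ^ b ≤ 2 ^ |b| * a ^ b := by
  have hx : 0 < x := by linarith
  have key : (x / a) ^ b ≤ 2 ^ |b| := by
    rcases le_total 0 b with hb | hb
    · rw [abs_of_nonneg hb]
      exact Real.rpow_le_rpow (by positivity) (by rw [div_le_iff₀ ha]; linarith) hb
    · rw [abs_of_nonpos hb, Real.rpow_neg (by norm_num), ← Real.inv_rpow (by norm_num)]
      exact Real.rpow_le_rpow_of_nonpos (by norm_num) (by rw [le_div_iff₀ ha]; linarith) hb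
  calc x ^ b = (x / a) ^ b * a ^ b := by
        rw [← Real.mul_rpow (by positivity) ha.le, div_mul_cancel₀ _ ha.ne']
    _ ≤ _ := by gcongr

theorem sub_sq_rpow_le {a ρ b : ℝ} (hρ : 0 < ρ) (hρa : ρ < a) :
    (a ^ 2 - ρ ^ 2) ^ b ≤ 2 ^ |b| * a ^ b * (a - ρ) ^ b := by
  rw [show a ^ 2 - ρ ^ 2 = (a + ρ) * (a - ρ) by ring,
    Real.mul_rpow (by linarith) (by linarith)]
  have := Real.rpow_nonneg (sub_nonneg.2 hρa.le) b
  gcongr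
  exact rpow_le_two_rpow_abs_mul (hρ.trans hρa) (by linarith) (by linarith)

theorem lintegral_disc_rpow_le {b : ℝ} (hb : -1 < b) {R : ℝ} (hR : 0 < R) :
    ∫⁻ ζ in {ζ : ℂ | ‖ζ‖ ^ 2 < R}, ENNReal.ofReal ((R - ‖ζ‖ ^ 2) ^ b) ≤
      ENNReal.ofReal (2 * Real.pi * 2 ^ |b| / (b + 1) * R ^ (b + 1)) := by
  have hms : MeasurableSet {ζ : ℂ | ‖ζ‖ ^ 2 < R} :=
    measurableSet_lt (by fun_prop) measurable_const
  obtain ⟨a, ha, rfl⟩ : ∃ a : ℝ, 0 < a ∧ R = a ^ 2 :=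
    ⟨√R, Real.sqrt_pos.2 hR, (Real.sq_sqrt hR.le).symm⟩
  have hb1 : 0 < b + 1 := by linarith
  rw [← lintegral_indicator hms, lintegral_complex_eq_polar
    (Measurable.indicator (by fun_prop) hms)]
  calc _ ≤ ∫⁻ ρ in Set.Ioi (0 : ℝ), (Set.Ioo 0 a).indicator (fun ρ =>
          ENNReal.ofReal (2 * Real.pi * 2 ^ |b| * a ^ (b + 1)) *
            ENNReal.ofReal ((a - ρ) ^ b)) ρ := by
        refine setLIntegral_mono' measurableSet_Ioi fun ρ hρ => ?_
        have hρ : 0 < ρ := hρ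
        have hnorm : ∀ θ, ‖Complex.polarCoord.symm (ρ, θ)‖ = ρ := fun θ => by
          rw [Complex.norm_polarCoord_symm, abs_of_pos hρ]
        by_cases hρa : ρ < a
        · rw [Set.indicator_of_mem (by exact ⟨hρ, hρa⟩)]
          have : ∀ θ, Complex.polarCoord.symm (ρ, θ) ∈ {ζ : ℂ | ‖ζ‖ ^ 2 < a ^ 2} := fun θ => by
            rw [Set.mem_ofPred_eq, hnorm]
            gcongr
          simp only [Set.indicator_of_mem (this _), hnorm]
          rw [setLIntegral_const, Real.volume_Ioo, ← ENNReal.ofReal_mul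
            (Real.rpow_nonneg (by nlinarith) _), ← ENNReal.ofReal_mul hρ.le,
            ← ENNReal.ofReal_mul (by positivity)]
          refine ENNReal.ofReal_le_ofReal ?_
          have h1 := sub_sq_rpow_le (b := b) hρ hρa
          have h2 := Real.rpow_nonneg (sub_nonneg.2 hρa.le) b
          calc ρ * ((a ^ 2 - ρ ^ 2) ^ b * (Real.pi - -Real.pi))
              ≤ a * ((2 ^ |b| * a ^ b * (a - ρ) ^ b) * (Real.pi - -Real.pi)) := by
                have : 0 ≤ (a ^ 2 - ρ ^ 2) ^ b := Real.rpow_nonneg (by nlinarith) _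
                have : 0 < Real.pi := Real.pi_pos
                have : 0 ≤ Real.pi - -Real.pi := by linarith
                gcongr
            _ = _ := by rw [Real.rpow_add ha, Real.rpow_one]; ring
        · have : ∀ θ, Complex.polarCoord.symm (ρ, θ) ∉ {ζ : ℂ | ‖ζ‖ ^ 2 < a ^ 2} := fun θ => by
            rw [Set.mem_ofPred_eq, hnorm, not_lt]
            have := not_lt.1 hρa
            gcongr
          simp only [Set.indicator_of_notMem (this _), lintegral_zero, mul_zero, zero_le]
    _ ≤ ∫⁻ ρ in Set.Ioo 0 a, ENNReal.ofReal (2 * Real.pi * 2 ^ |b| * a ^ (b + 1)) *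
            ENNReal.ofReal ((a - ρ) ^ b) := by
        rw [← lintegral_indicator measurableSet_Ioo]
        exact setLIntegral_le_lintegral _ _
    _ = _ := by
        rw [lintegral_const_mul' _ _ ENNReal.ofReal_ne_top,
          lintegral_Ioo_comp_sub_left a fun x => ENNReal.ofReal (x ^ b),
          lintegral_Ioo_rpow ha.le hb, ← ENNReal.ofReal_mul (by positivity)]
        congr 1
        rw [← Real.rpow_natCast a 2, ← Real.rpow_mul ha.le, mul_comm _ (b + 1), Real.rpow_mul ha.le,
          Real.rpow_natCast]
        ring

/-- The identity `|1 - x e^{iθ}|² = (1 - x)² + 4 x sin²(θ/2)` and Jordan's inequality `|sin(θ/2)| ≥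
|θ|/π ≥ |θ|/4` show that the distance to 1 is of order `(1 - x) + |θ|`. -/
theorem one_sub_add_abs_le {x θ : ℝ} (hx : 0 ≤ x) (hx1 : x ≤ 1) (hθ : θ ∈ Set.Ioo (-Real.pi) Real.pi) :
    (1 - x + |θ|) / 10 ≤ ‖1 - Complex.polarCoord.symm (x, θ)‖ := by
  have hsq : ‖1 - Complex.polarCoord.symm (x, θ)‖ ^ 2 = (1 - x) ^ 2 + 4 * x * Real.sin (θ / 2) ^ 2 := by
    rw [Complex.polarCoord_symm_apply, ← Complex.normSq_eq_norm_sq, Complex.normSq_apply]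
    simp [-Complex.ofReal_cos, -Complex.ofReal_sin]
    have h1 : Real.cos θ = 1 - 2 * Real.sin (θ / 2) ^ 2 := by
      have := Real.cos_sq' (θ / 2)
      have h2 := Real.cos_two_mul (θ / 2)
      rw [show 2 * (θ / 2) = θ by ring] at h2
      rw [h2, this]; ring
    have h3 := Real.sin_sq_add_cos_sq θ
    calc _ = 1 - 2 * x * Real.cos θ + x ^ 2 * (Real.sin θ ^ 2 + Real.cos θ ^ 2) := by ring
      _ = _ := by rw [h3, h1]; ring
  have habs : |θ| < Real.pi := abs_lt.2 hθ
  have hpi : Real.pi < 4 := Real.pi_lt_four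
  refine le_of_sq_le_sq ?_ (norm_nonneg _)
  rw [hsq]
  have hs : (|θ| / 4) ^ 2 ≤ Real.sin (θ / 2) ^ 2 := by
    rw [← sq_abs (Real.sin (θ / 2))]
    have : |θ| / 4 ≤ |Real.sin (θ / 2)| := by
      have h := Real.mul_abs_le_abs_sin (x := θ / 2) (by rw [abs_div, abs_two]; linarith)
      refine le_trans ?_ h
      rw [abs_div, abs_two, div_mul_div_comm, div_le_div_iff₀ (by norm_num) (by positivity)]
      nlinarith [abs_nonneg θ]
    gcongr
  have hθ0 := abs_nonneg θ
  -- For `x ≤ 1/2` the term `1 - x ≥ 1/2` alone dominates, as `|θ| < 4`; for `x ≥ 1/2` the sine term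
  -- controls `|θ|`.
  rcases le_total x (1 / 2) with h | h
  · have : (1 - x + |θ|) / 10 ≤ 1 - x := by linarith
    nlinarith [mul_nonneg hx (sq_nonneg (Real.sin (θ / 2)))]
  · have : 4 * x * Real.sin (θ / 2) ^ 2 ≥ 2 * (|θ| / 4) ^ 2 := by nlinarith
    nlinarith [sq_nonneg (1 - x - |θ|)]

/-- The angular integral of `(1 - rρ + |θ|) ^ (-κ)` costs one power and leaves `(1 - rρ) ^ (1 - κ)`.
What remains is a radial integral of the form treated in `lintegral_rpow_mul_max_rpow`, with `ε = 1
- r`. -/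
theorem lintegral_disc_forelliRudin {b t : ℝ} (hb : -1 < b) (ht : 0 < t) :
    ∃ C : ℝ, 0 ≤ C ∧ ∀ r : ℝ, 0 ≤ r → r < 1 →
      ∫⁻ ζ in {ζ : ℂ | ‖ζ‖ ^ 2 < 1}, ENNReal.ofReal ((1 - ‖ζ‖ ^ 2) ^ b *
        ‖1 - r * ζ‖ ^ (-(2 + b + t))) ≤ ENNReal.ofReal (C * (1 - r) ^ (-t)) := by
  have hms : MeasurableSet {ζ : ℂ | ‖ζ‖ ^ 2 < 1} :=
    measurableSet_lt (by fun_prop) measurable_const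
  set κ := 2 + b + t with hκdef
  have hκ : 1 < κ := by linarith
  have hb1 : 0 < b + 1 := by linarith
  set A : ℝ := 2 ^ |b| * 10 ^ κ * 2 / (κ - 1) with hA
  have hA0 : 0 ≤ A := by
    have : 0 < κ - 1 := by linarith
    positivity
  refine ⟨A * (1 / (b + 1) + 1 / t), by positivity, fun r hr hr1 => ?_⟩
  rw [← lintegral_indicator hms, lintegral_complex_eq_polar
    (Measurable.indicator (by fun_prop) hms)]
  calc _ ≤ ∫⁻ ρ in Set.Ioi (0 : ℝ), (Set.Ioo 0 1).indicator (fun ρ =>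
          ENNReal.ofReal A *
            ENNReal.ofReal ((1 - ρ) ^ b * (max (1 - ρ) (1 - r)) ^ (-(1 + b + t)))) ρ := by
        refine setLIntegral_mono' measurableSet_Ioi fun ρ hρ => ?_
        have hρ : 0 < ρ := hρ
        have hnorm : ∀ θ, ‖Complex.polarCoord.symm (ρ, θ)‖ = ρ := fun θ => by
          rw [Complex.norm_polarCoord_symm, abs_of_pos hρ]
        by_cases hρa : ρ < 1
        · rw [Set.indicator_of_mem (by exact ⟨hρ, hρa⟩)]
          have : ∀ θ, Complex.polarCoord.symm (ρ, θ) ∈ {ζ : ℂ | ‖ζ‖ ^ 2 < 1} := fun θ => by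
            rw [Set.mem_ofPred_eq, hnorm]
            nlinarith
          simp only [Set.indicator_of_mem (this _), hnorm]
          have hrρ : r * ρ < 1 := by nlinarith
          have hpos : 0 < 1 - r * ρ := by linarith
          have hsub : 0 ≤ (1 - ρ ^ 2) ^ b := Real.rpow_nonneg (by nlinarith) _
          have hsub1 := Real.rpow_nonneg (sub_nonneg.2 hρa.le) b
          have hinner : ∫⁻ θ in Set.Ioo (-Real.pi) Real.pi, ENNReal.ofReal ((1 - ρ ^ 2) ^ b *
              ‖1 - r * Complex.polarCoord.symm (ρ, θ)‖ ^ (-κ)) ≤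
              ENNReal.ofReal ((1 - ρ ^ 2) ^ b * 10 ^ κ) *
                (2 * ENNReal.ofReal ((1 - r * ρ) ^ (1 - κ) / (κ - 1))) := by
            refine le_trans ?_ (mul_le_mul_right (lintegral_add_abs_rpow_neg hpos hκ) _)
            rw [← lintegral_const_mul' _ _ ENNReal.ofReal_ne_top]
            refine le_trans (setLIntegral_mono' measurableSet_Ioo fun θ hθ => ?_)
              (setLIntegral_le_lintegral _ _)
            rw [← ENNReal.ofReal_mul (by positivity)]
            refine ENNReal.ofReal_le_ofReal ?_
            have h := one_sub_add_abs_le (x := r * ρ) (by positivity) hrρ.le hθ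
            have e : Complex.polarCoord.symm (r * ρ, θ) = r * Complex.polarCoord.symm (ρ, θ) := by
              simp only [Complex.polarCoord_symm_apply]
              push_cast
              ring
            rw [e] at h
            have h0 : 0 < 1 - r * ρ + |θ| := by positivity
            rw [mul_assoc]
            refine mul_le_mul_of_nonneg_left ?_ hsub
            calc _ ≤ ((1 - r * ρ + |θ|) / 10) ^ (-κ) :=
                  Real.rpow_le_rpow_of_nonpos (by positivity) h (by linarith)
              _ = _ := by
                  rw [Real.div_rpow h0.le (by norm_num), Real.rpow_neg (by norm_num : (0:ℝ) ≤ 10)]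
                  field_simp
          calc _ ≤ ENNReal.ofReal ρ * (ENNReal.ofReal ((1 - ρ ^ 2) ^ b * 10 ^ κ) *
                (2 * ENNReal.ofReal ((1 - r * ρ) ^ (1 - κ) / (κ - 1)))) := by gcongr
            _ = ENNReal.ofReal (ρ * (((1 - ρ ^ 2) ^ b * 10 ^ κ) *
                (2 * ((1 - r * ρ) ^ (1 - κ) / (κ - 1))))) := by
                rw [ENNReal.ofReal_mul hρ.le,
                  ENNReal.ofReal_mul (p := (1 - ρ ^ 2) ^ b * 10 ^ κ) (by positivity),
                  ENNReal.ofReal_mul (p := 2) (by norm_num), ENNReal.ofReal_ofNat]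
            _ ≤ ENNReal.ofReal (A * ((1 - ρ) ^ b *
                  (max (1 - ρ) (1 - r)) ^ (-(1 + b + t)))) := by
                refine ENNReal.ofReal_le_ofReal ?_
                have h1 := sub_sq_rpow_le (b := b) hρ hρa
                simp only [one_pow, Real.one_rpow, mul_one] at h1
                -- `1 - rρ` is at least both `1 - ρ` and `1 - r`, and the exponent is negative.
                have h2 : (1 - r * ρ) ^ (1 - κ) ≤ (max (1 - ρ) (1 - r)) ^ (-(1 + b + t)) := by
                  rw [show 1 - κ = -(1 + b + t) by rw [hκdef]; ring]
                  refine Real.rpow_le_rpow_of_nonpos (lt_max_of_lt_left (by linarith)) ?_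
                    (by linarith)
                  exact max_le (by nlinarith) (by nlinarith)
                have h3 : 0 ≤ (1 - r * ρ) ^ (1 - κ) := Real.rpow_nonneg hpos.le _
                have h4 : 0 < κ - 1 := by linarith
                calc _ ≤ 1 * (((2 ^ |b| * (1 - ρ) ^ b) * 10 ^ κ) *
                    (2 * ((max (1 - ρ) (1 - r)) ^ (-(1 + b + t)) / (κ - 1)))) := by
                      gcongr
                  _ = _ := by rw [hA]; ring
            _ = _ := ENNReal.ofReal_mul hA0
        · have : ∀ θ, Complex.polarCoord.symm (ρ, θ) ∉ {ζ : ℂ | ‖ζ‖ ^ 2 < 1} := fun θ => by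
            rw [Set.mem_ofPred_eq, hnorm, not_lt]
            nlinarith
          simp only [Set.indicator_of_notMem (this _), lintegral_zero, mul_zero, zero_le]
    _ ≤ ∫⁻ ρ in Set.Ioo 0 1, ENNReal.ofReal A *
            ENNReal.ofReal ((1 - ρ) ^ b * (max (1 - ρ) (1 - r)) ^ (-(1 + b + t))) := by
        rw [← lintegral_indicator measurableSet_Ioo]
        exact setLIntegral_le_lintegral _ _
    _ ≤ _ := by
        rw [lintegral_const_mul' _ _ ENNReal.ofReal_ne_top, lintegral_Ioo_comp_sub_left 1
          fun x => ENNReal.ofReal (x ^ b * (max x (1 - r)) ^ (-(1 + b + t))), mul_assoc,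
          ENNReal.ofReal_mul hA0]
        gcongr
        exact (lintegral_mono_set Set.Ioo_subset_Ioi_self).trans
          (lintegral_rpow_mul_max_rpow hb ht (by linarith))

/-! ### Integrals over the ball by slicing -/

/-- Induction on the dimension. Over a fixed first coordinate `ζ` the slice is a ball of squared
radius `R - |ζ|²`, so the induction hypothesis gives a disc integral of `(R - |ζ|²) ^ (β + m)`,
which adds one more power of `R`. -/
theorem lintegral_ball_rpow_le (m : ℕ) {β : ℝ} (hβ : -1 < β) :
    ∃ C : ℝ, 0 ≤ C ∧ ∀ R : ℝ, 0 < R →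
      ∫⁻ w in {w : EuclideanSpace ℂ (Fin m) | ‖w‖ ^ 2 < R}, ENNReal.ofReal ((R - ‖w‖ ^ 2) ^ β) ≤
        ENNReal.ofReal (C * R ^ (β + m)) := by
  induction m with
  | zero =>
    refine ⟨(volume : Measure (EuclideanSpace ℂ (Fin 0))).real Set.univ, measureReal_nonneg,
      fun R hR => (setLIntegral_le_lintegral _ _).trans (le_of_eq ?_)⟩
    have hfin : (volume : Measure (EuclideanSpace ℂ (Fin 0))) Set.univ ≠ ∞ :=
      (isCompact_univ.measure_lt_top).ne
    have : ∀ w : EuclideanSpace ℂ (Fin 0), ENNReal.ofReal ((R - ‖w‖ ^ 2) ^ β) =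
        ENNReal.ofReal (R ^ β) := fun w => by simp [Subsingleton.elim w 0]
    simp_rw [this]
    rw [lintegral_const, mul_comm, ENNReal.ofReal_mul measureReal_nonneg, ofReal_measureReal]
    simp
  | succ m ih =>
    obtain ⟨C, hC, ih⟩ := ih
    have hb : -1 < β + m := by have : (0 : ℝ) ≤ m := m.cast_nonneg; linarith
    have hb1 : 0 < β + m + 1 := by linarith
    refine ⟨C * (2 * Real.pi * 2 ^ |β + m| / (β + m + 1)), by positivity, fun R hR => ?_⟩
    obtain ⟨Φ, hΦ, hΦw⟩ := exists_measurePreserving_prod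
      (EuclideanSpace.single (0 : Fin (m + 1)) (1 : ℂ)) (by simp)
    have hms : MeasurableSet {q : ℂ × EuclideanSpace ℂ (Fin m) | ‖q.1‖ ^ 2 + ‖q.2‖ ^ 2 < R} :=
      measurableSet_lt (by fun_prop) measurable_const
    have hmeas : Measurable fun q : ℂ × EuclideanSpace ℂ (Fin m) =>
      {q : ℂ × EuclideanSpace ℂ (Fin m) | ‖q.1‖ ^ 2 + ‖q.2‖ ^ 2 < R}.indicator
        (fun q => ENNReal.ofReal ((R - (‖q.1‖ ^ 2 + ‖q.2‖ ^ 2)) ^ β)) q :=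
      Measurable.indicator (by fun_prop) hms
    have hpre : {w : EuclideanSpace ℂ (Fin (m + 1)) | ‖w‖ ^ 2 < R} =
        Φ ⁻¹' {q | ‖q.1‖ ^ 2 + ‖q.2‖ ^ 2 < R} := by
      ext w; simp [(hΦw w).2]
    calc _ = ∫⁻ w, (fun q => {q : ℂ × EuclideanSpace ℂ (Fin m) |
            ‖q.1‖ ^ 2 + ‖q.2‖ ^ 2 < R}.indicator
            (fun q => ENNReal.ofReal ((R - (‖q.1‖ ^ 2 + ‖q.2‖ ^ 2)) ^ β)) q) (Φ w) := by
          rw [hpre, ← lintegral_indicator (hΦ.measurable hms)]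
          refine lintegral_congr fun w => ?_
          beta_reduce
          rw [← Set.indicator_comp_right]
          refine congrFun (congrArg _ (funext fun x => ?_)) w
          simp only [Function.comp, (hΦw x).2]
      _ = ∫⁻ ζ : ℂ, ∫⁻ w : EuclideanSpace ℂ (Fin m),
            {q : ℂ × EuclideanSpace ℂ (Fin m) | ‖q.1‖ ^ 2 + ‖q.2‖ ^ 2 < R}.indicator
            (fun q => ENNReal.ofReal ((R - (‖q.1‖ ^ 2 + ‖q.2‖ ^ 2)) ^ β)) (ζ, w) := by
          rw [hΦ.lintegral_comp hmeas, Measure.volume_eq_prod, lintegral_prod _ hmeas.aemeasurable]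
      _ ≤ ∫⁻ ζ : ℂ, {ζ : ℂ | ‖ζ‖ ^ 2 < R}.indicator
            (fun ζ => ENNReal.ofReal C * ENNReal.ofReal ((R - ‖ζ‖ ^ 2) ^ (β + m))) ζ := by
          refine lintegral_mono fun ζ => ?_
          by_cases hζ : ‖ζ‖ ^ 2 < R
          · rw [Set.indicator_of_mem (by exact hζ), ← ENNReal.ofReal_mul hC]
            refine le_trans (le_of_eq ?_) (ih (R - ‖ζ‖ ^ 2) (by linarith))
            rw [← lintegral_indicator (measurableSet_lt (by fun_prop) measurable_const)]
            refine lintegral_congr fun w => ?_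
            simp only [Set.indicator_apply, Set.mem_ofPred_eq, lt_sub_iff_add_lt']
            simp only [sub_add_eq_sub_sub]
          · have : ∀ w : EuclideanSpace ℂ (Fin m),
                (ζ, w) ∉ {q : ℂ × EuclideanSpace ℂ (Fin m) | ‖q.1‖ ^ 2 + ‖q.2‖ ^ 2 < R} := by
              intro w
              simp only [Set.mem_ofPred_eq, not_lt]
              nlinarith [sq_nonneg ‖w‖]
            simp only [Set.indicator_of_notMem (this _), lintegral_zero, zero_le]
      _ ≤ _ := by
          rw [lintegral_indicator (measurableSet_lt (by fun_prop) measurable_const),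
            lintegral_const_mul' _ _ ENNReal.ofReal_ne_top, mul_assoc, ENNReal.ofReal_mul hC]
          gcongr
          refine (lintegral_disc_rpow_le hb hR).trans (le_of_eq ?_)
          push_cast
          ring_nf

/-- The **Forelli–Rudin estimate** on the unit ball. -/
theorem lintegral_ball_forelliRudin {n : ℕ} (hn : 1 ≤ n) {β t : ℝ} (hβ : -1 < β) (ht : 0 < t) :
    ∃ C : ℝ, 0 ≤ C ∧ ∀ z : EuclideanSpace ℂ (Fin n), ‖z‖ < 1 →
      ∫⁻ w in Metric.ball 0 1, ENNReal.ofReal ((1 - ‖w‖ ^ 2) ^ β *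
        ‖1 - inner ℂ z w‖ ^ (-(n + 1 + β + t))) ≤ ENNReal.ofReal (C * (1 - ‖z‖ ^ 2) ^ (-t)) := by
  obtain ⟨m, rfl⟩ : ∃ m, n = m + 1 := ⟨n - 1, by omega⟩
  have hb : -1 < β + m := by have : (0 : ℝ) ≤ m := m.cast_nonneg; linarith
  obtain ⟨C₁, hC₁, h₁⟩ := lintegral_ball_rpow_le m hβ
  obtain ⟨C₂, hC₂, h₂⟩ := lintegral_disc_forelliRudin hb ht
  refine ⟨C₁ * C₂ * 2 ^ t, by positivity, fun z hz => ?_⟩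
  -- Choose `e` in the direction of `z`, so that the kernel depends on `w` only through its
  -- coordinate along `e`.
  obtain ⟨e, he, hze⟩ : ∃ e : EuclideanSpace ℂ (Fin (m + 1)), ‖e‖ = 1 ∧ z = (‖z‖ : ℂ) • e := by
    by_cases h0 : z = 0
    · exact ⟨EuclideanSpace.single 0 1, by simp, by simp [h0]⟩
    · have : (‖z‖ : ℂ) ≠ 0 := by simpa using h0
      exact ⟨(‖z‖ : ℂ)⁻¹ • z, by simp [norm_smul, h0], by rw [smul_smul, mul_inv_cancel₀ this, one_smul]⟩
  obtain ⟨Φ, hΦ, hΦw⟩ := exists_measurePreserving_prod e he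
  set r := ‖z‖
  have hinner : ∀ w, inner ℂ z w = r * (Φ w).1 := fun w => by
    rw [(hΦw w).1, hze, inner_smul_left, Complex.conj_ofReal]
  set κ := ((m + 1 : ℕ) : ℝ) + 1 + β + t with hκ
  set S : Set (ℂ × EuclideanSpace ℂ (Fin m)) := {q | ‖q.1‖ ^ 2 + ‖q.2‖ ^ 2 < 1} with hS
  have hms : MeasurableSet S := measurableSet_lt (by fun_prop) measurable_const
  set G : ℂ × EuclideanSpace ℂ (Fin m) → ℝ≥0∞ := S.indicator fun q =>
    ENNReal.ofReal ((1 - (‖q.1‖ ^ 2 + ‖q.2‖ ^ 2)) ^ β * ‖1 - r * q.1‖ ^ (-κ)) with hG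
  have hmeas : Measurable G := Measurable.indicator (by fun_prop) hms
  have hpre : Metric.ball (0 : EuclideanSpace ℂ (Fin (m + 1))) 1 = Φ ⁻¹' S := by
    ext w
    simp only [mem_ball_zero_iff, hS, Set.mem_preimage, Set.mem_ofPred_eq, ← (hΦw w).2]
    rw [sq_lt_one_iff₀ (norm_nonneg _)]
  calc _ = ∫⁻ w, G (Φ w) := by
        rw [hpre, ← lintegral_indicator (hΦ.measurable hms)]
        refine lintegral_congr fun w => ?_
        rw [hG, ← Set.indicator_comp_right]
        refine congrFun (congrArg _ (funext fun x => ?_)) w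
        simp only [Function.comp, (hΦw x).2, hinner]
    _ = ∫⁻ ζ : ℂ, ∫⁻ w : EuclideanSpace ℂ (Fin m), G (ζ, w) := by
        rw [hΦ.lintegral_comp hmeas, Measure.volume_eq_prod, lintegral_prod _ hmeas.aemeasurable]
    -- Integrating out the other `m` coordinates raises the weight exponent to `β + m`, and `2 + (β
    -- + m) + t` is the given kernel exponent: this is the disc estimate.
    _ ≤ ∫⁻ ζ : ℂ, {ζ : ℂ | ‖ζ‖ ^ 2 < 1}.indicator (fun ζ => ENNReal.ofReal C₁ *
          ENNReal.ofReal ((1 - ‖ζ‖ ^ 2) ^ (β + m) * ‖1 - r * ζ‖ ^ (-(2 + (β + m) + t)))) ζ := by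
        refine lintegral_mono fun ζ => ?_
        by_cases hζ : ‖ζ‖ ^ 2 < 1
        · have hpos : 0 < 1 - ‖ζ‖ ^ 2 := by linarith
          have hn0 : (0 : ℝ) ≤ ‖1 - r * ζ‖ ^ (-κ) := Real.rpow_nonneg (norm_nonneg _) _
          rw [Set.indicator_of_mem (by exact hζ), show 2 + (β + m) + t = κ by
            rw [hκ]; push_cast; ring, ← ENNReal.ofReal_mul hC₁, ← mul_assoc,
            ENNReal.ofReal_mul' hn0]
          refine le_trans (le_of_eq ?_) (mul_le_mul_left (h₁ (1 - ‖ζ‖ ^ 2) hpos) _)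
          rw [← lintegral_mul_const' _ _ ENNReal.ofReal_ne_top,
            ← lintegral_indicator (measurableSet_lt (by fun_prop) measurable_const)]
          refine lintegral_congr fun w => ?_
          simp only [hG, hS, Set.indicator_apply, Set.mem_ofPred_eq, lt_sub_iff_add_lt',
            sub_add_eq_sub_sub, ENNReal.ofReal_mul' hn0]
        · have : ∀ w : EuclideanSpace ℂ (Fin m), (ζ, w) ∉ S := by
            intro w
            simp only [hS, Set.mem_ofPred_eq, not_lt]
            nlinarith [sq_nonneg ‖w‖]
          simp only [hG, Set.indicator_of_notMem (this _), lintegral_zero, zero_le]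
    _ ≤ ENNReal.ofReal C₁ * ENNReal.ofReal (C₂ * (1 - r) ^ (-t)) := by
        rw [lintegral_indicator (measurableSet_lt (by fun_prop) measurable_const),
          lintegral_const_mul' _ _ ENNReal.ofReal_ne_top]
        gcongr
        exact h₂ r (norm_nonneg _) hz
    _ ≤ _ := by
        rw [← ENNReal.ofReal_mul hC₁]
        refine ENNReal.ofReal_le_ofReal ?_
        have hr0 : 0 ≤ r := norm_nonneg _
        -- This uses `1 - r² ≤ 2 (1 - r)`.
        have : (1 - r) ^ (-t) ≤ 2 ^ t * (1 - r ^ 2) ^ (-t) := by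
          have hp : 0 < 1 - r ^ 2 := by nlinarith
          rw [← neg_neg t, Real.rpow_neg (by norm_num : (0 : ℝ) ≤ 2), neg_neg, ← Real.inv_rpow (by norm_num),
            ← Real.mul_rpow (by norm_num) hp.le]
          exact Real.rpow_le_rpow_of_nonpos (by positivity) (by nlinarith) (by linarith)
        calc C₁ * (C₂ * (1 - r) ^ (-t)) ≤ C₁ * (C₂ * (2 ^ t * (1 - r ^ 2) ^ (-t))) := by gcongr
          _ = _ := by ring

/-! ### Anisotropic boxes -/

/-- The defining function `1 - |u|²` of the unit ball. -/
def defect {n : ℕ} (u : EuclideanSpace ℂ (Fin n)) : ℝ := 1 - ‖u‖ ^ 2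

/-- The seminorm `|⟨v, u⟩| + (1 - |u|²)^(1/2) |v|`, adapted to the hyperbolic geometry at `u`. -/
def boxGauge {n : ℕ} (u v : EuclideanSpace ℂ (Fin n)) : ℝ :=
  ‖(inner ℂ u v : ℂ)‖ + √(defect u) * ‖v‖

/-- The anisotropic box of centre `u` and hyperbolic size `r`. -/
def hypBox {n : ℕ} (u : EuclideanSpace ℂ (Fin n)) (r : ℝ) : Set (EuclideanSpace ℂ (Fin n)) :=
  {w | boxGauge u (w - u) < r * defect u}

section Geometry

variable {n : ℕ} {u v w z : EuclideanSpace ℂ (Fin n)} {r : ℝ}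

theorem defect_pos (hu : ‖u‖ < 1) : 0 < defect u := by
  unfold defect; nlinarith [norm_nonneg u]

theorem norm_lt_one_of_defect_pos (hu : 0 < defect u) : ‖u‖ < 1 := by
  unfold defect at hu; nlinarith [norm_nonneg u]

theorem defect_le_one : defect u ≤ 1 := by
  unfold defect; nlinarith [sq_nonneg ‖u‖]

theorem UnitBall.norm_lt_one (z : UnitBall n) : ‖(z : EuclideanSpace ℂ (Fin n))‖ < 1 :=
  mem_ball_zero_iff.1 z.2

theorem UnitBall.defect_pos (z : UnitBall n) : 0 < defect (z : EuclideanSpace ℂ (Fin n)) :=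
  _root_.defect_pos z.norm_lt_one

theorem continuous_defect : Continuous (defect : EuclideanSpace ℂ (Fin n) → ℝ) := by
  unfold defect; fun_prop

theorem boxGauge_nonneg : 0 ≤ boxGauge u v := by unfold boxGauge; positivity

theorem boxGauge_zero : boxGauge u 0 = 0 := by simp [boxGauge]

theorem boxGauge_smul (c : ℂ) : boxGauge u (c • v) = ‖c‖ * boxGauge u v := by
  simp only [boxGauge, inner_smul_right, norm_mul, norm_smul]; ring

theorem boxGauge_neg : boxGauge u (-v) = boxGauge u v := by simp [boxGauge]

theorem boxGauge_add_le : boxGauge u (v + w) ≤ boxGauge u v + boxGauge u w := by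
  simp only [boxGauge, inner_add_right]
  nlinarith [norm_add_le (inner ℂ u v : ℂ) (inner ℂ u w), norm_add_le v w,
    mul_le_mul_of_nonneg_left (norm_add_le v w) (Real.sqrt_nonneg (defect u))]

theorem norm_one_sub_inner_symm : ‖1 - (inner ℂ u z : ℂ)‖ = ‖1 - (inner ℂ z u : ℂ)‖ := by
  rw [← inner_conj_symm u z, ← Complex.norm_conj]; simp

theorem one_sub_norm_le (hz : ‖z‖ ≤ 1) : 1 - ‖u‖ ≤ ‖1 - (inner ℂ u z : ℂ)‖ := by
  have h1 := norm_sub_norm_le (1 : ℂ) (inner ℂ u z)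
  have h2 := norm_inner_le_norm (𝕜 := ℂ) u z
  rw [norm_one] at h1
  nlinarith [norm_nonneg u]

theorem defect_le (hu : ‖u‖ < 1) (hz : ‖z‖ ≤ 1) : defect u ≤ 2 * ‖1 - (inner ℂ u z : ℂ)‖ := by
  have := one_sub_norm_le (u := u) hz
  unfold defect; nlinarith [norm_nonneg u]

theorem norm_one_sub_inner_pos (hu : ‖u‖ < 1) (hz : ‖z‖ ≤ 1) : 0 < ‖1 - (inner ℂ u z : ℂ)‖ := by
  linarith [one_sub_norm_le (u := u) hz]

theorem re_one_sub_inner_pos (hu : ‖u‖ < 1) (hz : ‖z‖ ≤ 1) : 0 < (1 - (inner ℂ u z : ℂ)).re := by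
  have h2 := norm_inner_le_norm (𝕜 := ℂ) u z
  have h3 := Complex.re_le_norm (inner ℂ u z)
  have : (1 - (inner ℂ u z : ℂ)).re = 1 - (inner ℂ u z : ℂ).re := by simp
  rw [this]
  nlinarith [norm_nonneg u]

/-- Expand the square: `|z|² + |u|² - 2 Re⟨z, u⟩ ≤ 2 Re(1 - ⟨z, u⟩)` on the ball. -/
theorem norm_sub_sq_le (hu : ‖u‖ < 1) (hz : ‖z‖ ≤ 1) :
    ‖z - u‖ ^ 2 ≤ 2 * ‖1 - (inner ℂ u z : ℂ)‖ := by
  have h := @norm_sub_sq ℂ _ _ _ _ z u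
  have h1 : RCLike.re (inner ℂ z u : ℂ) = 1 - (1 - (inner ℂ z u : ℂ)).re := by
    simp
  have h2 : (1 - (inner ℂ z u : ℂ)).re ≤ ‖1 - (inner ℂ u z : ℂ)‖ := by
    rw [norm_one_sub_inner_symm]; exact Complex.re_le_norm _
  rw [h, h1]
  nlinarith [norm_nonneg u, norm_nonneg z]

/-- This is why the gauge has its anisotropic form. Split the inner product with `z` into those with
`u` and `z - u`. Both `δ(u)` and `|z - u|²` are at most `2 |1 - ⟨u, z⟩|`, hence so is the geometric
mean `√δ(u) |z - u|`. A displacement of gauge at most `r δ(u)` thus changes `1 - ⟨u, z⟩` by a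
relative error at most `2r`, uniformly in `z`. -/
theorem defect_mul_norm_inner_le (hu : ‖u‖ < 1) (hz : ‖z‖ ≤ 1) :
    defect u * ‖(inner ℂ z v : ℂ)‖ ≤ 2 * boxGauge u v * ‖1 - (inner ℂ u z : ℂ)‖ := by
  have hδ := defect_pos hu
  set N := ‖1 - (inner ℂ u z : ℂ)‖
  have h1 : ‖(inner ℂ z v : ℂ)‖ ≤ ‖(inner ℂ u v : ℂ)‖ + ‖z - u‖ * ‖v‖ := by
    have : (inner ℂ z v : ℂ) = inner ℂ u v + inner ℂ (z - u) v := by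
      rw [inner_sub_left]; ring
    rw [this]
    exact (norm_add_le _ _).trans (by gcongr; exact norm_inner_le_norm _ _)
  have h2 := norm_sub_sq_le hu hz
  have h3 := defect_le hu hz
  have hN : 0 < N := norm_one_sub_inner_pos hu hz
  have h4 : √(defect u) * ‖z - u‖ ≤ 2 * N := by
    refine le_of_sq_le_sq ?_ (by positivity)
    rw [mul_pow, Real.sq_sqrt hδ.le]
    nlinarith [sq_nonneg ‖z - u‖]
  have h5 : defect u = √(defect u) * √(defect u) := (Real.mul_self_sqrt hδ.le).symm
  calc defect u * ‖(inner ℂ z v : ℂ)‖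
      ≤ defect u * (‖(inner ℂ u v : ℂ)‖ + ‖z - u‖ * ‖v‖) := by gcongr
    _ = defect u * ‖(inner ℂ u v : ℂ)‖ + √(defect u) * ‖v‖ * (√(defect u) * ‖z - u‖) := by
        linear_combination (‖z - u‖ * ‖v‖) * h5
    _ ≤ (2 * N) * ‖(inner ℂ u v : ℂ)‖ + √(defect u) * ‖v‖ * (2 * N) := by gcongr
    _ = _ := by unfold boxGauge; ring

theorem mem_hypBox_self (hu : ‖u‖ < 1) (hr : 0 < r) : u ∈ hypBox u r := by
  have := defect_pos hu
  simp only [hypBox, Set.mem_ofPred_eq, sub_self, boxGauge_zero]; positivity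

theorem isOpen_hypBox : IsOpen (hypBox u r) := by
  have : Continuous fun w => boxGauge u (w - u) := by unfold boxGauge; fun_prop
  exact isOpen_lt this continuous_const

theorem norm_sub_le_of_mem_hypBox (hu : ‖u‖ < 1) (hw : w ∈ hypBox u r) :
    ‖w - u‖ ≤ r * √(defect u) := by
  have hδ := defect_pos hu
  have hs := Real.sqrt_pos.2 hδ
  have h : √(defect u) * ‖w - u‖ < r * (√(defect u) * √(defect u)) := by
    rw [Real.mul_self_sqrt hδ.le]
    refine lt_of_le_of_lt ?_ hw
    unfold boxGauge
    linarith [norm_nonneg (inner ℂ u (w - u) : ℂ)]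
  nlinarith

/-- In `|w|² - |u|² = 2 Re⟨u, w - u⟩ + |w - u|²` the quadratic term is at most `√δ(u) |w - u|`, so
the total is at most twice the gauge. -/
theorem abs_defect_sub_le (hu : ‖u‖ < 1) (hr : r ≤ 1) (hw : w ∈ hypBox u r) :
    |defect w - defect u| ≤ 2 * r * defect u := by
  have hδ := defect_pos hu
  have h1 := norm_sub_le_of_mem_hypBox hu hw
  have hs := Real.sqrt_pos.2 hδ
  have h2 : defect w - defect u = -(2 * (inner ℂ u (w - u) : ℂ).re + ‖w - u‖ ^ 2) := by
    have := @norm_add_sq ℂ _ _ _ _ u (w - u)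
    rw [add_sub_cancel] at this
    unfold defect
    rw [this]
    simp only [RCLike.re_eq_complex_re]
    ring
  have h3 := Complex.abs_re_le_norm (inner ℂ u (w - u) : ℂ)
  have h4 : boxGauge u (w - u) < r * defect u := hw
  unfold boxGauge at h4
  rw [h2, abs_neg]
  have h5 : ‖w - u‖ ^ 2 ≤ √(defect u) * ‖w - u‖ := by
    rw [sq]
    refine mul_le_mul_of_nonneg_right (h1.trans ?_) (norm_nonneg _)
    nlinarith
  rw [abs_le] at h3 ⊢
  constructor <;> nlinarith [norm_nonneg (w - u), sq_nonneg ‖w - u‖]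

theorem norm_lt_one_of_mem_hypBox (hu : ‖u‖ < 1) (hr : r ≤ 1 / 8) (hw : w ∈ hypBox u r) :
    ‖w‖ < 1 := by
  have h := abs_le.1 (abs_defect_sub_le hu (by linarith) hw)
  exact norm_lt_one_of_defect_pos (by nlinarith [defect_pos hu])

theorem defect_bounds (hu : ‖u‖ < 1) (hr : r ≤ 1 / 8) (hw : w ∈ hypBox u r) :
    3 / 4 * defect u ≤ defect w ∧ defect w ≤ 5 / 4 * defect u := by
  have h := abs_le.1 (abs_defect_sub_le hu (by linarith) hw)
  constructor <;> nlinarith [defect_pos hu]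

/-- Moving the centre changes the inner product term by at most `|w - u| |v| ≤ √δ(u) |v| / 8`, which
the second term of the gauge absorbs. -/
theorem boxGauge_comparable (hu : ‖u‖ < 1) (hr : r ≤ 1 / 8) (hw : w ∈ hypBox u r) :
    boxGauge u v ≤ 2 * boxGauge w v ∧ boxGauge w v ≤ 2 * boxGauge u v := by
  have hδ := defect_pos hu
  obtain ⟨h1, h2⟩ := defect_bounds hu hr hw
  have hn := norm_sub_le_of_mem_hypBox hu hw
  have hs : 0 ≤ √(defect u) := Real.sqrt_nonneg _
  have hsw : 0 ≤ √(defect w) := Real.sqrt_nonneg _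
  have hn' : ‖w - u‖ ≤ 1 / 8 * √(defect u) := hn.trans (by gcongr)
  have e1 : √(defect w) ≤ 5 / 4 * √(defect u) := by
    rw [show (5 / 4 : ℝ) = √((5 / 4) ^ 2) by rw [Real.sqrt_sq (by norm_num)],
      ← Real.sqrt_mul (by norm_num)]
    exact Real.sqrt_le_sqrt (by nlinarith)
  have e2 : √(defect u) ≤ 5 / 4 * √(defect w) := by
    rw [show (5 / 4 : ℝ) = √((5 / 4) ^ 2) by rw [Real.sqrt_sq (by norm_num)],
      ← Real.sqrt_mul (by norm_num)]
    exact Real.sqrt_le_sqrt (by nlinarith)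
  have h3 : ‖(inner ℂ (w - u) v : ℂ)‖ ≤ ‖w - u‖ * ‖v‖ := norm_inner_le_norm _ _
  have h4 : ‖w - u‖ * ‖v‖ ≤ 1 / 8 * √(defect u) * ‖v‖ := by gcongr
  have h5 : √(defect w) * ‖v‖ ≤ 5 / 4 * √(defect u) * ‖v‖ := by gcongr
  have h6 : √(defect u) * ‖v‖ ≤ 5 / 4 * √(defect w) * ‖v‖ := by gcongr
  have h7 : (inner ℂ w v : ℂ) = inner ℂ u v + inner ℂ (w - u) v := by rw [inner_sub_left]; ring
  have h8 : ‖(inner ℂ w v : ℂ)‖ ≤ ‖(inner ℂ u v : ℂ)‖ + ‖(inner ℂ (w - u) v : ℂ)‖ := by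
    rw [h7]; exact norm_add_le _ _
  have h9 : ‖(inner ℂ u v : ℂ)‖ ≤ ‖(inner ℂ w v : ℂ)‖ + ‖(inner ℂ (w - u) v : ℂ)‖ := by
    rw [show (inner ℂ u v : ℂ) = inner ℂ w v - inner ℂ (w - u) v by rw [h7]; ring]
    exact norm_sub_le _ _
  have := norm_nonneg (inner ℂ u v : ℂ)
  have := norm_nonneg (inner ℂ w v : ℂ)
  have h10 : 0 ≤ √(defect u) * ‖v‖ := by positivity
  have h11 : 0 ≤ √(defect w) * ‖v‖ := by positivity
  unfold boxGauge
  constructor <;> linarith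

/-- Exchanging the centres costs 2 for the gauge and 4/3 for the defect. The factor 4 here and in
the next lemma fixes the scales 1/32, 1/8 and 1/2 used below. -/
theorem mem_hypBox_symm (hu : ‖u‖ < 1) (hr0 : 0 ≤ r) (hr : r ≤ 1 / 8) (hw : w ∈ hypBox u r) :
    u ∈ hypBox w (4 * r) := by
  have h1 := (boxGauge_comparable (v := u - w) hu hr hw).2
  have h2 := (defect_bounds hu hr hw).1
  have h3 : boxGauge u (u - w) < r * defect u := by
    rw [← neg_sub, boxGauge_neg]; exact hw
  have := defect_pos hu
  change boxGauge w (u - w) < _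
  nlinarith

theorem hypBox_subset_hypBox (hu : ‖u‖ < 1) (hr0 : 0 ≤ r) (hr : r ≤ 1 / 8) (hw : w ∈ hypBox u r) :
    hypBox w r ⊆ hypBox u (4 * r) := by
  intro x hx
  have h1 := (boxGauge_comparable (v := x - w) hu hr hw).1
  have h2 := (defect_bounds hu hr hw).2
  have h3 : boxGauge w (x - w) < r * defect w := hx
  have h4 : boxGauge u (w - u) < r * defect u := hw
  have h5 := boxGauge_add_le (u := u) (v := x - w) (w := w - u)
  rw [sub_add_sub_cancel] at h5
  have := defect_pos hu
  change boxGauge u (x - u) < _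
  nlinarith

theorem hypBox_mono {r' : ℝ} (hu : ‖u‖ < 1) (h : r ≤ r') : hypBox u r ⊆ hypBox u r' := by
  intro x hx
  have hx : boxGauge u (x - u) < r * defect u := hx
  have := defect_pos hu
  change boxGauge u (x - u) < _
  nlinarith

theorem norm_inner_sub_le (hu : ‖u‖ < 1) (hz : ‖z‖ ≤ 1) (hw : w ∈ hypBox u r) :
    ‖(1 - (inner ℂ w z : ℂ)) - (1 - inner ℂ u z)‖ ≤ 2 * r * ‖1 - (inner ℂ u z : ℂ)‖ := by
  have h := defect_mul_norm_inner_le (v := w - u) hu hz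
  have hδ := defect_pos hu
  have h1 : boxGauge u (w - u) < r * defect u := hw
  have h2 : ‖(1 - (inner ℂ w z : ℂ)) - (1 - inner ℂ u z)‖ = ‖(inner ℂ z (w - u) : ℂ)‖ := by
    rw [← norm_inner_symm, inner_sub_left, ← norm_neg]; congr 1; ring
  rw [h2]
  have h3 : defect u * ‖(inner ℂ z (w - u) : ℂ)‖ ≤
      defect u * (2 * r * ‖1 - (inner ℂ u z : ℂ)‖) := by
    refine h.trans ?_
    nlinarith [norm_nonneg (1 - (inner ℂ u z : ℂ)),
      mul_le_mul_of_nonneg_right h1.le (norm_nonneg (1 - (inner ℂ u z : ℂ)))]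
  exact le_of_mul_le_mul_left h3 hδ

theorem norm_one_sub_inner_bounds (hu : ‖u‖ < 1) (hz : ‖z‖ ≤ 1) (hr : r ≤ 1 / 8)
    (hw : w ∈ hypBox u r) :
    3 / 4 * ‖1 - (inner ℂ u z : ℂ)‖ ≤ ‖1 - (inner ℂ w z : ℂ)‖ ∧
      ‖1 - (inner ℂ w z : ℂ)‖ ≤ 5 / 4 * ‖1 - (inner ℂ u z : ℂ)‖ := by
  have h := norm_inner_sub_le hu hz hw
  have h1 := norm_sub_norm_le (1 - (inner ℂ w z : ℂ)) (1 - inner ℂ u z)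
  have h2 := norm_sub_norm_le (1 - (inner ℂ u z : ℂ)) (1 - inner ℂ w z)
  rw [norm_sub_rev (1 - (inner ℂ u z : ℂ)) (1 - inner ℂ w z)] at h2
  have := norm_nonneg (1 - (inner ℂ u z : ℂ))
  constructor <;> nlinarith

end Geometry

/-! ### Volume of boxes -/

/-- In coordinates along `u`, the box contains the product of a disc of radius `r δ / 4` and a ball
of `ℂ^(n-1)` of radius `r √δ / 4`. Its volume is of order `δ² δ^(n-1) = δ^(n+1)`. -/
theorem exists_volume_hypBox_ge {n : ℕ} (hn : 1 ≤ n) {r : ℝ} (hr : 0 < r) :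
    ∃ c : ℝ, 0 < c ∧ ∀ u : EuclideanSpace ℂ (Fin n), ‖u‖ < 1 →
      ENNReal.ofReal (c * defect u ^ (n + 1)) ≤ volume (hypBox u r) := by
  obtain ⟨m, rfl⟩ : ∃ m, n = m + 1 := ⟨n - 1, by omega⟩
  set κ := (volume : Measure ℂ).real (Metric.ball 0 1) *
    (volume : Measure (EuclideanSpace ℂ (Fin m))).real (Metric.ball 0 1) with hκ
  have hκ0 : 0 < κ := by
    refine mul_pos ?_ ?_ <;> refine ENNReal.toReal_pos ?_ measure_ball_lt_top.ne <;>
      exact (Metric.measure_ball_pos _ _ one_pos).ne'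
  refine ⟨(r / 4) ^ 2 * (r / 4) ^ (2 * m) * κ, by positivity, fun u hu => ?_⟩
  have hδ := defect_pos hu
  have hδ1 := defect_le_one (u := u)
  obtain ⟨e, he, hze⟩ : ∃ e : EuclideanSpace ℂ (Fin (m + 1)), ‖e‖ = 1 ∧ u = (‖u‖ : ℂ) • e := by
    by_cases h0 : u = 0
    · exact ⟨EuclideanSpace.single 0 1, by simp, by simp [h0]⟩
    · have : (‖u‖ : ℂ) ≠ 0 := by simpa using h0
      exact ⟨(‖u‖ : ℂ)⁻¹ • u, by simp [norm_smul, h0], by rw [smul_smul, mul_inv_cancel₀ this, one_smul]⟩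
  obtain ⟨Φ, hΦ, hΦw⟩ := exists_measurePreserving_prod e he
  set a := r / 4 * defect u with ha
  set b := r / 4 * √(defect u) with hb
  have hs := Real.sqrt_pos.2 hδ
  have hs1 : √(defect u) ≤ 1 := Real.sqrt_le_one.2 hδ1
  have hss : √(defect u) * √(defect u) = defect u := Real.mul_self_sqrt hδ.le
  have hsub : (fun x => x - u) ⁻¹' (Φ ⁻¹' (Metric.ball 0 a ×ˢ Metric.ball 0 b)) ⊆ hypBox u r := by
    intro x hx
    set v := x - u with hv
    obtain ⟨h1, h2⟩ : Φ v ∈ Metric.ball (0 : ℂ) a ×ˢ Metric.ball 0 b := hx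
    rw [mem_ball_zero_iff] at h1 h2
    have h3 : ‖(inner ℂ u v : ℂ)‖ ≤ ‖(Φ v).1‖ := by
      rw [(hΦw v).1]
      nth_rewrite 1 [hze]
      rw [inner_smul_left, norm_mul, Complex.conj_ofReal, Complex.norm_real, norm_norm]
      nlinarith [norm_nonneg (inner ℂ e v : ℂ)]
    have h4 : ‖v‖ ≤ ‖(Φ v).1‖ + ‖(Φ v).2‖ := by
      refine le_of_sq_le_sq ?_ (by positivity)
      rw [(hΦw v).2]
      nlinarith [norm_nonneg (Φ v).1, norm_nonneg (Φ v).2]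
    change boxGauge u v < _
    unfold boxGauge
    have h5 : √(defect u) * ‖v‖ ≤ √(defect u) * (‖(Φ v).1‖ + ‖(Φ v).2‖) := by gcongr
    have h6 : √(defect u) * ‖(Φ v).1‖ ≤ ‖(Φ v).1‖ := by nlinarith [norm_nonneg (Φ v).1]
    have h7 : √(defect u) * ‖(Φ v).2‖ < a := by
      calc _ < √(defect u) * b := by gcongr
        _ = a := by rw [hb, ha]; linear_combination (r / 4) * hss
    have : r * defect u = 4 * a := by rw [ha]; ring
    have : 0 < a := by positivity
    linarith
  have hfin : ∀ k, Module.finrank ℝ (EuclideanSpace ℂ (Fin k)) = 2 * k := by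
    intro k
    rw [(WithLp.linearEquiv 2 ℝ (Fin k → ℂ)).finrank_eq, Module.finrank_pi_fintype]
    simp [mul_comm]
  refine le_trans (le_of_eq ?_) (measure_mono hsub)
  rw [(measurePreserving_sub_right volume u).measure_preimage
    (hΦ.measurable (measurableSet_ball.prod measurableSet_ball)).nullMeasurableSet, hΦ.measure_preimage
    ((measurableSet_ball.prod measurableSet_ball).nullMeasurableSet), Measure.volume_eq_prod,
    Measure.prod_prod, Measure.addHaar_ball_of_pos _ _ (by positivity : 0 < a),
    Measure.addHaar_ball_of_pos _ _ (by positivity : 0 < b), Complex.finrank_real_complex, hfin,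
    ← ofReal_measureReal measure_ball_lt_top.ne, ← ofReal_measureReal measure_ball_lt_top.ne,
    ← ENNReal.ofReal_mul (by positivity), ← ENNReal.ofReal_mul (by positivity),
    ← ENNReal.ofReal_mul (by positivity)]
  congr 1
  have : b ^ (2 * m) = (r / 4) ^ (2 * m) * defect u ^ m := by
    rw [hb, mul_pow, pow_mul (√_), Real.sq_sqrt hδ.le]
  rw [this, hκ, ha]
  ring

/-! ### The weighted volume -/

section WeightedVolume

variable {n : ℕ} {α : ℝ}

theorem rawWeightedVolume_lintegral (F : EuclideanSpace ℂ (Fin n) → ℝ≥0∞) :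
    ∫⁻ z, F z ∂(rawWeightedVolume n α) =
      ∫⁻ w in Metric.ball 0 1, ENNReal.ofReal (defect w ^ α) * F w := by
  unfold rawWeightedVolume
  rw [lintegral_withDensity_eq_lintegral_mul_non_measurable]
  · exact lintegral_subtype_comap measurableSet_ball
      (fun w : EuclideanSpace ℂ (Fin n) => ENNReal.ofReal ((1 - ‖w‖ ^ 2) ^ α) * F w)
  · fun_prop
  · exact Filter.Eventually.of_forall fun _ => ENNReal.ofReal_lt_top

theorem rawWeightedVolume_univ_ne_top (hα : -1 < α) : rawWeightedVolume n α Set.univ ≠ ∞ := by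
  obtain ⟨C, -, h⟩ := lintegral_ball_rpow_le n hα
  rw [← lintegral_one, rawWeightedVolume_lintegral (fun _ => 1)]
  refine ne_top_of_le_ne_top ENNReal.ofReal_ne_top (le_trans (le_of_eq ?_) (h 1 one_pos))
  have : Metric.ball (0 : EuclideanSpace ℂ (Fin n)) 1 = {w | ‖w‖ ^ 2 < 1} := by
    ext w; simp
  rw [this]
  simp [defect]

theorem rawWeightedVolume_univ_ne_zero : rawWeightedVolume n α Set.univ ≠ 0 := by
  rw [← lintegral_one, rawWeightedVolume_lintegral (fun _ => 1)]
  refine ne_of_gt ?_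
  rw [setLIntegral_pos_iff (by unfold defect; fun_prop)]
  refine lt_of_lt_of_le (Metric.measure_ball_pos volume (0 : EuclideanSpace ℂ (Fin n)) one_pos)
    (measure_mono fun w hw => ⟨?_, hw⟩)
  rw [mem_ball_zero_iff] at hw
  simpa using Real.rpow_pos_of_pos (defect_pos hw) α

theorem isProbabilityMeasure_weightedVolume (hα : -1 < α) :
    IsProbabilityMeasure (weightedVolume n α) := by
  constructor
  rw [weightedVolume, Measure.smul_apply, smul_eq_mul]
  exact ENNReal.inv_mul_cancel rawWeightedVolume_univ_ne_zero (rawWeightedVolume_univ_ne_top hα)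

/-- Integration against the weighted volume, with `c` the normalizing constant. -/
theorem exists_weightedVolume_lintegral (n : ℕ) (hα : -1 < α) :
    ∃ c : ℝ, 0 < c ∧ ∀ F : EuclideanSpace ℂ (Fin n) → ℝ≥0∞,
      ∫⁻ z, F z ∂(weightedVolume n α) =
        ENNReal.ofReal c * ∫⁻ w in Metric.ball 0 1, ENNReal.ofReal (defect w ^ α) * F w := by
  have h0 := rawWeightedVolume_univ_ne_zero (n := n) (α := α)
  have h1 := rawWeightedVolume_univ_ne_top (n := n) hα
  refine ⟨((rawWeightedVolume n α Set.univ)⁻¹).toReal, ?_, fun F => ?_⟩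
  · exact ENNReal.toReal_pos (ENNReal.inv_ne_zero.2 h1) (ENNReal.inv_ne_top.2 h0)
  · rw [weightedVolume, lintegral_smul_measure, rawWeightedVolume_lintegral,
      ENNReal.ofReal_toReal (ENNReal.inv_ne_top.2 h0), smul_eq_mul]

/-- On a box, the weighted volume is comparable with Lebesgue measure times the weight at the
centre. -/
theorem exists_setLIntegral_hypBox_le (n : ℕ) (hα : -1 < α) :
    ∃ C : ℝ, 0 < C ∧ ∀ u : EuclideanSpace ℂ (Fin n), ‖u‖ < 1 → ∀ r ≤ 1 / 8,
      ∀ F : EuclideanSpace ℂ (Fin n) → ℝ≥0∞,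
        ENNReal.ofReal (defect u ^ α) * ∫⁻ w in hypBox u r, F w ≤
          ENNReal.ofReal C * ∫⁻ z in Subtype.val ⁻¹' hypBox u r, F z ∂(weightedVolume n α) := by
  obtain ⟨c, hc, h⟩ := exists_weightedVolume_lintegral n hα
  refine ⟨2 ^ |α| / c, by positivity, fun u hu r hr F => ?_⟩
  have hms : MeasurableSet (hypBox u r) := isOpen_hypBox.measurableSet
  have hsub : hypBox u r ⊆ Metric.ball 0 1 := fun w hw =>
    mem_ball_zero_iff.2 (norm_lt_one_of_mem_hypBox hu hr hw)
  have e : ∫⁻ z in Subtype.val ⁻¹' hypBox u r, F z ∂(weightedVolume n α) =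
      ENNReal.ofReal c * ∫⁻ w in hypBox u r, ENNReal.ofReal (defect w ^ α) * F w := by
    rw [← lintegral_indicator (measurable_subtype_coe hms)]
    have : ∀ z : UnitBall n, (Subtype.val ⁻¹' hypBox u r).indicator (fun z : UnitBall n => F z) z =
        (hypBox u r).indicator F z := fun z => Set.indicator_comp_right Subtype.val
    simp_rw [this]
    rw [h]
    congr 1
    rw [← Set.inter_eq_left.2 hsub, ← setLIntegral_indicator hms]
    refine lintegral_congr fun w => ?_
    by_cases hw : w ∈ hypBox u r
    · simp [Set.indicator_of_mem hw, Set.inter_eq_left.2 hsub]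
    · simp [Set.indicator_of_notMem hw, Set.inter_eq_left.2 hsub]
  rw [e, ← mul_assoc, ← ENNReal.ofReal_mul (by positivity), div_mul_cancel₀ _ hc.ne',
    ← lintegral_const_mul' _ _ ENNReal.ofReal_ne_top,
    ← lintegral_const_mul' _ _ ENNReal.ofReal_ne_top]
  refine setLIntegral_mono' hms fun w hw => ?_
  obtain ⟨h1, h2⟩ := defect_bounds hu hr hw
  have := defect_pos hu
  have hw0 : 0 < defect w := by linarith
  rw [← mul_assoc, ← ENNReal.ofReal_mul (by positivity)]
  gcongr
  exact rpow_le_two_rpow_abs_mul hw0 (by linarith) (by linarith)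

theorem exists_weightedVolume_hypBox_ge (hn : 1 ≤ n) (hα : -1 < α) {r : ℝ} (hr : 0 < r)
    (hr' : r ≤ 1 / 8) :
    ∃ c : ℝ, 0 < c ∧ ∀ u : EuclideanSpace ℂ (Fin n), ‖u‖ < 1 →
      ENNReal.ofReal (c * defect u ^ ((n : ℝ) + 1 + α)) ≤
        weightedVolume n α (Subtype.val ⁻¹' hypBox u r) := by
  obtain ⟨c, hc, h⟩ := exists_volume_hypBox_ge hn hr
  obtain ⟨C, hC, h'⟩ := exists_setLIntegral_hypBox_le n hα
  refine ⟨c / C, by positivity, fun u hu => ?_⟩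
  have hδ := defect_pos hu
  have h1 := h' u hu r hr' (fun _ => 1)
  rw [setLIntegral_one, setLIntegral_one] at h1
  have h2 : ENNReal.ofReal (c * defect u ^ ((n : ℝ) + 1 + α)) ≤
      ENNReal.ofReal C * weightedVolume n α (Subtype.val ⁻¹' hypBox u r) := by
    refine le_trans (le_trans (le_of_eq ?_) (mul_le_mul_right (h u hu) _)) h1
    rw [← ENNReal.ofReal_mul (by positivity)]
    congr 1
    rw [Real.rpow_add hδ, ← Real.rpow_natCast]
    push_cast
    ring
  calc _ = (ENNReal.ofReal C)⁻¹ * ENNReal.ofReal (c * defect u ^ ((n : ℝ) + 1 + α)) := by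
        rw [← ENNReal.ofReal_inv_of_pos hC, ← ENNReal.ofReal_mul (by positivity)]
        congr 1; ring
    _ ≤ (ENNReal.ofReal C)⁻¹ *
        (ENNReal.ofReal C * weightedVolume n α (Subtype.val ⁻¹' hypBox u r)) := by gcongr
    _ = _ := by
        rw [← mul_assoc, ENNReal.inv_mul_cancel (by simpa using hC) ENNReal.ofReal_ne_top, one_mul]

end WeightedVolume

/-! ### Sub-mean value property and oscillation -/

section MeanValue

variable {n : ℕ}

theorem measurePreserving_unit_smul {c : ℂ} (hc : ‖c‖ = 1) :
    MeasurePreserving (fun v : EuclideanSpace ℂ (Fin n) => c • v) := by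
  let I : EuclideanSpace ℂ (Fin n) →ₗᵢ[ℝ] EuclideanSpace ℂ (Fin n) :=
    { toFun := fun v => c • v
      map_add' := smul_add c
      map_smul' := fun a v => smul_comm c a v
      norm_map' := fun v => by
        change ‖c • v‖ = ‖v‖
        rw [norm_smul, hc, one_mul] }
  exact (I.toLinearIsometryEquiv rfl).measurePreserving

theorem differentiableOn_comp_line {F : EuclideanSpace ℂ (Fin n) → ℂ}
    (hF : DifferentiableOn ℂ F (Metric.ball 0 1)) {u v : EuclideanSpace ℂ (Fin n)} {S : Set ℂ}
    (hS : ∀ l ∈ S, u + l • v ∈ Metric.ball (0 : EuclideanSpace ℂ (Fin n)) 1) :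
    DifferentiableOn ℂ (fun l : ℂ => F (u + l • v)) S :=
  hF.comp (by fun_prop : Differentiable ℂ fun l : ℂ => u + l • v).differentiableOn hS

theorem add_smul_mem_hypBox {u v : EuclideanSpace ℂ (Fin n)} {r a : ℝ} {l : ℂ}
    (hv : boxGauge u v < r * defect u) (ha : 0 < a) (hl : ‖l‖ ≤ a) :
    u + l • v ∈ hypBox u (a * r) := by
  change boxGauge u (u + l • v - u) < _
  rw [add_sub_cancel_left, boxGauge_smul]
  calc _ ≤ a * boxGauge u v := mul_le_mul_of_nonneg_right hl boxGauge_nonneg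
    _ < a * (r * defect u) := by gcongr
    _ = _ := by ring

/-- `F(u)` is the mean of `F` over each circle `u + λ v`, `|λ| = 1`. Integrate over all `v` with `u
+ v` in the box and exchange the integrals: the box and Lebesgue measure are invariant under `v ↦ λ
v`, so every `λ` contributes the same integral. -/
theorem enorm_mul_volume_hypBox_le {F : EuclideanSpace ℂ (Fin n) → ℂ}
    (hF : DifferentiableOn ℂ F (Metric.ball 0 1)) {u : EuclideanSpace ℂ (Fin n)} (hu : ‖u‖ < 1)
    {r : ℝ} (hr : r ≤ 1 / 8) :
    ‖F u‖ₑ * volume (hypBox u r) ≤ ∫⁻ w in hypBox u r, ‖F w‖ₑ := by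
  have hms : MeasurableSet (hypBox u r) := isOpen_hypBox.measurableSet
  have hsub : hypBox u r ⊆ Metric.ball 0 1 := fun w hw =>
    mem_ball_zero_iff.2 (norm_lt_one_of_mem_hypBox hu hr hw)
  -- Extension by zero makes translation and rotation invariance on the whole space applicable.
  set G : EuclideanSpace ℂ (Fin n) → ℝ≥0∞ := fun w => ‖(hypBox u r).indicator F w‖ₑ with hG
  have hGm : Measurable G := by
    classical
    refine Measurable.enorm ?_
    have := (hF.continuousOn.mono hsub).measurable_piecewise
      (g := (0 : EuclideanSpace ℂ (Fin n) → ℂ)) continuousOn_const hms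
    rwa [Set.piecewise_eq_indicator] at this
  have hGint : ∫⁻ w, G w = ∫⁻ w in hypBox u r, ‖F w‖ₑ := by
    rw [← lintegral_indicator hms]
    refine lintegral_congr fun w => ?_
    simp only [hG, enorm_indicator_eq_indicator_enorm]
  have hpt : ∀ v, ((fun v => v + u) ⁻¹' hypBox u r).indicator
      (fun _ => ENNReal.ofReal (2 * Real.pi) * ‖F u‖ₑ) v ≤
      ∫⁻ θ in Set.Ioc 0 (2 * Real.pi), G (u + circleMap 0 1 θ • v) := by
    intro v
    by_cases hv : v + u ∈ hypBox u r
    swap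
    · rw [Set.indicator_of_notMem (by exact hv)]; exact zero_le
    rw [Set.indicator_of_mem (by exact hv)]
    have hv' : boxGauge u v < r * defect u := by
      have : boxGauge u (v + u - u) < r * defect u := hv
      rwa [add_sub_cancel_right] at this
    have hmem : ∀ l : ℂ, ‖l‖ ≤ 1 → u + l • v ∈ hypBox u r := fun l hl => by
      simpa using add_smul_mem_hypBox hv' one_pos hl
    have hd : DiffContOnCl ℂ (fun l : ℂ => F (u + l • v)) (Metric.ball 0 |1|) := by
      refine DifferentiableOn.diffContOnCl ?_
      refine differentiableOn_comp_line hF fun l hl => hsub (hmem l ?_)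
      rw [abs_one, closure_ball _ one_ne_zero] at hl
      simpa using hl
    have havg := hd.circleAverage
    simp only [zero_smul, add_zero] at havg
    rw [Real.circleAverage_def, intervalIntegral.integral_of_le Real.two_pi_pos.le] at havg
    have h2 : ((2 * Real.pi : ℝ) : ℂ) * F u =
        ∫ θ in Set.Ioc 0 (2 * Real.pi), F (u + circleMap 0 1 θ • v) := by
      rw [← havg, Complex.real_smul, ← mul_assoc, ← Complex.ofReal_mul,
        mul_inv_cancel₀ Real.two_pi_pos.ne', Complex.ofReal_one, one_mul]
    calc ENNReal.ofReal (2 * Real.pi) * ‖F u‖ₑ = ‖((2 * Real.pi : ℝ) : ℂ) * F u‖ₑ := by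
          rw [enorm_mul]
          congr 1
          rw [← ofReal_norm, Complex.norm_real, Real.norm_of_nonneg Real.two_pi_pos.le]
      _ ≤ ∫⁻ θ in Set.Ioc 0 (2 * Real.pi), ‖F (u + circleMap 0 1 θ • v)‖ₑ := by
          rw [h2]; exact enorm_integral_le_lintegral_enorm _
      _ = _ := by
          refine lintegral_congr fun θ => ?_
          simp only [hG]
          rw [Set.indicator_of_mem (hmem _ (by simp))]
  have hint := lintegral_mono (μ := volume) hpt
  rw [lintegral_indicator (hms.preimage (by fun_prop)), setLIntegral_const,
    (measurePreserving_add_right volume u).measure_preimage hms.nullMeasurableSet,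
    lintegral_lintegral_swap] at hint
  · have hin : ∀ θ, ∫⁻ v, G (u + circleMap 0 1 θ • v) = ∫⁻ w, G w := fun θ => by
      rw [(measurePreserving_unit_smul (c := circleMap 0 1 θ) (by simp)).lintegral_comp
        (f := fun v => G (u + v)) (by fun_prop)]
      exact lintegral_add_left_eq_self G u
    simp_rw [hin] at hint
    rw [setLIntegral_const, Real.volume_Ioc, sub_zero, hGint, mul_comm (∫⁻ _ in _, _),
      mul_assoc] at hint
    exact (ENNReal.mul_le_mul_iff_right (by simpa using Real.pi_pos) ENNReal.ofReal_ne_top).1 hint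
  · refine Measurable.aemeasurable ?_
    have : Continuous fun p : EuclideanSpace ℂ (Fin n) × ℝ => u + circleMap 0 1 p.2 • p.1 := by
      fun_prop
    exact hGm.comp this.measurable

/-- Apply the mean value inequality on the box of size 1/32 at `w`, which lies in the box of size
1/8 at `u`; the lower volume bound and the nearly constant weight turn the average into one against
`v_α`. -/
theorem exists_enorm_le_setLIntegral_hypBox {α : ℝ} (hn : 1 ≤ n) (hα : -1 < α) :
    ∃ C : ℝ, 0 < C ∧ ∀ F : EuclideanSpace ℂ (Fin n) → ℂ, DifferentiableOn ℂ F (Metric.ball 0 1) →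
      ∀ u, ‖u‖ < 1 → ∀ w ∈ hypBox u (1 / 32),
        ‖F w‖ₑ ≤ ENNReal.ofReal (C * defect u ^ (-((n : ℝ) + 1 + α))) *
          ∫⁻ z in Subtype.val ⁻¹' hypBox u (1 / 8), ‖F z‖ₑ ∂(weightedVolume n α) := by
  obtain ⟨c, hc, h1⟩ := exists_volume_hypBox_ge hn (r := 1 / 32) (by norm_num)
  obtain ⟨C, hC, h2⟩ := exists_setLIntegral_hypBox_le n hα
  set s := (n : ℝ) + 1 + α with hs
  refine ⟨C / c * 2 ^ |-s|, by positivity, fun F hF u hu w hw => ?_⟩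
  have hw1 := norm_lt_one_of_mem_hypBox hu (by norm_num) hw
  have hδ := defect_pos hu
  have hδw := defect_pos hw1
  obtain ⟨hb1, hb2⟩ := defect_bounds hu (by norm_num) hw
  have h3 := enorm_mul_volume_hypBox_le hF hw1 (r := 1 / 32) (by norm_num)
  have h4 := h2 w hw1 (1 / 32) (by norm_num) (fun w => ‖F w‖ₑ)
  have h5 : hypBox w (1 / 32) ⊆ hypBox u (1 / 8) := by
    have := hypBox_subset_hypBox hu (by norm_num) (by norm_num) hw
    norm_num at this ⊢
    exact this
  set A := ∫⁻ z in Subtype.val ⁻¹' hypBox u (1 / 8), ‖F z‖ₑ ∂(weightedVolume n α)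
  have h6 : ENNReal.ofReal (c * defect w ^ s) * ‖F w‖ₑ ≤ ENNReal.ofReal C * A := by
    calc ENNReal.ofReal (c * defect w ^ s) * ‖F w‖ₑ
        = ENNReal.ofReal (defect w ^ α) *
          (‖F w‖ₑ * ENNReal.ofReal (c * defect w ^ (n + 1))) := by
          rw [mul_left_comm, ← ENNReal.ofReal_mul (by positivity), mul_comm]
          congr 2
          rw [hs, Real.rpow_add hδw, ← Real.rpow_natCast]
          push_cast
          ring
      _ ≤ ENNReal.ofReal (defect w ^ α) * (‖F w‖ₑ * volume (hypBox w (1 / 32))) := by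
          gcongr; exact h1 w hw1
      _ ≤ ENNReal.ofReal (defect w ^ α) * ∫⁻ x in hypBox w (1 / 32), ‖F x‖ₑ := by gcongr
      _ ≤ _ := h4.trans (by gcongr; exact lintegral_mono_set (Set.preimage_mono h5))
  have h7 : defect w ^ (-s) ≤ 2 ^ |-s| * defect u ^ (-s) :=
    rpow_le_two_rpow_abs_mul hδ (by linarith) (by linarith)
  calc ‖F w‖ₑ = ENNReal.ofReal (c⁻¹ * defect w ^ (-s)) *
        (ENNReal.ofReal (c * defect w ^ s) * ‖F w‖ₑ) := by
        rw [← mul_assoc, ← ENNReal.ofReal_mul (by positivity), Real.rpow_neg hδw.le]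
        have : c⁻¹ * (defect w ^ s)⁻¹ * (c * defect w ^ s) = 1 := by
          have : 0 < defect w ^ s := Real.rpow_pos_of_pos hδw s
          field_simp
        rw [this, ENNReal.ofReal_one, one_mul]
    _ ≤ ENNReal.ofReal (c⁻¹ * (2 ^ |-s| * defect u ^ (-s))) * (ENNReal.ofReal C * A) := by
        gcongr
    _ = _ := by
        rw [← mul_assoc, ← ENNReal.ofReal_mul (by positivity)]
        congr 2
        ring

/-- Schwarz lemma on the line `λ ↦ u + λ (w - u)`: it stays in the box of size 1/32 for `|λ| < R =
1/(32 r)`, and `w` is the point `λ = 1`. As `g` varies by at most `2M`, the bound is `2M / R = 64 r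
M`. -/
theorem enorm_sub_le_of_bound_hypBox {g : EuclideanSpace ℂ (Fin n) → ℂ}
    (hg : DifferentiableOn ℂ g (Metric.ball 0 1)) {u w : EuclideanSpace ℂ (Fin n)} (hu : ‖u‖ < 1)
    {r : ℝ} (hr0 : 0 < r) (hr : r < 1 / 32) (hw : w ∈ hypBox u r) {M : ℝ≥0∞}
    (hM : ∀ x ∈ hypBox u (1 / 32), ‖g x‖ₑ ≤ M) :
    ‖g w - g u‖ₑ ≤ ENNReal.ofReal (64 * r) * M := by
  rcases eq_or_ne M ∞ with rfl | hMtop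
  · rw [ENNReal.mul_top (by simpa using hr0)]; exact le_top
  lift M to ℝ≥0 using hMtop
  have hM' : ∀ x ∈ hypBox u (1 / 32), ‖g x‖ ≤ M := fun x hx => by
    have := hM x hx
    rw [enorm_eq_nnnorm] at this
    exact_mod_cast this
  have hgw : boxGauge u (w - u) < r * defect u := hw
  set R := (1 / 32) / r with hR
  have hRpos : 0 < R := by positivity
  have hRr : R * r = 1 / 32 := div_mul_cancel₀ _ hr0.ne'
  have hmem : ∀ l ∈ Metric.ball (0 : ℂ) R, u + l • (w - u) ∈ hypBox u (1 / 32) := fun l hl => by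
    rw [← hRr]
    exact add_smul_mem_hypBox hgw hRpos (mem_ball_zero_iff.1 hl).le
  have hd : DifferentiableOn ℂ (fun l : ℂ => g (u + l • (w - u))) (Metric.ball 0 R) :=
    differentiableOn_comp_line hg fun l hl => mem_ball_zero_iff.2
      (norm_lt_one_of_mem_hypBox hu (by norm_num) (hmem l hl))
  have hmaps : Set.MapsTo (fun l : ℂ => g (u + l • (w - u))) (Metric.ball 0 R)
      (Metric.closedBall (g (u + (0 : ℂ) • (w - u))) (2 * M)) := by
    intro l hl
    rw [mem_closedBall_iff_norm]
    have h1 := hM' _ (hmem l hl)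
    have h2 := hM' _ (hmem 0 (Metric.mem_ball_self hRpos))
    exact (norm_sub_le _ _).trans (by linarith)
  have h1R : (1 : ℂ) ∈ Metric.ball (0 : ℂ) R := by
    rw [mem_ball_zero_iff, norm_one, hR, one_lt_div hr0]; exact hr
  have key := Complex.dist_le_div_mul_dist_of_mapsTo_ball hd hmaps h1R
  simp only [one_smul, zero_smul, add_zero, add_sub_cancel, dist_eq_norm, sub_zero, norm_one,
    mul_one] at key
  rw [← ofReal_norm, ← ENNReal.ofReal_coe_nnreal, ← ENNReal.ofReal_mul (by positivity)]
  refine ENNReal.ofReal_le_ofReal (key.trans (le_of_eq ?_))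
  rw [hR]
  field_simp
  ring

end MeanValue

/-! ### The kernel -/

/-- The function `(1 - ⟨z, w⟩)^(-s)`. -/
def powKernel {n : ℕ} (s : ℝ) (z w : EuclideanSpace ℂ (Fin n)) : ℂ :=
  1 / (1 - inner ℂ w z) ^ (s : ℂ)

section Kernel

variable {n : ℕ} {s : ℝ} {u w z : EuclideanSpace ℂ (Fin n)}

theorem norm_powKernel (hw : ‖w‖ < 1) (hz : ‖z‖ ≤ 1) :
    ‖powKernel s z w‖ = ‖1 - (inner ℂ w z : ℂ)‖ ^ (-s) := by
  have h := norm_one_sub_inner_pos hw hz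
  rw [powKernel, norm_div, norm_one, Complex.norm_cpow_of_ne_zero (norm_pos_iff.1 h),
    Complex.ofReal_re, Complex.ofReal_im, mul_zero, Real.exp_zero, div_one,
    Real.rpow_neg h.le, one_div]

theorem enorm_powKernel (hw : ‖w‖ < 1) (hz : ‖z‖ ≤ 1) :
    ‖powKernel s z w‖ₑ = ENNReal.ofReal (‖1 - (inner ℂ w z : ℂ)‖ ^ (-s)) := by
  rw [← norm_powKernel hw hz, ofReal_norm]

theorem mem_slitPlane_one_sub_inner (hw : ‖w‖ < 1) (hz : ‖z‖ ≤ 1) :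
    1 - (inner ℂ w z : ℂ) ∈ Complex.slitPlane :=
  Or.inl (re_one_sub_inner_pos hw hz)

/-- The base has positive real part, so the principal power commutes with conjugation. The kernel is
antiholomorphic in `w`; this symmetry lets holomorphic estimates be applied to its conjugate. -/
theorem conj_powKernel (hw : ‖w‖ < 1) (hz : ‖z‖ ≤ 1) :
    (starRingEnd ℂ) (powKernel s z w) = powKernel s w z := by
  have h := Complex.mem_slitPlane_iff_arg.1 (mem_slitPlane_one_sub_inner hw hz)
  have h1 := Complex.cpow_conj (1 - (inner ℂ w z : ℂ)) (s : ℂ) h.1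
  rw [Complex.conj_ofReal] at h1
  rw [powKernel, powKernel, map_div₀, map_one, h1, Complex.conj_conj, map_sub, map_one, inner_conj_symm]

theorem norm_powKernel_symm (hw : ‖w‖ < 1) (hz : ‖z‖ ≤ 1) :
    ‖powKernel s z w‖ = ‖powKernel s w z‖ := by
  rw [← conj_powKernel hw hz, Complex.norm_conj]

theorem differentiableOn_powKernel (hw : ‖w‖ < 1) :
    DifferentiableOn ℂ (fun z => powKernel s z w) (Metric.ball 0 1) := by
  intro z hz
  have hz' : ‖z‖ ≤ 1 := (mem_ball_zero_iff.1 hz).le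
  have hm := mem_slitPlane_one_sub_inner hw hz'
  have h1 : DifferentiableAt ℂ (fun z : EuclideanSpace ℂ (Fin n) => (1 : ℂ) - inner ℂ w z) z :=
    (differentiableAt_const _).sub (innerSL ℂ w).differentiableAt
  have h2 : DifferentiableAt ℂ (fun z : EuclideanSpace ℂ (Fin n) =>
      ((1 : ℂ) - inner ℂ w z) ^ (s : ℂ)) z := h1.cpow (differentiableAt_const _) hm
  refine DifferentiableAt.differentiableWithinAt ?_
  simp only [powKernel, one_div]
  refine h2.fun_inv ?_
  rw [Complex.cpow_ne_zero_iff]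
  exact Or.inl (Complex.slitPlane_ne_zero hm)

theorem norm_powKernel_le_of_mem_hypBox (hs : 0 ≤ s) (hu : ‖u‖ < 1) (hz : ‖z‖ ≤ 1)
    (hw : w ∈ hypBox u (1 / 8)) :
    ‖powKernel s z w‖ ≤ 2 ^ s * ‖powKernel s z u‖ ∧
      ‖powKernel s z u‖ ≤ 2 ^ s * ‖powKernel s z w‖ := by
  obtain ⟨h1, h2⟩ := norm_one_sub_inner_bounds hu hz le_rfl hw
  have hw1 := norm_lt_one_of_mem_hypBox hu le_rfl hw
  have h3 := norm_one_sub_inner_pos hu hz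
  have h4 := norm_one_sub_inner_pos hw1 hz
  rw [norm_powKernel hw1 hz, norm_powKernel hu hz]
  have e : |(-s)| = s := by rw [abs_neg, abs_of_nonneg hs]
  constructor
  · have := rpow_le_two_rpow_abs_mul (b := -s) h3 (by linarith) (by linarith :
      ‖1 - (inner ℂ w z : ℂ)‖ ≤ _)
    rwa [e] at this
  · have := rpow_le_two_rpow_abs_mul (b := -s) h4 (by linarith) (by linarith :
      ‖1 - (inner ℂ u z : ℂ)‖ ≤ _)
    rwa [e] at this

theorem enorm_powKernel_le_of_mem_hypBox (hs : 0 ≤ s) (hu : ‖u‖ < 1) (hz : ‖z‖ ≤ 1)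
    (hw : w ∈ hypBox u (1 / 8)) :
    ‖powKernel s z w‖ₑ ≤ ENNReal.ofReal (2 ^ s) * ‖powKernel s z u‖ₑ ∧
      ‖powKernel s z u‖ₑ ≤ ENNReal.ofReal (2 ^ s) * ‖powKernel s z w‖ₑ := by
  obtain ⟨h1, h2⟩ := norm_powKernel_le_of_mem_hypBox hs hu hz hw
  rw [← ofReal_norm, ← ofReal_norm, ← ENNReal.ofReal_mul (by positivity),
    ← ENNReal.ofReal_mul (by positivity)]
  exact ⟨ENNReal.ofReal_le_ofReal h1, ENNReal.ofReal_le_ofReal h2⟩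

/-- Product rule for differences. On the box of size 1/32, `F` is bounded by its mean over the
larger box and the kernel by its value at the centre; the Schwarz bound applies to `F` and to the
conjugate kernel, each contributing a factor `64 r`. -/
theorem exists_enorm_mul_powKernel_sub_le {α : ℝ} (hn : 1 ≤ n) (hα : -1 < α) :
    ∃ C : ℝ, 0 < C ∧ ∀ F : EuclideanSpace ℂ (Fin n) → ℂ, DifferentiableOn ℂ F (Metric.ball 0 1) →
      ∀ z u : EuclideanSpace ℂ (Fin n), ‖z‖ < 1 → ‖u‖ < 1 → ∀ r : ℝ, 0 < r → r < 1 / 32 →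
      ∀ w ∈ hypBox u r,
        ‖F w * powKernel ((n : ℝ) + 1 + α) z w - F u * powKernel ((n : ℝ) + 1 + α) z u‖ₑ ≤
          ENNReal.ofReal (C * r) * (ENNReal.ofReal (defect u ^ (-((n : ℝ) + 1 + α))) *
            ‖powKernel ((n : ℝ) + 1 + α) z u‖ₑ *
          ∫⁻ x in Subtype.val ⁻¹' hypBox u (1 / 8), ‖F x‖ₑ ∂(weightedVolume n α)) := by
  obtain ⟨C, hC, h⟩ := exists_enorm_le_setLIntegral_hypBox hn hα
  set s := (n : ℝ) + 1 + α with hs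
  have hs0 : 0 ≤ s := by have : (0 : ℝ) ≤ n := n.cast_nonneg; linarith
  refine ⟨128 * C * 2 ^ s, by positivity, fun F hF z u hz hu r hr0 hr w hw => ?_⟩
  have hδ := defect_pos hu
  set A := ∫⁻ x in Subtype.val ⁻¹' hypBox u (1 / 8), ‖F x‖ₑ ∂(weightedVolume n α)
  have hw' := hypBox_mono hu hr.le hw
  have h32 : hypBox u (1 / 32) ⊆ hypBox u (1 / 8) := hypBox_mono hu (by norm_num)
  have hw1 := norm_lt_one_of_mem_hypBox hu (by norm_num) hw'
  set MF := ENNReal.ofReal (C * defect u ^ (-s)) * A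
  set MK := ENNReal.ofReal (2 ^ s) * ‖powKernel s z u‖ₑ
  have hFb : ∀ x ∈ hypBox u (1 / 32), ‖F x‖ₑ ≤ MF := h F hF u hu
  have hKb : ∀ x ∈ hypBox u (1 / 32), ‖powKernel s x z‖ₑ ≤ MK := fun x hx => by
    have hx1 := norm_lt_one_of_mem_hypBox hu (by norm_num) hx
    have h0 : ‖powKernel s x z‖ₑ = ‖powKernel s z x‖ₑ := by
      rw [← ofReal_norm, ← ofReal_norm, norm_powKernel_symm hx1 hz.le]
    rw [h0]
    exact (enorm_powKernel_le_of_mem_hypBox hs0 hu hz.le (h32 hx)).1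
  have h1 := enorm_sub_le_of_bound_hypBox hF hu hr0 hr hw hFb
  have h2 := enorm_sub_le_of_bound_hypBox (differentiableOn_powKernel hz) hu hr0 hr hw hKb
  have h3 : ‖powKernel s z w - powKernel s z u‖ₑ = ‖powKernel s w z - powKernel s u z‖ₑ := by
    rw [← conj_powKernel hw1 hz.le, ← conj_powKernel hu hz.le, ← map_sub, ← ofReal_norm,
      ← ofReal_norm, Complex.norm_conj]
  rw [← h3] at h2
  have h4 : ‖powKernel s z w‖ₑ ≤ MK := (enorm_powKernel_le_of_mem_hypBox hs0 hu hz.le (h32 hw')).1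
  have h5 : ‖F u‖ₑ ≤ MF := hFb u (mem_hypBox_self hu (by norm_num))
  calc _ = ‖(F w - F u) * powKernel s z w + F u * (powKernel s z w - powKernel s z u)‖ₑ := by
        congr 1; ring
    _ ≤ ‖F w - F u‖ₑ * ‖powKernel s z w‖ₑ + ‖F u‖ₑ * ‖powKernel s z w - powKernel s z u‖ₑ := by
        refine (enorm_add_le _ _).trans ?_
        rw [enorm_mul, enorm_mul]
    _ ≤ ENNReal.ofReal (64 * r) * MF * MK + MF * (ENNReal.ofReal (64 * r) * MK) := by gcongr
    _ = _ := by
        have e : ENNReal.ofReal (128 * C * 2 ^ s * r) =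
            2 * ENNReal.ofReal (64 * r) * (ENNReal.ofReal C * ENNReal.ofReal (2 ^ s)) := by
          rw [← ENNReal.ofReal_mul hC.le, ← ENNReal.ofReal_ofNat 2,
            ← ENNReal.ofReal_mul (by norm_num), ← ENNReal.ofReal_mul (by positivity)]
          congr 1; ring
        simp only [MF, MK]
        rw [e, ENNReal.ofReal_mul hC.le]
        ring

end Kernel

/-! ### Boundedness of the maximal Bergman operator -/

/-- Schur's test: Hölder applied to `k f = (k^(1/q) h) (k^(1/p) h⁻¹ f)`, then `h1` for the first
factor, Tonelli, and `h2` for the second. The final power of `C` is `p/q + 1 = p`. -/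
theorem lintegral_rpow_le_of_schur {X : Type*} [MeasurableSpace X] {V : Measure X} [SFinite V]
    {k : X → X → ℝ≥0∞} (hk : Measurable (Function.uncurry k)) {h : X → ℝ≥0∞} (hm : Measurable h)
    (h0 : ∀ x, h x ≠ 0) (ht : ∀ x, h x ≠ ∞) {p q : ℝ} (hpq : p.HolderConjugate q) {C : ℝ≥0∞}
    (h1 : ∀ z, ∫⁻ w, k z w * h w ^ q ∂V ≤ C * h z ^ q)
    (h2 : ∀ w, ∫⁻ z, k z w * h z ^ p ∂V ≤ C * h w ^ p) {f : X → ℝ≥0∞} (hf : Measurable f) :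
    ∫⁻ z, (∫⁻ w, k z w * f w ∂V) ^ p ∂V ≤ C ^ p * ∫⁻ w, f w ^ p ∂V := by
  have hp := hpq.pos
  have hq := hpq.symm.pos
  have hkz : ∀ z, Measurable (k z) := fun z => hk.of_uncurry_left
  have hkw : ∀ w, Measurable fun z => k z w := fun w => hk.of_uncurry_right
  have hpt : ∀ z, (∫⁻ w, k z w * f w ∂V) ^ p ≤
      C ^ (p / q) * (h z ^ p * ∫⁻ w, k z w * (h w ^ (-p) * f w ^ p) ∂V) := by
    intro z
    have e : ∀ w, k z w * f w =
        ((fun w => k z w ^ (1 / q) * h w) * fun w => k z w ^ (1 / p) * ((h w)⁻¹ * f w)) w := by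
      intro w
      have hk1 : k z w ^ (1 / q) * k z w ^ (1 / p) = k z w := by
        rw [← ENNReal.rpow_add_of_nonneg _ _ (by positivity) (by positivity), one_div, one_div,
          add_comm, hpq.inv_add_inv_eq_one, ENNReal.rpow_one]
      calc k z w * f w = (k z w ^ (1 / q) * k z w ^ (1 / p)) * (h w * (h w)⁻¹) * f w := by
            rw [hk1, ENNReal.mul_inv_cancel (h0 w) (ht w), mul_one]
        _ = _ := by simp only [Pi.mul_apply]; ring
    have hold := ENNReal.lintegral_mul_le_Lp_mul_Lq V hpq.symm
      (f := fun w => k z w ^ (1 / q) * h w) (g := fun w => k z w ^ (1 / p) * ((h w)⁻¹ * f w))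
      (((hkz z).pow_const _).mul hm).aemeasurable
      (((hkz z).pow_const _).mul (hm.inv.mul hf)).aemeasurable
    have e1 : ∀ w, (k z w ^ (1 / q) * h w) ^ q = k z w * h w ^ q := fun w => by
      rw [ENNReal.mul_rpow_of_nonneg _ _ hq.le, ← ENNReal.rpow_mul, one_div_mul_cancel hq.ne',
        ENNReal.rpow_one]
    have e2 : ∀ w, (k z w ^ (1 / p) * ((h w)⁻¹ * f w)) ^ p =
        k z w * (h w ^ (-p) * f w ^ p) := fun w => by
      rw [ENNReal.mul_rpow_of_nonneg _ _ hp.le, ← ENNReal.rpow_mul, one_div_mul_cancel hp.ne',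
        ENNReal.rpow_one, ENNReal.mul_rpow_of_nonneg _ _ hp.le, ENNReal.inv_rpow,
        ENNReal.rpow_neg]
    simp_rw [e1, e2] at hold
    calc (∫⁻ w, k z w * f w ∂V) ^ p
        ≤ ((C * h z ^ q) ^ (1 / q) *
          (∫⁻ w, k z w * (h w ^ (-p) * f w ^ p) ∂V) ^ (1 / p)) ^ p := by
          simp_rw [e]
          gcongr
          refine hold.trans ?_
          gcongr
          exact h1 z
      _ = _ := by
          rw [ENNReal.mul_rpow_of_nonneg _ _ hp.le, ← ENNReal.rpow_mul, ← ENNReal.rpow_mul,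
            one_div_mul_cancel hp.ne', ENNReal.rpow_one,
            ENNReal.mul_rpow_of_nonneg _ _ (by positivity), ← ENNReal.rpow_mul,
            show 1 / q * p = p / q by ring, show q * (p / q) = p by field_simp, mul_assoc]
  have hkm : Measurable (Function.uncurry fun z w => h z ^ p * (k z w * (h w ^ (-p) * f w ^ p))) := by
    refine Measurable.mul ((hm.comp measurable_fst).pow_const _) (hk.mul ?_)
    exact ((hm.comp measurable_snd).pow_const _).mul ((hf.comp measurable_snd).pow_const _)
  calc _ ≤ ∫⁻ z, C ^ (p / q) * (h z ^ p * ∫⁻ w, k z w * (h w ^ (-p) * f w ^ p) ∂V) ∂V :=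
        lintegral_mono hpt
    _ = C ^ (p / q) * ∫⁻ z, ∫⁻ w, h z ^ p * (k z w * (h w ^ (-p) * f w ^ p)) ∂V ∂V := by
        have hin : ∀ z, h z ^ p * ∫⁻ w, k z w * (h w ^ (-p) * f w ^ p) ∂V =
            ∫⁻ w, h z ^ p * (k z w * (h w ^ (-p) * f w ^ p)) ∂V := fun z => by
          exact (lintegral_const_mul _ ((hkz z).mul ((hm.pow_const _).mul (hf.pow_const _)))).symm
        simp_rw [hin]
        exact lintegral_const_mul _ hkm.lintegral_prod_right'
    _ = C ^ (p / q) * ∫⁻ w, ∫⁻ z, h z ^ p * (k z w * (h w ^ (-p) * f w ^ p)) ∂V ∂V := by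
        rw [lintegral_lintegral_swap hkm.aemeasurable]
    _ ≤ C ^ (p / q) * ∫⁻ w, C * f w ^ p ∂V := by
        gcongr with w
        calc ∫⁻ z, h z ^ p * (k z w * (h w ^ (-p) * f w ^ p)) ∂V
            = (∫⁻ z, k z w * h z ^ p ∂V) * (h w ^ (-p) * f w ^ p) := by
              refine Eq.trans ?_ (lintegral_mul_const _ ((hkw w).mul (hm.pow_const _)))
              refine lintegral_congr fun z => ?_
              ring
          _ ≤ (C * h w ^ p) * (h w ^ (-p) * f w ^ p) := by gcongr; exact h2 w
          _ = C * (h w ^ p * h w ^ (-p)) * f w ^ p := by ring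
          _ = _ := by
              rw [← ENNReal.rpow_add _ _ (h0 w) (ht w), add_neg_cancel, ENNReal.rpow_zero, mul_one]
    _ = _ := by
        rw [lintegral_const_mul _ (hf.pow_const _), ← mul_assoc]
        congr 1
        nth_rewrite 2 [← ENNReal.rpow_one C]
        rw [← ENNReal.rpow_add_of_nonneg _ _ (by positivity) zero_le_one]
        congr 1
        have := hpq.inv_add_inv_eq_one
        field_simp at this ⊢
        linarith

section BergmanOperator

variable {n : ℕ} {α : ℝ}

theorem exists_weightedVolume_forelliRudin (hn : 1 ≤ n) (hα : -1 < α) {β t : ℝ} (hβ : -1 < β)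
    (ht : 0 < t) :
    ∃ C : ℝ, 0 < C ∧ ∀ z : UnitBall n,
      ∫⁻ w : UnitBall n, ENNReal.ofReal (defect (w : EuclideanSpace ℂ (Fin n)) ^ (β - α) *
        ‖1 - (inner ℂ (z : EuclideanSpace ℂ (Fin n)) (w : EuclideanSpace ℂ (Fin n)) : ℂ)‖ ^
          (-(n + 1 + β + t))) ∂(weightedVolume n α) ≤
      ENNReal.ofReal (C * defect (z : EuclideanSpace ℂ (Fin n)) ^ (-t)) := by
  obtain ⟨c, hc, h⟩ := exists_weightedVolume_lintegral n hα
  obtain ⟨C, hC, h'⟩ := lintegral_ball_forelliRudin hn hβ ht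
  -- `C` may vanish, hence `C + 1` to have a positive constant.
  refine ⟨c * (C + 1), by positivity, fun z => ?_⟩
  rw [h fun w => ENNReal.ofReal (defect w ^ (β - α) *
    ‖1 - (inner ℂ (z : EuclideanSpace ℂ (Fin n)) w : ℂ)‖ ^ (-(n + 1 + β + t))), mul_assoc,
    ENNReal.ofReal_mul hc.le]
  gcongr
  refine le_trans (le_of_eq ?_) ((h' z z.norm_lt_one).trans (ENNReal.ofReal_le_ofReal ?_))
  · refine setLIntegral_congr_fun measurableSet_ball fun w hw => ?_
    have hδ := defect_pos (mem_ball_zero_iff.1 hw)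
    rw [← ENNReal.ofReal_mul (by positivity), ← mul_assoc, ← Real.rpow_add hδ, add_sub_cancel]
    rfl
  · have := Real.rpow_nonneg z.defect_pos.le (-t)
    change C * defect (z : EuclideanSpace ℂ (Fin n)) ^ (-t) ≤ _
    gcongr
    linarith

theorem continuous_powKernel_prod (s : ℝ) : Continuous fun q : UnitBall n × UnitBall n =>
    powKernel s (q.1 : EuclideanSpace ℂ (Fin n)) (q.2 : EuclideanSpace ℂ (Fin n)) := by
  unfold powKernel
  refine Continuous.div continuous_const ?_ fun q => ?_
  · refine Continuous.cpow (by fun_prop) continuous_const fun q => ?_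
    exact mem_slitPlane_one_sub_inner q.2.norm_lt_one q.1.norm_lt_one.le
  · rw [Complex.cpow_ne_zero_iff]
    exact Or.inl (Complex.slitPlane_ne_zero
      (mem_slitPlane_one_sub_inner q.2.norm_lt_one q.1.norm_lt_one.le))

/-- Schur's test with `h = δ^(-a)`. Forelli–Rudin with weight exponent `β = α - t` reproduces
`δ^(-t)`, because `n + 1 + β + t` is then the kernel exponent; it is needed for `t = a q` and `t = a
p`. -/
theorem exists_lintegral_powKernel_rpow_le (hn : 1 ≤ n) (hα : -1 < α) {p q : ℝ}
    (hpq : p.HolderConjugate q) :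
    ∃ C : ℝ≥0, ∀ f : UnitBall n → ℝ≥0∞, Measurable f →
      ∫⁻ z : UnitBall n, (∫⁻ w : UnitBall n, ‖powKernel ((n : ℝ) + 1 + α) (z : EuclideanSpace ℂ (Fin n))
        (w : EuclideanSpace ℂ (Fin n))‖ₑ * f w ∂(weightedVolume n α)) ^ p ∂(weightedVolume n α) ≤
      C * ∫⁻ w, f w ^ p ∂(weightedVolume n α) := by
  have := isProbabilityMeasure_weightedVolume (n := n) hα
  have hp := hpq.pos
  have hq := hpq.symm.pos
  -- This makes both `a p` and `a q` smaller than `α + 1`, so that `α - t > -1`.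
  set a := (α + 1) / (2 * (p + q)) with ha
  have hα1 : 0 < α + 1 := by linarith
  have ha0 : 0 < a := by positivity
  have hapq : a * (p + q) = (α + 1) / 2 := by rw [ha]; field_simp
  have key : ∀ t, 0 < t → t < α + 1 → ∃ C : ℝ, 0 < C ∧ ∀ z : UnitBall n,
      ∫⁻ w : UnitBall n, ‖powKernel ((n : ℝ) + 1 + α) (z : EuclideanSpace ℂ (Fin n))
        (w : EuclideanSpace ℂ (Fin n))‖ₑ * ENNReal.ofReal (defect (w : EuclideanSpace ℂ (Fin n)) ^ (-t))
          ∂(weightedVolume n α) ≤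
        ENNReal.ofReal C * ENNReal.ofReal (defect (z : EuclideanSpace ℂ (Fin n)) ^ (-t)) := by
    intro t ht ht'
    obtain ⟨C, hC, h⟩ := exists_weightedVolume_forelliRudin hn hα (β := α - t) (by linarith) ht
    refine ⟨C, hC, fun z => ?_⟩
    rw [← ENNReal.ofReal_mul hC.le]
    refine le_trans (le_of_eq (lintegral_congr fun w => ?_)) (h z)
    rw [enorm_powKernel w.norm_lt_one z.norm_lt_one.le, ← ENNReal.ofReal_mul (by positivity),
      norm_one_sub_inner_symm, mul_comm]
    congr 3 <;> ring
  obtain ⟨C₁, hC₁, h₁⟩ := key (a * q) (by positivity) (by nlinarith)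
  obtain ⟨C₂, hC₂, h₂⟩ := key (a * p) (by positivity) (by nlinarith)
  set h : UnitBall n → ℝ≥0∞ := fun w =>
    ENNReal.ofReal (defect (w : EuclideanSpace ℂ (Fin n)) ^ (-a)) with hh
  have hpow : ∀ (w : UnitBall n) (x : ℝ), 0 ≤ x → h w ^ x =
      ENNReal.ofReal (defect (w : EuclideanSpace ℂ (Fin n)) ^ (-(a * x))) := fun w x hx => by
    rw [hh]
    simp only
    rw [ENNReal.ofReal_rpow_of_nonneg (Real.rpow_nonneg w.defect_pos.le _) hx,
      ← Real.rpow_mul w.defect_pos.le]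
    congr 2; ring
  refine ⟨(max C₁ C₂).toNNReal ^ p, fun f hf => ?_⟩
  rw [ENNReal.coe_rpow_of_nonneg _ hp.le]
  refine lintegral_rpow_le_of_schur (h := h) (continuous_powKernel_prod _).measurable.enorm ?_ ?_
    ?_ hpq ?_ ?_ hf
  · have := (continuous_defect (n := n)).measurable
    fun_prop
  · intro w
    simpa [hh] using Real.rpow_pos_of_pos w.defect_pos (-a)
  · intro w; exact ENNReal.ofReal_ne_top
  · intro z
    simp_rw [hpow _ _ hq.le]
    refine (h₁ z).trans ?_
    gcongr
    exact ENNReal.ofReal_le_ofReal (le_max_left _ _)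
  · intro w
    simp_rw [hpow _ _ hp.le]
    have e : ∀ z : UnitBall n, ‖powKernel ((n : ℝ) + 1 + α) (z : EuclideanSpace ℂ (Fin n))
        (w : EuclideanSpace ℂ (Fin n))‖ₑ = ‖powKernel ((n : ℝ) + 1 + α) (w : EuclideanSpace ℂ (Fin n))
        (z : EuclideanSpace ℂ (Fin n))‖ₑ := fun z => by
      rw [← ofReal_norm, ← ofReal_norm, norm_powKernel_symm w.norm_lt_one z.norm_lt_one.le]
    simp_rw [e]
    refine (h₂ w).trans ?_
    gcongr
    exact ENNReal.ofReal_le_ofReal (le_max_right _ _)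

end BergmanOperator

/-! ### Polar decomposition of complex measures -/

section ComplexMeasure

variable {X : Type*} [MeasurableSpace X]

/-- Radon–Nikodym for the real and imaginary parts gives a density `g` with respect to the variation
`ν`. The variation of `g ν` is `|g| ν`, so `|g| ν = ν` and `|g| = 1` almost everywhere. -/
theorem MeasureTheory.ComplexMeasure.exists_density (m : ComplexMeasure X)
    [IsFiniteMeasure m.variation] :
    ∃ h : X → ℂ, Measurable h ∧ (∀ x, ‖h x‖ ≤ 1) ∧ m = m.variation.withDensityᵥ h := by
  set ν := m.variation with hν
  have hac : ∀ s : Set X, ν s = 0 → m s = 0 := fun s hs => by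
    have := VectorMeasure.enorm_measure_le_variation m s
    rw [← hν, hs] at this
    simpa using this
  have hre : ComplexMeasure.re m ≪ᵥ ν.toENNRealVectorMeasure := by
    refine VectorMeasure.AbsolutelyContinuous.mk fun s hs h => ?_
    rw [Measure.toENNRealVectorMeasure_apply_measurable hs] at h
    simp [ComplexMeasure.re, VectorMeasure.mapRangeₗ, VectorMeasure.mapRange_apply, hac s h]
  have him : ComplexMeasure.im m ≪ᵥ ν.toENNRealVectorMeasure := by
    refine VectorMeasure.AbsolutelyContinuous.mk fun s hs h => ?_
    rw [Measure.toENNRealVectorMeasure_apply_measurable hs] at h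
    simp [ComplexMeasure.im, VectorMeasure.mapRangeₗ, VectorMeasure.mapRange_apply, hac s h]
  set a := (ComplexMeasure.re m).rnDeriv ν
  set b := (ComplexMeasure.im m).rnDeriv ν
  have ha : Integrable a ν := SignedMeasure.integrable_rnDeriv _ _
  have hb : Integrable b ν := SignedMeasure.integrable_rnDeriv _ _
  have h1 := SignedMeasure.withDensityᵥ_rnDeriv_eq _ ν hre
  have h2 := SignedMeasure.withDensityᵥ_rnDeriv_eq _ ν him
  set g : X → ℂ := fun x => (a x : ℂ) + (b x : ℂ) * Complex.I
  have hg : Integrable g ν := ha.ofReal.add (hb.ofReal.mul_const _)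
  have hmg : m = ν.withDensityᵥ g := by
    ext s hs
    rw [withDensityᵥ_apply hg hs]
    have e1 : (m s).re = ∫ x in s, a x ∂ν := by
      rw [← withDensityᵥ_apply ha hs, h1]; rfl
    have e2 : (m s).im = ∫ x in s, b x ∂ν := by
      rw [← withDensityᵥ_apply hb hs, h2]; rfl
    rw [integral_add ha.ofReal.restrict (hb.ofReal.mul_const _).restrict,
      integral_mul_const, integral_complex_ofReal, integral_complex_ofReal, ← e1, ← e2, Complex.re_add_im]
  have hvar : ν = ν.withDensity fun x => ‖g x‖ₑ := by
    rw [← Measure.variation_withDensityᵥ hg, ← hmg]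
  have hnorm : ∀ᵐ x ∂ν, ‖g x‖ₑ = 1 := by
    have : (fun x => ‖g x‖ₑ) =ᵐ[ν] fun _ => 1 := by
      rw [← withDensity_eq_iff_of_sigmaFinite hg.aestronglyMeasurable.enorm aemeasurable_const,
        withDensity_const, one_smul, ← hvar]
    exact this
  set g' := hg.aestronglyMeasurable.mk g
  have hg'm : Measurable g' := hg.aestronglyMeasurable.stronglyMeasurable_mk.measurable
  have hgg' : g =ᵐ[ν] g' := hg.aestronglyMeasurable.ae_eq_mk
  -- Cutting the measurable representative off outside this set of full measure makes the bound hold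
  -- at every point.
  have hS : MeasurableSet {x | ‖g' x‖ ≤ 1} := measurableSet_le hg'm.norm measurable_const
  refine ⟨{x | ‖g' x‖ ≤ 1}.indicator g', hg'm.indicator hS, fun x => ?_, ?_⟩
  · by_cases hx : x ∈ {x | ‖g' x‖ ≤ 1}
    · rw [Set.indicator_of_mem hx]; exact hx
    · rw [Set.indicator_of_notMem hx]; simp
  · nth_rewrite 1 [hmg]
    refine WithDensityᵥEq.congr_ae ?_
    filter_upwards [hgg', hnorm] with x hx hx1
    have : x ∈ {x | ‖g' x‖ ≤ 1} := by
      rw [Set.mem_ofPred_eq, ← hx, ← toReal_enorm, hx1, ENNReal.toReal_one]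
    rw [Set.indicator_of_mem this, hx]

/-- Both sides are additive and continuous in `L¹(|m|)`, the right one because `|h| ≤ 1`; on
multiples of indicators the identity is the definition of the density. -/
theorem MeasureTheory.ComplexMeasure.integral_mul_eq {m : ComplexMeasure X}
    [IsFiniteMeasure m.variation] {h : X → ℂ} (hm : Measurable h) (hb : ∀ x, ‖h x‖ ≤ 1)
    (hmh : m = m.variation.withDensityᵥ h) {f : X → ℂ} (hf : Integrable f m.variation) :
    m.integral f (ContinuousLinearMap.mul ℝ ℂ) = ∫ x, f x * h x ∂m.variation := by
  set ν := m.variation with hν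
  have hint : Integrable h ν := Integrable.of_bound hm.aestronglyMeasurable 1
    (Filter.Eventually.of_forall hb)
  have hmul : ∀ {g : X → ℂ}, Integrable g ν → Integrable (fun x => g x * h x) ν := fun hg =>
    hg.mul_bdd hm.aestronglyMeasurable (Filter.Eventually.of_forall hb)
  refine Integrable.induction (fun f => m.integral f (ContinuousLinearMap.mul ℝ ℂ) =
    ∫ x, f x * h x ∂ν) ?_ ?_ ?_ ?_ hf
  · intro c s hs _
    have e : ∀ x, s.indicator (fun _ => c) x * h x = s.indicator (fun x => c * h x) x := fun x => by
      by_cases hx : x ∈ s <;> simp [hx]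
    simp_rw [e]
    have hfin : IsFiniteMeasure (m.restrict s).variation := inferInstance
    rw [VectorMeasure.integral_indicator hs, VectorMeasure.integral_const,
      MeasureTheory.integral_indicator hs, integral_const_mul, VectorMeasure.restrict_apply _ hs
      MeasurableSet.univ, Set.univ_inter, ← withDensityᵥ_apply hint hs, ← hmh]
    rfl
  · intro f g _ hf hg h1 h2
    rw [VectorMeasure.integral_add hf hg, h1, h2, ← integral_add (hmul hf) (hmul hg)]
    simp [add_mul]
  · refine isClosed_eq VectorMeasure.continuous_integral ?_
    have hbd : Continuous fun f : Lp ℂ 1 ν => ∫ x, f x * h x ∂ν := by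
      refine continuous_iff_continuousAt.2 fun f => ?_
      have hL : LipschitzWith 1 fun f : Lp ℂ 1 ν => ∫ x, f x * h x ∂ν := by
        refine LipschitzWith.of_dist_le_mul fun f g => ?_
        rw [dist_eq_norm, ← integral_sub (hmul (L1.integrable_coeFn f))
          (hmul (L1.integrable_coeFn g)), NNReal.coe_one, one_mul, dist_eq_norm, L1.norm_sub_eq_lintegral,
          ← integral_norm_eq_lintegral_enorm (f := fun x => f x - g x)
            ((L1.integrable_coeFn f).sub (L1.integrable_coeFn g)).aestronglyMeasurable]
        refine (norm_integral_le_integral_norm _).trans (integral_mono_of_nonneg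
          (Filter.Eventually.of_forall fun _ => norm_nonneg _)
          ((L1.integrable_coeFn f).sub (L1.integrable_coeFn g)).norm
          (Filter.Eventually.of_forall fun x => ?_))
        simp only [← sub_mul, norm_mul]
        exact mul_le_of_le_one_right (norm_nonneg _) (hb x)
      exact hL.continuous.continuousAt
    exact hbd
  · intro f g hfg _ h1
    rw [← VectorMeasure.integral_congr_ae hfg, h1]
    refine integral_congr_ae ?_
    filter_upwards [hfg] with x hx
    rw [hx]

end ComplexMeasure

/-! ### Carleson measures -/

section Carleson

variable {n d : ℕ} {α : ℝ} {p : ℝ≥0∞} [Fact (1 ≤ p)]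

/-- Test functions for the Carleson inequality: a power of the kernel times a coordinate vector,
bounded on the ball because `w` is an interior point. -/
theorem exists_bergmanSpace_enorm_eq_powKernel (hα : -1 < α) {τ : ℝ} (hτ : 0 ≤ τ) (w : UnitBall n)
    (i : Fin d) :
    ∃ f : BergmanSpace n d α p, ∀ z : UnitBall n, ‖f z‖ₑ =
      ‖powKernel τ (z : EuclideanSpace ℂ (Fin n)) (w : EuclideanSpace ℂ (Fin n))‖ₑ := by
  have := isProbabilityMeasure_weightedVolume (n := n) hα
  set e : CdLp p d := WithLp.toLp p (Pi.single i 1)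
  have he : ‖e‖ = 1 := by
    simp [e]
  have hn : ∀ z : UnitBall n, ‖powKernel τ (z : EuclideanSpace ℂ (Fin n))
      (w : EuclideanSpace ℂ (Fin n)) • e‖ = ‖powKernel τ (z : EuclideanSpace ℂ (Fin n))
      (w : EuclideanSpace ℂ (Fin n))‖ := fun z => by rw [norm_smul, he, mul_one]
  refine ⟨⟨fun z => powKernel τ (z : EuclideanSpace ℂ (Fin n)) (w : EuclideanSpace ℂ (Fin n)) • e,
    ⟨fun z => powKernel τ z (w : EuclideanSpace ℂ (Fin n)) • e,
      (differentiableOn_powKernel w.norm_lt_one).smul_const e, fun _ => rfl⟩, ?_⟩, fun z => ?_⟩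
  · have hc : Continuous fun z : UnitBall n => powKernel τ (z : EuclideanSpace ℂ (Fin n))
        (w : EuclideanSpace ℂ (Fin n)) • e :=
      ((continuous_powKernel_prod τ).comp (continuous_id.prodMk continuous_const)).smul
        continuous_const
    refine MemLp.of_bound hc.aestronglyMeasurable
      ((1 - ‖(w : EuclideanSpace ℂ (Fin n))‖) ^ (-τ)) (Eventually.of_forall fun z => ?_)
    rw [hn, norm_powKernel w.norm_lt_one z.norm_lt_one.le]
    exact Real.rpow_le_rpow_of_nonpos (by linarith [w.norm_lt_one])
      (one_sub_norm_le z.norm_lt_one.le) (by linarith)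
  · change ‖powKernel τ (z : EuclideanSpace ℂ (Fin n)) (w : EuclideanSpace ℂ (Fin n)) • e‖ₑ = _
    rw [← ofReal_norm, hn, ofReal_norm]

/-- Carleson measures are finite. -/
theorem IsBergmanCarleson.isFiniteMeasure (hα : -1 < α) (hd : 1 ≤ d) {ν : Measure (UnitBall n)}
    (h : IsBergmanCarleson n d α p ν) : IsFiniteMeasure ν := by
  have := isProbabilityMeasure_weightedVolume (n := n) hα
  obtain ⟨C, hC⟩ := h
  let o : UnitBall n := ⟨0, by simp⟩
  -- Exponent 0 gives a test function of norm 1 at every point.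
  obtain ⟨f, hf⟩ := exists_bergmanSpace_enorm_eq_powKernel (p := p) hα (le_refl (0 : ℝ)) o
    (⟨0, hd⟩ : Fin d)
  have h1 : ∀ z : UnitBall n, ‖f z‖ₑ ^ p.toReal = 1 := fun z => by
    rw [hf z]; simp [powKernel]
  have h2 := hC f
  simp only [h1, lintegral_const, one_mul, measure_univ, mul_one] at h2
  exact ⟨h2.trans_lt ENNReal.coe_lt_top⟩

/-- A Carleson measure gives a box a mass which is at most comparable with its volume. -/
theorem IsBergmanCarleson.exists_hypBox_le (hn : 1 ≤ n) (hα : -1 < α) (hd : 1 ≤ d) (hp : p ≠ ∞)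
    {ν : Measure (UnitBall n)} (h : IsBergmanCarleson n d α p ν) :
    ∃ C : ℝ, 0 < C ∧ ∀ w : UnitBall n,
      ν (Subtype.val ⁻¹' hypBox (w : EuclideanSpace ℂ (Fin n)) (1 / 2)) ≤
        ENNReal.ofReal (C * defect (w : EuclideanSpace ℂ (Fin n)) ^ ((n : ℝ) + 1 + α)) := by
  obtain ⟨A, hA⟩ := h
  obtain ⟨C, hC, hFR⟩ := exists_weightedVolume_forelliRudin hn hα hα one_pos
  have hp0 : 0 < p.toReal := ENNReal.toReal_pos (zero_lt_one.trans_le Fact.out).ne' hp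
  set s := (n : ℝ) + 1 + α with hs
  have hs0 : 0 < s + 1 := by have : (0 : ℝ) ≤ n := n.cast_nonneg; linarith
  refine ⟨(3 / 2) ^ (s + 1) * ((A + 1) * C), by positivity, fun w => ?_⟩
  have hδ := w.defect_pos
  set δ := defect (w : EuclideanSpace ℂ (Fin n))
  -- The exponent makes `‖f‖^p = |1 - ⟨z, w⟩| ^ (-(s + 1))`. By Forelli–Rudin with `t = 1` its
  -- volume integral is at most `C δ⁻¹`, while on the box `|1 - ⟨z, w⟩| ≤ 3δ/2` makes it at least
  -- `(3δ/2) ^ (-(s + 1))`. The quotient is of order `δ^s`.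
  obtain ⟨f, hf⟩ := exists_bergmanSpace_enorm_eq_powKernel (p := p) hα
    (τ := (s + 1) / p.toReal) (by positivity) w (⟨0, hd⟩ : Fin d)
  have hfp : ∀ z : UnitBall n, ‖f z‖ₑ ^ p.toReal = ENNReal.ofReal
      (‖1 - (inner ℂ (w : EuclideanSpace ℂ (Fin n)) (z : EuclideanSpace ℂ (Fin n)) : ℂ)‖ ^
        (-(s + 1))) := fun z => by
    rw [hf z, enorm_powKernel w.norm_lt_one z.norm_lt_one.le,
      ENNReal.ofReal_rpow_of_nonneg (by positivity) hp0.le, ← Real.rpow_mul (norm_nonneg _)]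
    congr 2
    field_simp
  have h1 : ∫⁻ z, ‖f z‖ₑ ^ p.toReal ∂(weightedVolume n α) ≤ ENNReal.ofReal (C * δ ^ (-1 : ℝ)) := by
    refine le_trans (le_of_eq (lintegral_congr fun z => ?_)) (hFR w)
    rw [hfp z, sub_self, Real.rpow_zero, one_mul]
  have h2 : ENNReal.ofReal ((3 / 2 * δ) ^ (-(s + 1))) *
      ν (Subtype.val ⁻¹' hypBox (w : EuclideanSpace ℂ (Fin n)) (1 / 2)) ≤
        ∫⁻ z, ‖f z‖ₑ ^ p.toReal ∂ν := by
    have hm : MeasurableSet (Subtype.val ⁻¹' hypBox (w : EuclideanSpace ℂ (Fin n)) (1 / 2) :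
        Set (UnitBall n)) := (isOpen_hypBox.preimage continuous_subtype_val).measurableSet
    rw [← setLIntegral_const]
    refine (setLIntegral_mono' hm fun z hz => ?_).trans (setLIntegral_le_lintegral _ _)
    rw [hfp z]
    refine ENNReal.ofReal_le_ofReal (Real.rpow_le_rpow_of_nonpos
      (norm_one_sub_inner_pos w.norm_lt_one z.norm_lt_one.le) ?_ (by linarith))
    have hz : boxGauge (w : EuclideanSpace ℂ (Fin n)) ((z : EuclideanSpace ℂ (Fin n)) - w) <
      1 / 2 * δ := hz
    have e : 1 - (inner ℂ (w : EuclideanSpace ℂ (Fin n)) (z : EuclideanSpace ℂ (Fin n)) : ℂ) =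
        (δ : ℂ) - inner ℂ (w : EuclideanSpace ℂ (Fin n)) ((z : EuclideanSpace ℂ (Fin n)) - w) := by
      have e0 : (inner ℂ (w : EuclideanSpace ℂ (Fin n)) (w : EuclideanSpace ℂ (Fin n)) : ℂ) =
          ((‖(w : EuclideanSpace ℂ (Fin n))‖ ^ 2 : ℝ) : ℂ) := by
        rw [inner_self_eq_norm_sq_to_K]; push_cast; rfl
      simp only [δ, defect, inner_sub_right, e0]
      push_cast
      ring
    have h3 := norm_sub_le (δ : ℂ)
      (inner ℂ (w : EuclideanSpace ℂ (Fin n)) ((z : EuclideanSpace ℂ (Fin n)) - w))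
    rw [← e, Complex.norm_real, Real.norm_of_nonneg hδ.le] at h3
    have h4 : ‖(inner ℂ (w : EuclideanSpace ℂ (Fin n)) ((z : EuclideanSpace ℂ (Fin n)) - w) : ℂ)‖ ≤
        boxGauge (w : EuclideanSpace ℂ (Fin n)) ((z : EuclideanSpace ℂ (Fin n)) - w) := by
      unfold boxGauge
      have : 0 ≤ √(defect (w : EuclideanSpace ℂ (Fin n))) *
        ‖(z : EuclideanSpace ℂ (Fin n)) - w‖ := by positivity
      linarith
    linarith
  have h3 := h2.trans ((hA f).trans (mul_le_mul_right h1 _))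
  have h4 : ν (Subtype.val ⁻¹' hypBox (w : EuclideanSpace ℂ (Fin n)) (1 / 2)) =
      ENNReal.ofReal ((3 / 2 * δ) ^ (s + 1)) * (ENNReal.ofReal ((3 / 2 * δ) ^ (-(s + 1))) *
      ν (Subtype.val ⁻¹' hypBox (w : EuclideanSpace ℂ (Fin n)) (1 / 2))) := by
    rw [← mul_assoc, ← ENNReal.ofReal_mul (by positivity), ← Real.rpow_add (by positivity),
      add_neg_cancel, Real.rpow_zero, ENNReal.ofReal_one, one_mul]
  rw [h4]
  refine (mul_le_mul_right h3 _).trans ?_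
  rw [← ENNReal.ofReal_coe_nnreal, ← ENNReal.ofReal_mul (by positivity),
    ← ENNReal.ofReal_mul (by positivity)]
  refine ENNReal.ofReal_le_ofReal ?_
  have e1 : δ ^ (s + 1) * δ ^ (-1 : ℝ) = δ ^ s := by
    rw [← Real.rpow_add hδ]; congr 1; ring
  rw [Real.mul_rpow (by norm_num) hδ.le]
  calc (3 / 2 : ℝ) ^ (s + 1) * δ ^ (s + 1) * (A * (C * δ ^ (-1 : ℝ)))
      = (3 / 2 : ℝ) ^ (s + 1) * (A * C) * (δ ^ (s + 1) * δ ^ (-1 : ℝ)) := by ring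
    _ ≤ _ := by
      rw [e1]
      gcongr
      linarith

end Carleson

/-! ### Integral operators with the Bergman kernel -/

section Operators

variable {n d : ℕ} {α : ℝ} {p : ℝ≥0∞} [Fact (1 ≤ p)]

theorem hasFDerivAt_powKernel {s : ℝ} {z w : EuclideanSpace ℂ (Fin n)} (hw : ‖w‖ < 1)
    (hz : ‖z‖ ≤ 1) :
    HasFDerivAt (fun z => powKernel s z w) (((s : ℂ) * powKernel (s + 1) z w) • innerSL ℂ w) z := by
  have hm := mem_slitPlane_one_sub_inner hw hz
  have h1 : HasFDerivAt (fun z : EuclideanSpace ℂ (Fin n) => (1 : ℂ) - inner ℂ w z)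
      (-(innerSL ℂ w)) z := by
    simpa using (innerSL ℂ w).hasFDerivAt.const_sub (1 : ℂ) (x := z)
  have h2 : HasDerivAt (fun x : ℂ => x ^ (-(s : ℂ))) (-(s : ℂ) * (1 - inner ℂ w z) ^ (-(s : ℂ) - 1))
      (1 - inner ℂ w z) := by
    simpa using (hasDerivAt_id (1 - (inner ℂ w z : ℂ))).cpow_const (c := -(s : ℂ)) hm
  have h3 := h2.comp_hasFDerivAt z h1
  have e : (fun z => powKernel s z w) = (fun x : ℂ => x ^ (-(s : ℂ))) ∘
      fun z : EuclideanSpace ℂ (Fin n) => (1 : ℂ) - inner ℂ w z := by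
    funext z
    simp [powKernel, Complex.cpow_neg]
  rw [e]
  have e2 : ((s : ℂ) * powKernel (s + 1) z w) • innerSL ℂ w =
      (-(s : ℂ) * (1 - inner ℂ w z) ^ (-(s : ℂ) - 1)) • -(innerSL ℂ w) := by
    rw [smul_neg, ← neg_smul, powKernel, one_div, ← Complex.cpow_neg]
    congr 1
    push_cast
    ring_nf
  rw [e2]
  exact h3

theorem norm_powKernel_le {s R : ℝ} (hs : 0 ≤ s) (hR : R < 1) {z w : EuclideanSpace ℂ (Fin n)}
    (hw : ‖w‖ < 1) (hz : ‖z‖ ≤ R) : ‖powKernel s z w‖ ≤ (1 - R) ^ (-s) := by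
  rw [norm_powKernel hw (hz.trans hR.le)]
  refine Real.rpow_le_rpow_of_nonpos (by linarith) ?_ (by linarith)
  rw [norm_one_sub_inner_symm]
  have := one_sub_norm_le (u := z) hw.le
  linarith

theorem continuous_powKernel_right (s : ℝ) (z : UnitBall n) :
    Continuous fun w : UnitBall n => powKernel s (z : EuclideanSpace ℂ (Fin n))
      (w : EuclideanSpace ℂ (Fin n)) :=
  Continuous.uncurry_left (f := fun (z w : UnitBall n) => powKernel s (z : EuclideanSpace ℂ (Fin n))
    (w : EuclideanSpace ℂ (Fin n))) z (continuous_powKernel_prod s)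

theorem norm_fderiv_powKernel_le {s R : ℝ} (hs : 0 ≤ s) (hR : R < 1)
    {z w : EuclideanSpace ℂ (Fin n)} (hw : ‖w‖ < 1) (hz : ‖z‖ ≤ R) :
    ‖((s : ℂ) * powKernel (s + 1) z w) • innerSL ℂ w‖ ≤ s * (1 - R) ^ (-(s + 1)) := by
  rw [norm_smul, norm_mul, innerSL_apply_norm, Complex.norm_real, Real.norm_of_nonneg hs]
  have h1 := norm_powKernel_le (s := s + 1) (by linarith) hR hw hz
  have h3 : 0 ≤ (1 - R) ^ (-(s + 1)) := Real.rpow_nonneg (by linarith) _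
  calc _ ≤ s * (1 - R) ^ (-(s + 1)) * 1 := by gcongr
    _ = _ := mul_one _

/-- Differentiation under the integral sign: for `|z| ≤ R < 1` the derivative of the kernel is
bounded uniformly in `w`, so a multiple of `|g|` dominates. -/
theorem differentiableOn_integral_powKernel {m : Measure (UnitBall n)} {s : ℝ} (hs : 0 ≤ s)
    {g : UnitBall n → ℂ} (hg : Integrable g m) :
    DifferentiableOn ℂ (fun z : EuclideanSpace ℂ (Fin n) =>
      ∫ w : UnitBall n, g w * powKernel s z w ∂m) (Metric.ball 0 1) := by
  intro z₀ hz₀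
  have hz₀' : ‖z₀‖ < 1 := mem_ball_zero_iff.1 hz₀
  obtain ⟨R, hR0, hR⟩ := exists_between hz₀'
  have hmeas : ∀ t : ℝ, ∀ z ∈ Metric.ball (0 : EuclideanSpace ℂ (Fin n)) 1,
      Continuous fun w : UnitBall n => powKernel t z (w : EuclideanSpace ℂ (Fin n)) :=
    fun t z hz => continuous_powKernel_right t ⟨z, hz⟩
  have key := hasFDerivAt_integral_of_dominated_of_fderiv_le (μ := m) (𝕜 := ℂ) (x₀ := z₀)
    (F := fun (z : EuclideanSpace ℂ (Fin n)) (w : UnitBall n) => g w * powKernel s z w)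
    (F' := fun z w => g w • (((s : ℂ) * powKernel (s + 1) z w) •
      innerSL ℂ (w : EuclideanSpace ℂ (Fin n))))
    (bound := fun w => ‖g w‖ * (s * (1 - R) ^ (-(s + 1))))
    (s := Metric.ball 0 R) (Metric.isOpen_ball.mem_nhds (mem_ball_zero_iff.2 hR0))
    ?_ ?_ ?_ ?_ ?_ ?_
  · exact key.differentiableAt.differentiableWithinAt
  · filter_upwards [Metric.isOpen_ball.mem_nhds hz₀] with z hz
    exact hg.aestronglyMeasurable.mul (hmeas s z hz).aestronglyMeasurable
  · exact hg.mul_bdd (hmeas s z₀ hz₀).aestronglyMeasurable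
      (Eventually.of_forall fun w => norm_powKernel_le hs hR w.norm_lt_one hR0.le)
  · refine hg.aestronglyMeasurable.smul (Continuous.aestronglyMeasurable ?_)
    exact (continuous_const.mul (hmeas (s + 1) z₀ hz₀)).smul
      ((innerSL ℂ).continuous.comp continuous_subtype_val)
  · refine Eventually.of_forall fun w z hz => ?_
    rw [norm_smul]
    exact mul_le_mul_of_nonneg_left (norm_fderiv_powKernel_le hs hR w.norm_lt_one
      (mem_ball_zero_iff.1 hz).le) (norm_nonneg _)
  · exact hg.norm.mul_const _
  · refine Eventually.of_forall fun w z hz => ?_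
    exact (hasFDerivAt_powKernel w.norm_lt_one ((mem_ball_zero_iff.1 hz).le.trans hR.le)).const_mul
      (g w)

theorem IsHolomorphicOnBall.continuous {f : UnitBall n → CdLp p d} (hf : IsHolomorphicOnBall f) :
    Continuous f := by
  obtain ⟨F, hF, h⟩ := hf
  have := continuousOn_iff_continuous_domRestrict.1 hF.continuousOn
  convert this using 1
  funext z
  exact (h z).symm

theorem IsHolomorphicOnBall.exists_coord {f : UnitBall n → CdLp p d} (hf : IsHolomorphicOnBall f)
    (j : Fin d) : ∃ F : EuclideanSpace ℂ (Fin n) → ℂ, DifferentiableOn ℂ F (Metric.ball 0 1) ∧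
      ∀ z : UnitBall n, F z = f z j := by
  obtain ⟨F, hF, h⟩ := hf
  refine ⟨fun z => F z j, fun z hz => ?_, fun z => by simp only [h z]⟩
  exact (PiLp.proj p (𝕜 := ℂ) (fun _ : Fin d => ℂ) j).differentiableAt.comp_differentiableWithinAt z
    (hF z hz)

theorem bergmanExponent_nonneg (hα : -1 < α) : 0 ≤ (n : ℝ) + 1 + α := by
  have : (0 : ℝ) ≤ n := n.cast_nonneg
  linarith

theorem continuous_bergmanKernel_right (z : UnitBall n) :
    Continuous fun w : UnitBall n => bergmanKernel n α z w :=
  continuous_powKernel_right ((n : ℝ) + 1 + α) z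

theorem bergmanKernel_zero_left {o w : UnitBall n} (ho : (o : EuclideanSpace ℂ (Fin n)) = 0) :
    bergmanKernel n α o w = 1 := by
  simp [bergmanKernel, ho]

theorem exists_norm_bergmanKernel_le (hα : -1 < α) (z : UnitBall n) :
    ∃ C : ℝ, 0 ≤ C ∧ ∀ w, ‖bergmanKernel n α z w‖ ≤ C :=
  ⟨_, Real.rpow_nonneg (by linarith [z.norm_lt_one]) _, fun w =>
    norm_powKernel_le (bergmanExponent_nonneg hα) z.norm_lt_one w.norm_lt_one le_rfl⟩

/-- The positive Bergman operator is bounded on `L^p`. -/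
theorem exists_eLpNorm_le_of_enorm_le (hn : 1 ≤ n) (hα : -1 < α) (hp1 : 1 < p) (hp : p < ∞) :
    ∃ C : ℝ≥0, ∀ f g : UnitBall n → CdLp p d, (Measurable fun w => ‖f w‖ₑ) → ∀ c : ℝ≥0,
      (∀ z, ‖g z‖ₑ ≤ c * ∫⁻ w, ‖bergmanKernel n α z w‖ₑ * ‖f w‖ₑ ∂(weightedVolume n α)) →
      eLpNorm g p (weightedVolume n α) ≤ C * c * eLpNorm f p (weightedVolume n α) := by
  have hp1' : 1 < p.toReal := by
    rw [← ENNReal.toReal_one]; exact (ENNReal.toReal_lt_toReal ENNReal.one_ne_top hp.ne).2 hp1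
  have hp0 : 0 < p.toReal := by linarith
  obtain ⟨C, hC⟩ := exists_lintegral_powKernel_rpow_le (n := n) hn hα
    (Real.HolderConjugate.conjExponent hp1')
  refine ⟨C ^ (1 / p.toReal), fun f g hf c h => ?_⟩
  have hpz : p ≠ 0 := (zero_lt_one.trans hp1).ne'
  rw [eLpNorm_eq_lintegral_rpow_enorm_toReal hpz hp.ne,
    eLpNorm_eq_lintegral_rpow_enorm_toReal hpz hp.ne]
  have h1 : ∫⁻ z, ‖g z‖ₑ ^ p.toReal ∂(weightedVolume n α) ≤
      (c : ℝ≥0∞) ^ p.toReal * (C * ∫⁻ w, ‖f w‖ₑ ^ p.toReal ∂(weightedVolume n α)) := by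
    calc _ ≤ ∫⁻ z, (c : ℝ≥0∞) ^ p.toReal * (∫⁻ w, ‖bergmanKernel n α z w‖ₑ * ‖f w‖ₑ
          ∂(weightedVolume n α)) ^ p.toReal ∂(weightedVolume n α) := by
          refine lintegral_mono fun z => ?_
          rw [← ENNReal.mul_rpow_of_nonneg _ _ hp0.le]
          exact ENNReal.rpow_le_rpow (h z) hp0.le
      _ = (c : ℝ≥0∞) ^ p.toReal * ∫⁻ z, (∫⁻ w, ‖bergmanKernel n α z w‖ₑ * ‖f w‖ₑ
          ∂(weightedVolume n α)) ^ p.toReal ∂(weightedVolume n α) :=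
          lintegral_const_mul' _ _ (ENNReal.rpow_ne_top_of_nonneg hp0.le ENNReal.coe_ne_top)
      _ ≤ _ := mul_le_mul_right (hC _ hf) _
  calc _ ≤ ((c : ℝ≥0∞) ^ p.toReal * (C * ∫⁻ w, ‖f w‖ₑ ^ p.toReal ∂(weightedVolume n α))) ^
        (1 / p.toReal) := ENNReal.rpow_le_rpow h1 (by positivity)
    _ = _ := by
      rw [ENNReal.mul_rpow_of_nonneg _ _ (by positivity), ENNReal.mul_rpow_of_nonneg _ _ (by positivity),
        ← ENNReal.rpow_mul, mul_one_div_cancel hp0.ne', ENNReal.rpow_one,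
        ENNReal.coe_rpow_of_nonneg _ (by positivity)]
      ring

/-- Here `C` is independent of the operator, so a pointwise bound with small `c` gives a small norm.
This is applied to the difference of two Toeplitz operators. -/
theorem BergmanSpace.exists_norm_clm_le (hn : 1 ≤ n) (hα : -1 < α) (hp1 : 1 < p) (hp : p < ∞) :
    ∃ C : ℝ≥0, ∀ (A : BergmanSpace n d α p →L[ℂ] BergmanSpace n d α p) (c : ℝ≥0),
      (∀ f z, ‖A f z‖ₑ ≤
        c * ∫⁻ w, ‖bergmanKernel n α z w‖ₑ * ‖f w‖ₑ ∂(weightedVolume n α)) → ‖A‖ ≤ C * c := by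
  obtain ⟨C, hC⟩ := exists_eLpNorm_le_of_enorm_le (d := d) hn hα hp1 hp
  refine ⟨C, fun A c h => A.opNorm_le_bound (by positivity) fun f => ?_⟩
  have h1 := hC f (A f) f.2.1.continuous.enorm.measurable c (h f)
  rw [BergmanSpace.norm_def, BergmanSpace.norm_def]
  refine (ENNReal.toReal_mono (ENNReal.mul_ne_top (by finiteness) f.2.2.2.ne) h1).trans ?_
  rw [ENNReal.toReal_mul]
  simp

/-- A linear map given by holomorphic functions and dominated by the positive Bergman operator is
a bounded operator on the Bergman space. -/
theorem BergmanSpace.exists_clm (hn : 1 ≤ n) (hα : -1 < α) (hp1 : 1 < p) (hp : p < ∞)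
    (A : BergmanSpace n d α p → UnitBall n → CdLp p d) (hhol : ∀ f, IsHolomorphicOnBall (A f))
    (hadd : ∀ f g z, A (f + g) z = A f z + A g z) (hsmul : ∀ (a : ℂ) f z, A (a • f) z = a • A f z)
    (c : ℝ≥0) (hc : ∀ f z, ‖A f z‖ₑ ≤
        c * ∫⁻ w, ‖bergmanKernel n α z w‖ₑ * ‖f w‖ₑ ∂(weightedVolume n α)) :
    ∃ T : BergmanSpace n d α p →L[ℂ] BergmanSpace n d α p, ∀ f z, T f z = A f z := by
  obtain ⟨C, hC⟩ := exists_eLpNorm_le_of_enorm_le (d := d) hn hα hp1 hp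
  have h1 : ∀ f, eLpNorm (A f) p (weightedVolume n α) ≤ C * c * eLpNorm f p (weightedVolume n α) :=
    fun f => hC f (A f) f.2.1.continuous.enorm.measurable c (hc f)
  have h2 : ∀ f : BergmanSpace n d α p, C * c * eLpNorm f p (weightedVolume n α) ≠ ∞ := fun f =>
    ENNReal.mul_ne_top (by finiteness) f.2.2.2.ne
  let L : BergmanSpace n d α p →ₗ[ℂ] BergmanSpace n d α p :=
    { toFun := fun f => ⟨A f, hhol f, (hhol f).continuous.aestronglyMeasurable,
        (h1 f).trans_lt (h2 f).lt_top⟩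
      map_add' := fun f g => Subtype.ext (funext fun z => hadd f g z)
      map_smul' := fun a f => Subtype.ext (funext fun z => hsmul a f z) }
  refine ⟨L.mkContinuous (C * c) fun f => ?_, fun f z => rfl⟩
  rw [BergmanSpace.norm_def, BergmanSpace.norm_def]
  refine (ENNReal.toReal_mono (h2 f) (h1 f)).trans ?_
  rw [ENNReal.toReal_mul]
  simp

end Operators

/-! ### Measures dominated by the volume on Bergman functions -/

section Domination

variable {n d : ℕ} {α : ℝ} {p : ℝ≥0∞} [Fact (1 ≤ p)]

theorem measurableSet_preimage_hypBox (u : EuclideanSpace ℂ (Fin n)) (r : ℝ) :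
    MeasurableSet (Subtype.val ⁻¹' hypBox u r : Set (UnitBall n)) :=
  (isOpen_hypBox.preimage continuous_subtype_val).measurableSet

theorem isOpen_hypBox_prod (r : ℝ) : IsOpen {q : UnitBall n × UnitBall n |
    (q.2 : EuclideanSpace ℂ (Fin n)) ∈ hypBox (q.1 : EuclideanSpace ℂ (Fin n)) r} := by
  have h1 : Continuous fun q : UnitBall n × UnitBall n => boxGauge (q.1 : EuclideanSpace ℂ (Fin n))
      ((q.2 : EuclideanSpace ℂ (Fin n)) - q.1) := by unfold boxGauge defect; fun_prop
  have h2 : Continuous fun q : UnitBall n × UnitBall n =>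
      r * defect (q.1 : EuclideanSpace ℂ (Fin n)) := by unfold defect; fun_prop
  exact isOpen_lt h1 h2

theorem measurable_defect : Measurable fun u : UnitBall n => defect (u : EuclideanSpace ℂ (Fin n)) := by
  refine Continuous.measurable ?_
  unfold defect; fun_prop

/-- By Tonelli, fix `x` and integrate over those `u` whose box of size 1/8 contains `x`. They lie in
the box of size 1/2 at `x`, where `δ(u)` and `K(z, u)` are comparable with `δ(x)` and `K(z, x)`; the
mass bound `C δ(x)^s` cancels `δ(x)^(-s)`. The two comparisons cost `2^s` each, whence `4^s`. -/
theorem lintegral_hypBox_swap_le (hα : -1 < α) {ν : Measure (UnitBall n)} [SFinite ν] {C : ℝ}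
    (hν : ∀ w : UnitBall n, ν (Subtype.val ⁻¹' hypBox (w : EuclideanSpace ℂ (Fin n)) (1 / 2)) ≤
        ENNReal.ofReal (C * defect (w : EuclideanSpace ℂ (Fin n)) ^ ((n : ℝ) + 1 + α)))
    {g : UnitBall n → ℝ≥0∞} (hg : Measurable g) (z : UnitBall n) :
    ∫⁻ u : UnitBall n, ENNReal.ofReal (defect (u : EuclideanSpace ℂ (Fin n)) ^ (-((n : ℝ) + 1 + α))) *
        ‖bergmanKernel n α z u‖ₑ *
        ∫⁻ x in Subtype.val ⁻¹' hypBox (u : EuclideanSpace ℂ (Fin n)) (1 / 8), g x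
          ∂(weightedVolume n α) ∂ν ≤
      ENNReal.ofReal (4 ^ ((n : ℝ) + 1 + α) * C) *
        ∫⁻ x, ‖bergmanKernel n α z x‖ₑ * g x ∂(weightedVolume n α) := by
  have := isProbabilityMeasure_weightedVolume (n := n) hα
  have hs0 := bergmanExponent_nonneg (n := n) hα
  set s := (n : ℝ) + 1 + α with hs
  set D : Set (UnitBall n × UnitBall n) :=
    {q | (q.2 : EuclideanSpace ℂ (Fin n)) ∈ hypBox (q.1 : EuclideanSpace ℂ (Fin n)) (1 / 8)}
  have hD : MeasurableSet D := by
    exact (isOpen_hypBox_prod _).measurableSet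
  have hδm : Measurable fun u : UnitBall n => ENNReal.ofReal (defect (u : EuclideanSpace ℂ (Fin n)) ^ (-s)) :=
    (measurable_defect.pow_const _).ennreal_ofReal
  have hKm := (continuous_bergmanKernel_right (α := α) z).enorm.measurable
  set Φ : UnitBall n × UnitBall n → ℝ≥0∞ := D.indicator fun q =>
    ENNReal.ofReal (defect (q.1 : EuclideanSpace ℂ (Fin n)) ^ (-s)) * ‖bergmanKernel n α z q.1‖ₑ * g q.2
  have hΦ : Measurable Φ := Measurable.indicator
    (((hδm.comp measurable_fst).mul (hKm.comp measurable_fst)).mul (hg.comp measurable_snd)) hD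
  have e1 : ∀ u : UnitBall n, ENNReal.ofReal (defect (u : EuclideanSpace ℂ (Fin n)) ^ (-s)) *
      ‖bergmanKernel n α z u‖ₑ * ∫⁻ x in Subtype.val ⁻¹' hypBox (u : EuclideanSpace ℂ (Fin n)) (1 / 8),
        g x ∂(weightedVolume n α) = ∫⁻ x, Φ (u, x) ∂(weightedVolume n α) := fun u => by
    rw [← lintegral_const_mul _ hg, ← lintegral_indicator (measurableSet_preimage_hypBox _ _)]
    rfl
  simp_rw [e1]
  rw [lintegral_lintegral_swap (f := fun u x => Φ (u, x)) hΦ.aemeasurable,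
    ← lintegral_const_mul' _ _ ENNReal.ofReal_ne_top]
  refine lintegral_mono fun x => ?_
  have hx := x.defect_pos
  have key : ∀ u : UnitBall n, Φ (u, x) ≤
      (Subtype.val ⁻¹' hypBox (x : EuclideanSpace ℂ (Fin n)) (1 / 2)).indicator (fun _ =>
        ENNReal.ofReal (2 ^ s * defect (x : EuclideanSpace ℂ (Fin n)) ^ (-s)) *
          (ENNReal.ofReal (2 ^ s) * ‖bergmanKernel n α z x‖ₑ) * g x) u := fun u => by
    by_cases hu : (u, x) ∈ D
    · have hmem : (x : EuclideanSpace ℂ (Fin n)) ∈ hypBox (u : EuclideanSpace ℂ (Fin n)) (1 / 8) := hu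
      have hmem' := mem_hypBox_symm u.norm_lt_one (by norm_num) le_rfl hmem
      have hu' : u ∈ (Subtype.val ⁻¹' hypBox (x : EuclideanSpace ℂ (Fin n)) (1 / 2)) := by
        norm_num at hmem'; exact hmem'
      rw [Set.indicator_of_mem hu']
      change D.indicator _ (u, x) ≤ _
      rw [Set.indicator_of_mem hu]
      obtain ⟨hb1, hb2⟩ := defect_bounds u.norm_lt_one le_rfl hmem
      have hk := (enorm_powKernel_le_of_mem_hypBox hs0 u.norm_lt_one z.norm_lt_one.le hmem).2
      have hd := rpow_le_two_rpow_abs_mul (b := -s) hx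
        (x := defect (u : EuclideanSpace ℂ (Fin n))) (by linarith) (by linarith)
      rw [abs_neg, abs_of_nonneg hs0] at hd
      have hk' : ‖bergmanKernel n α z u‖ₑ ≤ ENNReal.ofReal (2 ^ s) * ‖bergmanKernel n α z x‖ₑ := hk
      change ENNReal.ofReal (defect (u : EuclideanSpace ℂ (Fin n)) ^ (-s)) *
        ‖bergmanKernel n α z u‖ₑ * g x ≤ _
      gcongr
    · change D.indicator _ (u, x) ≤ _
      rw [Set.indicator_of_notMem hu]
      exact zero_le
  refine (lintegral_mono key).trans ?_
  rw [lintegral_indicator_const (measurableSet_preimage_hypBox _ _)]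
  refine (mul_le_mul_right (hν x) _).trans (le_of_eq ?_)
  have h2 : ENNReal.ofReal (2 ^ s * defect (x : EuclideanSpace ℂ (Fin n)) ^ (-s)) * ENNReal.ofReal (2 ^ s) *
      ENNReal.ofReal (C * defect (x : EuclideanSpace ℂ (Fin n)) ^ s) = ENNReal.ofReal (4 ^ s * C) := by
    rw [← ENNReal.ofReal_mul (by positivity), ← ENNReal.ofReal_mul (by positivity)]
    congr 1
    have e4 : (4 : ℝ) ^ s = 2 ^ s * 2 ^ s := by
      rw [← Real.mul_rpow (by norm_num) (by norm_num)]; norm_num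
    have e5 : defect (x : EuclideanSpace ℂ (Fin n)) ^ (-s) * defect (x : EuclideanSpace ℂ (Fin n)) ^ s = 1 := by
      rw [← Real.rpow_add hx, neg_add_cancel, Real.rpow_zero]
    rw [e4]
    linear_combination (2 ^ s * 2 ^ s * C) * e5
  rw [← h2]
  ring

/-- On products of holomorphic functions and kernels, the measure is dominated by the volume. -/
def BergmanDominated (n : ℕ) (α : ℝ) (m : Measure (UnitBall n)) : Prop :=
  ∃ C : ℝ≥0, ∀ F : EuclideanSpace ℂ (Fin n) → ℂ, DifferentiableOn ℂ F (Metric.ball 0 1) →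
    ∀ z : UnitBall n, ∫⁻ w : UnitBall n, ‖F w‖ₑ * ‖bergmanKernel n α z w‖ₑ ∂m ≤
      C * ∫⁻ w : UnitBall n, ‖bergmanKernel n α z w‖ₑ * ‖F w‖ₑ ∂(weightedVolume n α)

theorem bergmanDominated_weightedVolume : BergmanDominated n α (weightedVolume n α) :=
  ⟨1, fun F _ z => le_of_eq (by
    rw [ENNReal.coe_one, one_mul]
    exact lintegral_congr fun w => mul_comm _ _)⟩

theorem measurable_enorm_of_differentiableOn {F : EuclideanSpace ℂ (Fin n) → ℂ}
    (hF : DifferentiableOn ℂ F (Metric.ball 0 1)) : Measurable fun w : UnitBall n => ‖F w‖ₑ :=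
  (continuousOn_iff_continuous_domRestrict.1 hF.continuousOn).enorm.measurable

/-- Replace `|F(u)|` by its mean over the box at `u`, then exchange the integrals; only the mass of
boxes under `ν` enters. -/
theorem bergmanDominated_of_hypBox_le (hn : 1 ≤ n) (hα : -1 < α) {ν : Measure (UnitBall n)}
    [SFinite ν] {C : ℝ} (hν : ∀ w : UnitBall n,
      ν (Subtype.val ⁻¹' hypBox (w : EuclideanSpace ℂ (Fin n)) (1 / 2)) ≤
        ENNReal.ofReal (C * defect (w : EuclideanSpace ℂ (Fin n)) ^ ((n : ℝ) + 1 + α))) :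
    BergmanDominated n α ν := by
  obtain ⟨A, hA, h⟩ := exists_enorm_le_setLIntegral_hypBox hn hα
  refine ⟨(A * (4 ^ ((n : ℝ) + 1 + α) * C)).toNNReal, fun F hF z => ?_⟩
  have h1 := lintegral_hypBox_swap_le hα hν (measurable_enorm_of_differentiableOn hF) z
  calc _ ≤ ∫⁻ u : UnitBall n, ENNReal.ofReal A *
        (ENNReal.ofReal (defect (u : EuclideanSpace ℂ (Fin n)) ^ (-((n : ℝ) + 1 + α))) *
        ‖bergmanKernel n α z u‖ₑ *
        ∫⁻ x in Subtype.val ⁻¹' hypBox (u : EuclideanSpace ℂ (Fin n)) (1 / 8), ‖F x‖ₑ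
          ∂(weightedVolume n α)) ∂ν := by
        refine lintegral_mono fun u => ?_
        have h2 := h F hF u u.norm_lt_one u (mem_hypBox_self u.norm_lt_one (by norm_num))
        rw [ENNReal.ofReal_mul hA.le] at h2
        refine (mul_le_mul_left h2 _).trans (le_of_eq (by ring))
    _ = ENNReal.ofReal A * ∫⁻ u : UnitBall n,
        (ENNReal.ofReal (defect (u : EuclideanSpace ℂ (Fin n)) ^ (-((n : ℝ) + 1 + α))) *
        ‖bergmanKernel n α z u‖ₑ *
        ∫⁻ x in Subtype.val ⁻¹' hypBox (u : EuclideanSpace ℂ (Fin n)) (1 / 8), ‖F x‖ₑ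
          ∂(weightedVolume n α)) ∂ν := lintegral_const_mul' _ _ ENNReal.ofReal_ne_top
    _ ≤ _ := by
        refine (mul_le_mul_right h1 _).trans (le_of_eq ?_)
        rw [← mul_assoc, ← ENNReal.ofReal_mul hA.le]
        rfl

theorem CdLp.enorm_le_sum (v : CdLp p d) : ‖v‖ₑ ≤ ∑ i, ‖v i‖ₑ := by
  have h : v = ∑ i, (WithLp.toLp p (Pi.single i (v i)) : CdLp p d) := by
    ext j
    rw [WithLp.ofLp_sum]
    simp [Finset.sum_apply, Pi.single_apply]
  conv_lhs => rw [h]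
  refine (enorm_sum_le _ _).trans (Finset.sum_le_sum fun i _ => le_of_eq ?_)
  rw [← ofReal_norm, ← ofReal_norm]
  simp

theorem CdLp.enorm_apply_le (v : CdLp p d) (i : Fin d) : ‖v i‖ₑ ≤ ‖v‖ₑ := by
  rw [← ofReal_norm, ← ofReal_norm]
  exact ENNReal.ofReal_le_ofReal (PiLp.norm_apply_le v i)

theorem BergmanSpace.continuous_coord (f : BergmanSpace n d α p) (j : Fin d) :
    Continuous fun w => f w j :=
  (PiLp.proj p (𝕜 := ℂ) (fun _ : Fin d => ℂ) j).continuous.comp f.2.1.continuous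

theorem BergmanSpace.lintegral_coord_mul_le (f : BergmanSpace n d α p) (j : Fin d) (z : UnitBall n) :
    ∫⁻ w, ‖bergmanKernel n α z w‖ₑ * ‖f w j‖ₑ ∂(weightedVolume n α) ≤
      ∫⁻ w, ‖bergmanKernel n α z w‖ₑ * ‖f w‖ₑ ∂(weightedVolume n α) :=
  lintegral_mono fun _ => mul_le_mul_right (CdLp.enorm_apply_le _ _) _

theorem BergmanSpace.lintegral_bergmanKernel_mul_lt_top (hα : -1 < α) (f : BergmanSpace n d α p)
    (z : UnitBall n) :
    ∫⁻ w, ‖bergmanKernel n α z w‖ₑ * ‖f w‖ₑ ∂(weightedVolume n α) < ∞ := by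
  have := isProbabilityMeasure_weightedVolume (n := n) hα
  obtain ⟨C, hC, h⟩ := exists_norm_bergmanKernel_le hα z
  have hf : Integrable f.1 (weightedVolume n α) := f.2.2.integrable Fact.out
  calc _ ≤ ∫⁻ w, ENNReal.ofReal C * ‖f w‖ₑ ∂(weightedVolume n α) := by
        refine lintegral_mono fun w => mul_le_mul_left ?_ _
        rw [← ofReal_norm]
        exact ENNReal.ofReal_le_ofReal (h w)
    _ = ENNReal.ofReal C * ∫⁻ w, ‖f w‖ₑ ∂(weightedVolume n α) :=
        lintegral_const_mul' _ _ ENNReal.ofReal_ne_top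
    _ < ∞ := ENNReal.mul_lt_top ENNReal.ofReal_lt_top hf.2

theorem BergmanDominated.exists_lintegral_le {m : Measure (UnitBall n)} (hm : BergmanDominated n α m) :
    ∃ C : ℝ≥0, ∀ (f : BergmanSpace n d α p) (j : Fin d) (z : UnitBall n),
      ∫⁻ w, ‖f w j * bergmanKernel n α z w‖ₑ ∂m ≤
        C * ∫⁻ w, ‖bergmanKernel n α z w‖ₑ * ‖f w‖ₑ ∂(weightedVolume n α) := by
  obtain ⟨C, h⟩ := hm
  refine ⟨C, fun f j z => ?_⟩
  obtain ⟨F, hF, hFf⟩ := f.2.1.exists_coord j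
  have h1 := h F hF z
  simp only [hFf] at h1
  simp only [enorm_mul]
  exact h1.trans (mul_le_mul_right (f.lintegral_coord_mul_le j z) _)

theorem BergmanDominated.integrable (hα : -1 < α) {m : Measure (UnitBall n)}
    (hm : BergmanDominated n α m) (f : BergmanSpace n d α p) (j : Fin d) (z : UnitBall n) :
    Integrable (fun w => f w j * bergmanKernel n α z w) m := by
  obtain ⟨C, h⟩ := hm.exists_lintegral_le (d := d) (p := p)
  exact ⟨((f.continuous_coord j).mul (continuous_bergmanKernel_right z)).aestronglyMeasurable,
    (h f j z).trans_lt (ENNReal.mul_lt_top ENNReal.coe_lt_top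
      (f.lintegral_bergmanKernel_mul_lt_top hα z))⟩

theorem BergmanDominated.integrable_coord (hα : -1 < α) {m : Measure (UnitBall n)}
    (hm : BergmanDominated n α m) (f : BergmanSpace n d α p) (j : Fin d) :
    Integrable (fun w => f w j) m := by
  -- The kernel is identically 1 for `z = 0`.
  have h := hm.integrable hα f j ⟨0, by simp⟩
  simpa only [bergmanKernel_zero_left, mul_one] using h

end Domination

/-! ### Toeplitz operators with dominated measures -/

section Toeplitz

variable {n d : ℕ} {α : ℝ} {p : ℝ≥0∞} [Fact (1 ≤ p)]

/-- One construction for both kinds of operators: the variations of the entries with their polar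
densities give `T_μ`, and `v_α` with the entries of a bounded symbol gives the operators with
symbols. -/
theorem exists_toeplitz_clm (hn : 1 ≤ n) (hα : -1 < α) (hp1 : 1 < p) (hp : p < ∞)
    (m : Fin d → Fin d → Measure (UnitBall n)) (hm : ∀ i j, BergmanDominated n α (m i j))
    (b : Fin d → Fin d → UnitBall n → ℂ) (hb : ∀ i j, Measurable (b i j)) (M : ℝ≥0)
    (hM : ∀ i j w, ‖b i j w‖ ≤ M) :
    ∃ T : BergmanSpace n d α p →L[ℂ] BergmanSpace n d α p, ∀ f z i,
      T f z i = ∑ j, ∫ w, f w j * bergmanKernel n α z w * b i j w ∂(m i j) := by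
  have hint : ∀ (f : BergmanSpace n d α p) z i j,
      Integrable (fun w => f w j * bergmanKernel n α z w * b i j w) (m i j) := fun f z i j =>
    ((hm i j).integrable hα f j z).mul_bdd (hb i j).aestronglyMeasurable (Eventually.of_forall (hM i j))
  choose C hC using fun i j => (hm i j).exists_lintegral_le (d := d) (p := p)
  set A : BergmanSpace n d α p → UnitBall n → CdLp p d := fun f z => WithLp.toLp p fun i =>
    ∑ j, ∫ w, f w j * bergmanKernel n α z w * b i j w ∂(m i j)
  suffices hA : ∃ T : BergmanSpace n d α p →L[ℂ] BergmanSpace n d α p, ∀ f z, T f z = A f z by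
    obtain ⟨T, hT⟩ := hA
    exact ⟨T, fun f z i => by rw [hT f z]⟩
  refine BergmanSpace.exists_clm hn hα hp1 hp A ?_ ?_ ?_ (∑ i, ∑ j, C i j * M) ?_
  · intro f
    -- The bounded factor is grouped with `f_j`; their product is integrable and the kernel carries
    -- all the dependence on `z`.
    refine ⟨fun z => WithLp.toLp p fun i => ∑ j, ∫ w : UnitBall n, (f w j * b i j w) *
      powKernel ((n : ℝ) + 1 + α) z (w : EuclideanSpace ℂ (Fin n)) ∂(m i j), ?_, fun z => ?_⟩
    · refine (PiLp.continuousLinearEquiv p ℂ (fun _ : Fin d => ℂ)).symm.differentiable.comp_differentiableOn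
        (differentiableOn_pi.2 fun i => DifferentiableOn.fun_sum fun j _ => ?_)
      exact differentiableOn_integral_powKernel (bergmanExponent_nonneg hα)
        (((hm i j).integrable_coord hα f j).mul_bdd (hb i j).aestronglyMeasurable
          (Eventually.of_forall (hM i j)))
    · simp only [A]
      congr 1
      funext i
      refine Finset.sum_congr rfl fun j _ => integral_congr_ae (Eventually.of_forall fun w => ?_)
      change f w j * b i j w * bergmanKernel n α z w = _
      ring
  · intro f g z
    simp only [A]
    rw [← WithLp.toLp_add]
    congr 1
    funext i
    simp only [Pi.add_apply]
    rw [← Finset.sum_add_distrib]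
    refine Finset.sum_congr rfl fun j _ => ?_
    rw [← integral_add (hint f z i j) (hint g z i j)]
    refine integral_congr_ae (Eventually.of_forall fun w => ?_)
    change (f w j + g w j) * _ * _ = _
    ring
  · intro a f z
    simp only [A]
    rw [← WithLp.toLp_smul]
    congr 1
    funext i
    simp only [Pi.smul_apply, smul_eq_mul]
    rw [Finset.mul_sum]
    refine Finset.sum_congr rfl fun j _ => ?_
    rw [← integral_const_mul]
    refine integral_congr_ae (Eventually.of_forall fun w => ?_)
    change (a * f w j) * _ * _ = _
    ring
  · intro f z
    refine (CdLp.enorm_le_sum _).trans ?_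
    rw [ENNReal.ofNNReal_finsetSum, Finset.sum_mul]
    refine Finset.sum_le_sum fun i _ => ?_
    rw [ENNReal.ofNNReal_finsetSum, Finset.sum_mul]
    refine (enorm_sum_le _ _).trans (Finset.sum_le_sum fun j _ => ?_)
    calc _ ≤ ∫⁻ w, ‖f w j * bergmanKernel n α z w * b i j w‖ₑ ∂(m i j) :=
          enorm_integral_le_lintegral_enorm _
      _ ≤ ∫⁻ w, ‖f w j * bergmanKernel n α z w‖ₑ * M ∂(m i j) := by
          refine lintegral_mono fun w => ?_
          rw [enorm_mul]
          refine mul_le_mul_right ?_ _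
          rw [← ofReal_norm, ← ENNReal.ofReal_coe_nnreal]
          exact ENNReal.ofReal_le_ofReal (hM i j w)
      _ = (∫⁻ w, ‖f w j * bergmanKernel n α z w‖ₑ ∂(m i j)) * M :=
          lintegral_mul_const' _ _ ENNReal.coe_ne_top
      _ ≤ _ := by
          refine (mul_le_mul_left (hC i j f j z) _).trans (le_of_eq ?_)
          push_cast
          ring

end Toeplitz

/-! ### Mollifiers adapted to the boxes -/

section Mollifier

variable {n : ℕ} {α : ℝ}

/-- With `v = w - z` and `X = P v + √δ (v - P v)`, the involution is `-X / (1 - ⟨w, z⟩)`, so `|X| =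
ρ |1 - ⟨w, z⟩|`. Each part of the gauge is controlled by `X`, giving gauge at most `3 |X|`. Finally
`|1 - ⟨w, z⟩| ≤ δ + |X|` and `ρ ≤ 1/2` give `|1 - ⟨w, z⟩| ≤ 2δ`. -/
theorem boxGauge_le_of_pseudoHyperbolicDist_le {z w : UnitBall n}
    (h : pseudoHyperbolicDist z w ≤ 1 / 2) :
    boxGauge (z : EuclideanSpace ℂ (Fin n)) ((w : EuclideanSpace ℂ (Fin n)) - z) ≤
      6 * pseudoHyperbolicDist z w * defect (z : EuclideanSpace ℂ (Fin n)) := by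
  obtain ⟨z, hz⟩ := z
  obtain ⟨w, hw⟩ := w
  have hz1 : ‖z‖ < 1 := mem_ball_zero_iff.1 hz
  have hw1 : ‖w‖ < 1 := mem_ball_zero_iff.1 hw
  have hδ := defect_pos hz1
  simp only at h ⊢
  set ρ := pseudoHyperbolicDist (⟨z, hz⟩ : UnitBall n) ⟨w, hw⟩ with hρ
  set t : ℝ := √(defect z) with ht
  have ht0 : 0 ≤ t := Real.sqrt_nonneg _
  have ht1 : t ≤ 1 := Real.sqrt_le_one.2 defect_le_one
  set P : EuclideanSpace ℂ (Fin n) → EuclideanSpace ℂ (Fin n) := fun v =>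
    (inner ℂ z v / ((‖z‖ ^ 2 : ℝ) : ℂ)) • z with hP
  set v := w - z with hv
  set X := P v + (t : ℂ) • (v - P v) with hX
  have hzz : (inner ℂ z z : ℂ) = ((‖z‖ ^ 2 : ℝ) : ℂ) := by
    rw [inner_self_eq_norm_sq_to_K]; push_cast; rfl
  have hPw : P w = z + P v := by
    have : w = v + z := by simp [hv]
    rw [this]
    simp only [hP, inner_add_right, add_div, add_smul, hzz]
    by_cases h0 : z = 0
    · simp [h0]
    · have : ((‖z‖ ^ 2 : ℝ) : ℂ) ≠ 0 := by
        exact_mod_cast pow_ne_zero 2 (norm_ne_zero_iff.2 h0)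
      rw [div_self this, one_smul, add_comm]
  have hinP : (inner ℂ z (P v) : ℂ) = inner ℂ z v := by
    simp only [hP, inner_smul_right, hzz]
    by_cases h0 : z = 0
    · simp [h0]
    · have : ((‖z‖ ^ 2 : ℝ) : ℂ) ≠ 0 := by
        exact_mod_cast pow_ne_zero 2 (norm_ne_zero_iff.2 h0)
      exact div_mul_cancel₀ _ this
  have hinX : (inner ℂ z X : ℂ) = inner ℂ z v := by
    simp only [hX, inner_add_right, inner_smul_right, inner_sub_right, hinP]
    ring
  have hXle : ‖(inner ℂ z v : ℂ)‖ ≤ ‖z‖ * ‖X‖ := by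
    rw [← hinX]; exact norm_inner_le_norm _ _
  have hPle : ‖P v‖ ≤ ‖X‖ := by
    by_cases h0 : z = 0
    · simp [hP, h0]
    · have hz0 : 0 < ‖z‖ := norm_pos_iff.2 h0
      have : ‖P v‖ = ‖(inner ℂ z v : ℂ)‖ / ‖z‖ := by
        simp only [hP, norm_smul, norm_div, Complex.norm_real, norm_pow, norm_norm]
        field_simp
      rw [this, div_le_iff₀ hz0, mul_comm]
      exact hXle
  have hXnorm : ‖X‖ = ρ * ‖1 - (inner ℂ z w : ℂ)‖ := by
    have h1 := norm_one_sub_inner_pos hz1 hw1.le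
    have e : ballInvolution z w = (1 / (1 - inner ℂ z w)) • (-X) := by
      change (1 / (1 - inner ℂ z w)) • (z - P w - (t : ℂ) • (w - P w)) = _
      congr 1
      rw [hPw, hX]
      have : w - (z + P v) = v - P v := by rw [hv]; abel
      rw [this]
      abel
    have e2 : ρ = ‖ballInvolution z w‖ := rfl
    rw [e2, e, norm_smul, norm_neg, norm_div, norm_one]
    field_simp
  have htv : t * ‖v‖ ≤ 2 * ‖X‖ := by
    have e : (t : ℂ) • v = X - ((1 - t : ℝ) : ℂ) • P v := by
      rw [hX]; push_cast; module
    have e1 : t * ‖v‖ = ‖(t : ℂ) • v‖ := by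
      rw [norm_smul, Complex.norm_real, Real.norm_of_nonneg ht0]
    rw [e1, e]
    refine (norm_sub_le _ _).trans ?_
    rw [norm_smul, Complex.norm_real, Real.norm_of_nonneg (by linarith)]
    nlinarith [norm_nonneg (P v), norm_nonneg X]
  have hρ0 : 0 ≤ ρ := norm_nonneg _
  have hin : ‖(inner ℂ z v : ℂ)‖ ≤ ‖X‖ := by nlinarith [norm_nonneg X]
  have hle : ‖1 - (inner ℂ z w : ℂ)‖ ≤ defect z + ‖X‖ := by
    have e : 1 - (inner ℂ z w : ℂ) = (defect z : ℂ) - inner ℂ z v := by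
      simp only [hv, defect, inner_sub_right, hzz]
      push_cast
      ring
    rw [e]
    refine (norm_sub_le _ _).trans ?_
    rw [Complex.norm_real, Real.norm_of_nonneg hδ.le]
    linarith
  have hle2 : ‖1 - (inner ℂ z w : ℂ)‖ ≤ 2 * defect z := by
    nlinarith [norm_nonneg (1 - (inner ℂ z w : ℂ))]
  have : boxGauge z v ≤ 3 * ‖X‖ := by
    change ‖(inner ℂ z v : ℂ)‖ + t * ‖v‖ ≤ _
    linarith
  refine this.trans ?_
  rw [hXnorm]
  nlinarith

/-- A bump function supported in a box. -/
def boxBump (r : ℝ) (w u : UnitBall n) : ℝ :=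
  max 0 (1 - boxGauge (u : EuclideanSpace ℂ (Fin n)) ((w : EuclideanSpace ℂ (Fin n)) - u) /
    (r * defect (u : EuclideanSpace ℂ (Fin n))))

theorem continuous_boxBump {r : ℝ} (hr : 0 < r) :
    Continuous fun q : UnitBall n × UnitBall n => boxBump r q.1 q.2 := by
  have h1 : Continuous fun q : UnitBall n × UnitBall n => boxGauge (q.2 : EuclideanSpace ℂ (Fin n))
      ((q.1 : EuclideanSpace ℂ (Fin n)) - q.2) := by unfold boxGauge defect; fun_prop
  have h2 : Continuous fun q : UnitBall n × UnitBall n =>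
      r * defect (q.2 : EuclideanSpace ℂ (Fin n)) := by unfold defect; fun_prop
  exact continuous_const.max (continuous_const.sub (h1.div h2 fun q =>
    (mul_pos hr q.2.defect_pos).ne'))

theorem boxBump_nonneg {r : ℝ} (w u : UnitBall n) : 0 ≤ boxBump r w u := le_max_left _ _

theorem boxBump_le_one {r : ℝ} (hr : 0 < r) (w u : UnitBall n) : boxBump r w u ≤ 1 := by
  refine max_le zero_le_one ?_
  have : 0 ≤ boxGauge (u : EuclideanSpace ℂ (Fin n)) ((w : EuclideanSpace ℂ (Fin n)) - u) /
    (r * defect (u : EuclideanSpace ℂ (Fin n))) :=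
    div_nonneg boxGauge_nonneg (mul_pos hr u.defect_pos).le
  linarith

theorem mem_hypBox_of_boxBump_ne_zero {r : ℝ} (hr : 0 < r) {w u : UnitBall n}
    (h : boxBump r w u ≠ 0) :
    (w : EuclideanSpace ℂ (Fin n)) ∈ hypBox (u : EuclideanSpace ℂ (Fin n)) r := by
  by_contra hw
  refine h (max_eq_left ?_)
  have hw : r * defect (u : EuclideanSpace ℂ (Fin n)) ≤
    boxGauge (u : EuclideanSpace ℂ (Fin n)) ((w : EuclideanSpace ℂ (Fin n)) - u) := not_lt.1 hw
  have := (one_le_div (mul_pos hr u.defect_pos)).2 hw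
  linarith

theorem half_le_boxBump {r : ℝ} (hr : 0 < r) {w u : UnitBall n}
    (h : (w : EuclideanSpace ℂ (Fin n)) ∈ hypBox (u : EuclideanSpace ℂ (Fin n)) (r / 2)) :
    1 / 2 ≤ boxBump r w u := by
  refine le_max_of_le_right ?_
  have h : boxGauge (u : EuclideanSpace ℂ (Fin n)) ((w : EuclideanSpace ℂ (Fin n)) - u) <
    r / 2 * defect (u : EuclideanSpace ℂ (Fin n)) := h
  have h2 : boxGauge (u : EuclideanSpace ℂ (Fin n)) ((w : EuclideanSpace ℂ (Fin n)) - u) /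
    (r * defect (u : EuclideanSpace ℂ (Fin n))) ≤ 1 / 2 := by
    rw [div_le_iff₀ (mul_pos hr u.defect_pos)]
    linarith
  linarith

/-- The gauge at `u` satisfies the reverse triangle inequality, and truncation at 0 does not
increase distances. -/
theorem abs_boxBump_sub_le {r : ℝ} (hr : 0 < r) (w w' u : UnitBall n) :
    |boxBump r w u - boxBump r w' u| ≤
      boxGauge (u : EuclideanSpace ℂ (Fin n)) ((w : EuclideanSpace ℂ (Fin n)) - w') /
        (r * defect (u : EuclideanSpace ℂ (Fin n))) := by
  have hpos := mul_pos hr u.defect_pos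
  unfold boxBump
  refine (abs_max_sub_max_le_max _ _ _ _).trans ?_
  rw [sub_self, abs_zero]
  refine max_le (div_nonneg boxGauge_nonneg hpos.le) ?_
  rw [sub_sub_sub_cancel_left, ← sub_div, abs_div, abs_of_pos hpos]
  refine div_le_div_of_nonneg_right ?_ hpos.le
  have h1 := boxGauge_add_le (u := (u : EuclideanSpace ℂ (Fin n)))
    (v := (w : EuclideanSpace ℂ (Fin n)) - w') (w := (w' : EuclideanSpace ℂ (Fin n)) - u)
  have h2 := boxGauge_add_le (u := (u : EuclideanSpace ℂ (Fin n)))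
    (v := -((w : EuclideanSpace ℂ (Fin n)) - w')) (w := (w : EuclideanSpace ℂ (Fin n)) - u)
  rw [boxGauge_neg] at h2
  rw [sub_add_sub_cancel] at h1
  rw [neg_sub, sub_add_sub_cancel] at h2
  rw [abs_le]
  constructor <;> linarith

/-- The functions `κ(·, u)` are probability densities concentrated in the boxes of size `r`, and
they are bounded and Lipschitz with the constant `c` in the natural scale. -/
structure IsHypBoxMollifier (n : ℕ) (α r : ℝ) (κ : UnitBall n → UnitBall n → ℝ) (c : ℝ) : Prop where
  const_pos : 0 < c
  measurable : Measurable (fun q : UnitBall n × UnitBall n => κ q.1 q.2)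
  nonneg : ∀ w u, 0 ≤ κ w u
  mem_hypBox : ∀ w u, κ w u ≠ 0 →
    (w : EuclideanSpace ℂ (Fin n)) ∈ hypBox (u : EuclideanSpace ℂ (Fin n)) r
  le : ∀ w u, κ w u ≤ c * defect (u : EuclideanSpace ℂ (Fin n)) ^ (-((n : ℝ) + 1 + α))
  integral_eq_one : ∀ u, ∫ w, κ w u ∂(weightedVolume n α) = 1
  abs_sub_le : ∀ w w' u, |κ w u - κ w' u| ≤
    c * defect (u : EuclideanSpace ℂ (Fin n)) ^ (-((n : ℝ) + 1 + α)) *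
    (boxGauge (u : EuclideanSpace ℂ (Fin n)) ((w : EuclideanSpace ℂ (Fin n)) - w') /
      defect (u : EuclideanSpace ℂ (Fin n)))

/-- Divide the bump by its integral `N(u)`, which is at least a multiple of `δ(u)^s` because the
bump is at least 1/2 on the box of half the size. The constant depends on `r`; it serves the
regularity of the symbol only and does not enter the error estimate. -/
theorem exists_isHypBoxMollifier (hn : 1 ≤ n) (hα : -1 < α) {r : ℝ} (hr : 0 < r) (hr' : r ≤ 1 / 8) :
    ∃ κ c, IsHypBoxMollifier n α r κ c := by
  have := isProbabilityMeasure_weightedVolume (n := n) hα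
  obtain ⟨c, hc, h⟩ := exists_weightedVolume_hypBox_ge hn hα (r := r / 2) (by positivity) (by linarith)
  set s := (n : ℝ) + 1 + α
  set N : UnitBall n → ℝ := fun u => ∫ w, boxBump r w u ∂(weightedVolume n α) with hN
  have hbm : Measurable fun q : UnitBall n × UnitBall n => boxBump r q.1 q.2 :=
    (continuous_boxBump hr).measurable
  have hbi : ∀ u, Integrable (fun w => boxBump r w u) (weightedVolume n α) := fun u =>
    Integrable.of_bound (hbm.comp (measurable_id.prodMk measurable_const)).aestronglyMeasurable 1
      (Eventually.of_forall fun w => by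
        rw [Real.norm_of_nonneg (boxBump_nonneg w u)]; exact boxBump_le_one hr w u)
  have hNm : Measurable N := by
    have := (hbm.comp measurable_swap).stronglyMeasurable.integral_prod_right'
      (ν := weightedVolume n α)
    exact this.measurable
  have hNge : ∀ u : UnitBall n, c / 2 * defect (u : EuclideanSpace ℂ (Fin n)) ^ s ≤ N u := fun u => by
    have hms := measurableSet_preimage_hypBox (n := n) u (r / 2)
    have hδ := Real.rpow_pos_of_pos u.defect_pos s
    have h1 : c * defect (u : EuclideanSpace ℂ (Fin n)) ^ s ≤ (weightedVolume n α).real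
        (Subtype.val ⁻¹' hypBox (u : EuclideanSpace ℂ (Fin n)) (r / 2)) :=
      (ENNReal.ofReal_le_iff_le_toReal (measure_ne_top _ _)).1 (h u u.norm_lt_one)
    have h2 : ∫ w, (Subtype.val ⁻¹' hypBox (u : EuclideanSpace ℂ (Fin n)) (r / 2)).indicator
        (fun _ => (1 / 2 : ℝ)) w ∂(weightedVolume n α) ≤ N u := by
      refine integral_mono ((integrable_const _).indicator hms) (hbi u) fun w => ?_
      by_cases hw : w ∈ Subtype.val ⁻¹' hypBox (u : EuclideanSpace ℂ (Fin n)) (r / 2)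
      · rw [Set.indicator_of_mem hw]; exact half_le_boxBump hr hw
      · rw [Set.indicator_of_notMem hw]; exact boxBump_nonneg w u
    rw [integral_indicator_const _ hms, smul_eq_mul] at h2
    linarith
  have hNpos : ∀ u, 0 < N u := fun u => lt_of_lt_of_le
    (mul_pos (by positivity) (Real.rpow_pos_of_pos u.defect_pos s)) (hNge u)
  have hNinv : ∀ u : UnitBall n, (N u)⁻¹ ≤ 2 / c * defect (u : EuclideanSpace ℂ (Fin n)) ^ (-s) := fun u => by
    have hδ := Real.rpow_pos_of_pos u.defect_pos s
    rw [Real.rpow_neg u.defect_pos.le]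
    refine (inv_anti₀ (by positivity) (hNge u)).trans (le_of_eq ?_)
    field_simp
  -- This lets one constant serve both the supremum bound and the Lipschitz bound, which carries a
  -- factor `1/r`.
  have h1r : 1 ≤ 1 / r := by rw [le_div_iff₀ hr]; linarith
  refine ⟨fun w u => boxBump r w u * (N u)⁻¹, 2 / c * (1 / r), by positivity,
    hbm.mul (hNm.comp measurable_snd).inv,
    fun w u => mul_nonneg (boxBump_nonneg w u) (inv_nonneg.2 (hNpos u).le),
    fun w u hw => mem_hypBox_of_boxBump_ne_zero hr (left_ne_zero_of_mul hw), fun w u => ?_,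
    fun u => ?_, fun w w' u => ?_⟩
  · have hδ := Real.rpow_pos_of_pos u.defect_pos (-s)
    calc boxBump r w u * (N u)⁻¹ ≤ 1 * (2 / c * defect (u : EuclideanSpace ℂ (Fin n)) ^ (-s)) :=
          mul_le_mul (boxBump_le_one hr w u) (hNinv u) (inv_nonneg.2 (hNpos u).le) zero_le_one
      _ = 2 / c * 1 * defect (u : EuclideanSpace ℂ (Fin n)) ^ (-s) := by ring
      _ ≤ _ := by gcongr
  · rw [integral_mul_const]
    exact mul_inv_cancel₀ (hNpos u).ne'
  · rw [← sub_mul, abs_mul, abs_of_pos (inv_pos.2 (hNpos u))]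
    have h2 := abs_boxBump_sub_le hr w w' u
    have h3 : 0 ≤ boxGauge (u : EuclideanSpace ℂ (Fin n)) ((w : EuclideanSpace ℂ (Fin n)) - w') /
        (r * defect (u : EuclideanSpace ℂ (Fin n))) :=
      div_nonneg boxGauge_nonneg (mul_pos hr u.defect_pos).le
    refine (mul_le_mul h2 (hNinv u) (inv_nonneg.2 (hNpos u).le) h3).trans (le_of_eq ?_)
    have := u.defect_pos.ne'
    field_simp
    rfl

end Mollifier

/-! ### Mollified measures -/

section MollifiedMeasure

variable {n d : ℕ} {α : ℝ} {p : ℝ≥0∞} [Fact (1 ≤ p)]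

/-- A multiple of the indicator function of a box, normalized by the volume of the box. -/
def boxWeight (n : ℕ) (α : ℝ) (w : UnitBall n) : UnitBall n → ℝ≥0∞ :=
  (Subtype.val ⁻¹' hypBox (w : EuclideanSpace ℂ (Fin n)) (1 / 2)).indicator fun _ =>
    ENNReal.ofReal (2 ^ ((n : ℝ) + 1 + α) *
      defect (w : EuclideanSpace ℂ (Fin n)) ^ (-((n : ℝ) + 1 + α)))

theorem measurable_boxWeight (w : UnitBall n) : Measurable (boxWeight n α w) :=
  measurable_const.indicator (measurableSet_preimage_hypBox _ _)

/-- If `w` is in the box of `u`, then `u` is in the box of size 1/2 of `w`, with comparable defect.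
This transfers bounds on `κ(w, ·)`, stated at the variable centre `u`, to a weight fixed by `w`,
whose `ν`-integral is bounded uniformly in `w`. -/
theorem ofReal_defect_rpow_le_boxWeight (hα : -1 < α) {w u : UnitBall n} {r : ℝ} (hr : r ≤ 1 / 8)
    (h : (w : EuclideanSpace ℂ (Fin n)) ∈ hypBox (u : EuclideanSpace ℂ (Fin n)) r) :
    ENNReal.ofReal (defect (u : EuclideanSpace ℂ (Fin n)) ^ (-((n : ℝ) + 1 + α))) ≤
      boxWeight n α w u := by
  have hs0 := bergmanExponent_nonneg (n := n) hα
  have h' := hypBox_mono u.norm_lt_one hr h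
  have hmem' := mem_hypBox_symm u.norm_lt_one (by norm_num) le_rfl h'
  have hu' : u ∈ (Subtype.val ⁻¹' hypBox (w : EuclideanSpace ℂ (Fin n)) (1 / 2)) := by
    norm_num at hmem'; exact hmem'
  rw [boxWeight, Set.indicator_of_mem hu']
  obtain ⟨hb1, hb2⟩ := defect_bounds u.norm_lt_one le_rfl h'
  have hw := w.defect_pos
  have hd := rpow_le_two_rpow_abs_mul (b := -((n : ℝ) + 1 + α)) hw
    (x := defect (u : EuclideanSpace ℂ (Fin n))) (by linarith) (by linarith)
  rw [abs_neg, abs_of_nonneg hs0] at hd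
  exact ENNReal.ofReal_le_ofReal hd

theorem lintegral_boxWeight_le {ν : Measure (UnitBall n)} {C : ℝ} {w : UnitBall n}
    (hν : ν (Subtype.val ⁻¹' hypBox (w : EuclideanSpace ℂ (Fin n)) (1 / 2)) ≤
        ENNReal.ofReal (C * defect (w : EuclideanSpace ℂ (Fin n)) ^ ((n : ℝ) + 1 + α))) :
    ∫⁻ u, boxWeight n α w u ∂ν ≤ ENNReal.ofReal (2 ^ ((n : ℝ) + 1 + α) * C) := by
  have hw := w.defect_pos
  unfold boxWeight
  rw [lintegral_indicator_const (measurableSet_preimage_hypBox _ _)]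
  refine (mul_le_mul_right hν _).trans (le_of_eq ?_)
  rw [← ENNReal.ofReal_mul (by positivity)]
  congr 1
  have e5 : defect (w : EuclideanSpace ℂ (Fin n)) ^ (-((n : ℝ) + 1 + α)) *
      defect (w : EuclideanSpace ℂ (Fin n)) ^ ((n : ℝ) + 1 + α) = 1 := by
    rw [← Real.rpow_add hw, neg_add_cancel, Real.rpow_zero]
  linear_combination (2 ^ ((n : ℝ) + 1 + α) * C) * e5

namespace IsHypBoxMollifier

variable {r c : ℝ} {κ : UnitBall n → UnitBall n → ℝ}

theorem enorm_le (hκ : IsHypBoxMollifier n α r κ c) (hα : -1 < α) (hr : r ≤ 1 / 8)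
    (w u : UnitBall n) : ‖κ w u‖ₑ ≤ ENNReal.ofReal c * boxWeight n α w u := by
  by_cases h : κ w u = 0
  · rw [h, enorm_zero]; exact zero_le
  · rw [Real.enorm_of_nonneg (hκ.nonneg w u)]
    refine (ENNReal.ofReal_le_ofReal (hκ.le w u)).trans ?_
    rw [ENNReal.ofReal_mul hκ.const_pos.le]
    exact mul_le_mul_right (ofReal_defect_rpow_le_boxWeight hα hr (hκ.mem_hypBox w u h)) _

/-- Unless both values vanish, `w` or `w'` lies in the box of `u`, and the gauge of `w - w'` at `w`
can be compared with that at `u` before the Lipschitz bound is used. -/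
theorem enorm_sub_le (hκ : IsHypBoxMollifier n α r κ c) (hα : -1 < α) (hr : r ≤ 1 / 8) {η : ℝ}
    (hη0 : 0 ≤ η) (hη : η < 1 / 8) {w w' : UnitBall n}
    (hw : boxGauge (w : EuclideanSpace ℂ (Fin n)) ((w' : EuclideanSpace ℂ (Fin n)) - w) ≤
      η * defect (w : EuclideanSpace ℂ (Fin n))) (u : UnitBall n) :
    ‖κ w u - κ w' u‖ₑ ≤ ENNReal.ofReal (7 * c * η) * (boxWeight n α w u + boxWeight n α w' u) := by
  have hc := hκ.const_pos
  have hδw := w.defect_pos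
  have hδu := u.defect_pos
  have hδs := Real.rpow_pos_of_pos hδu (-((n : ℝ) + 1 + α))
  have hsym : boxGauge (w : EuclideanSpace ℂ (Fin n)) ((w : EuclideanSpace ℂ (Fin n)) - w') ≤
      η * defect (w : EuclideanSpace ℂ (Fin n)) := by
    rw [← neg_sub, boxGauge_neg]; exact hw
  have key : boxGauge (u : EuclideanSpace ℂ (Fin n)) ((w : EuclideanSpace ℂ (Fin n)) - w') ≤
      7 * η * defect (u : EuclideanSpace ℂ (Fin n)) →
      ‖κ w u - κ w' u‖ₑ ≤ ENNReal.ofReal (7 * c * η) *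
        ENNReal.ofReal (defect (u : EuclideanSpace ℂ (Fin n)) ^ (-((n : ℝ) + 1 + α))) := fun hg => by
    rw [← ENNReal.ofReal_mul (by positivity), ← ofReal_norm, Real.norm_eq_abs]
    refine ENNReal.ofReal_le_ofReal ((hκ.abs_sub_le w w' u).trans ?_)
    have : boxGauge (u : EuclideanSpace ℂ (Fin n)) ((w : EuclideanSpace ℂ (Fin n)) - w') /
        defect (u : EuclideanSpace ℂ (Fin n)) ≤ 7 * η := (div_le_iff₀ hδu).2 hg
    calc _ ≤ c * defect (u : EuclideanSpace ℂ (Fin n)) ^ (-((n : ℝ) + 1 + α)) * (7 * η) := by gcongr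
      _ = _ := by ring
  by_cases h : κ w u = 0
  · by_cases h' : κ w' u = 0
    · rw [h, h', sub_zero, enorm_zero]; exact zero_le
    · have hm := hκ.mem_hypBox w' u h'
      have hm' : (w' : EuclideanSpace ℂ (Fin n)) ∈ hypBox (w : EuclideanSpace ℂ (Fin n)) (1 / 8) := by
        refine lt_of_le_of_lt hw ?_
        gcongr
      -- The worst case passes from `w` through `w'` to `u`: two gauge comparisons and two defect
      -- comparisons give `4 · (4/3) · (5/4) = 20/3 < 7`.
      have h1 := (boxGauge_comparable (v := (w : EuclideanSpace ℂ (Fin n)) - (w' : EuclideanSpace ℂ (Fin n))) u.norm_lt_one hr hm).1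
      have h2 := (boxGauge_comparable (v := (w : EuclideanSpace ℂ (Fin n)) - (w' : EuclideanSpace ℂ (Fin n))) w.norm_lt_one le_rfl hm').2
      have h3 := (defect_bounds w.norm_lt_one le_rfl hm').1
      have h4 := (defect_bounds u.norm_lt_one hr hm).2
      refine (key ?_).trans (mul_le_mul_right ((ofReal_defect_rpow_le_boxWeight hα hr hm).trans
        le_add_self) _)
      nlinarith
  · have hm := hκ.mem_hypBox w u h
    have h1 := (boxGauge_comparable (v := (w : EuclideanSpace ℂ (Fin n)) - (w' : EuclideanSpace ℂ (Fin n))) u.norm_lt_one hr hm).1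
    have h4 := (defect_bounds u.norm_lt_one hr hm).2
    refine (key ?_).trans (mul_le_mul_right ((ofReal_defect_rpow_le_boxWeight hα hr hm).trans
      le_self_add) _)
    nlinarith

variable {ν : Measure (UnitBall n)} {C : ℝ} {h : UnitBall n → ℂ}

theorem lintegral_enorm_le (hκ : IsHypBoxMollifier n α r κ c) (hα : -1 < α) (hr : r ≤ 1 / 8)
    {w : UnitBall n} (hν : ν (Subtype.val ⁻¹' hypBox (w : EuclideanSpace ℂ (Fin n)) (1 / 2)) ≤
        ENNReal.ofReal (C * defect (w : EuclideanSpace ℂ (Fin n)) ^ ((n : ℝ) + 1 + α)))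
    (hb : ∀ u, ‖h u‖ ≤ 1) :
    ∫⁻ u, ‖(κ w u : ℂ) * h u‖ₑ ∂ν ≤ ENNReal.ofReal (c * (2 ^ ((n : ℝ) + 1 + α) * C)) := by
  calc _ ≤ ∫⁻ u, ENNReal.ofReal c * boxWeight n α w u ∂ν := by
        refine lintegral_mono fun u => le_trans ?_ (hκ.enorm_le hα hr w u)
        rw [← ofReal_norm, ← ofReal_norm, norm_mul, Complex.norm_real]
        exact ENNReal.ofReal_le_ofReal (mul_le_of_le_one_right (norm_nonneg _) (hb u))
    _ = ENNReal.ofReal c * ∫⁻ u, boxWeight n α w u ∂ν :=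
        lintegral_const_mul' _ _ ENNReal.ofReal_ne_top
    _ ≤ _ := by
        rw [ENNReal.ofReal_mul hκ.const_pos.le]
        exact mul_le_mul_right (lintegral_boxWeight_le hν) _

theorem measurable_mul (hκ : IsHypBoxMollifier n α r κ c) (hh : Measurable h) :
    Measurable fun q : UnitBall n × UnitBall n => (κ q.1 q.2 : ℂ) * h q.2 :=
  (Complex.measurable_ofReal.comp hκ.measurable).mul (hh.comp measurable_snd)

theorem measurable_integral [SFinite ν] (hκ : IsHypBoxMollifier n α r κ c) (hh : Measurable h) :
    Measurable fun w => ∫ u, (κ w u : ℂ) * h u ∂ν :=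
  ((hκ.measurable_mul hh).stronglyMeasurable.integral_prod_right' (ν := ν)).measurable

theorem mem_boundedUniformAlgebra (hκ : IsHypBoxMollifier n α r κ c) (hα : -1 < α) (hr : r ≤ 1 / 8)
    (hC : 0 ≤ C) (hν : ∀ w : UnitBall n,
      ν (Subtype.val ⁻¹' hypBox (w : EuclideanSpace ℂ (Fin n)) (1 / 2)) ≤
        ENNReal.ofReal (C * defect (w : EuclideanSpace ℂ (Fin n)) ^ ((n : ℝ) + 1 + α)))
    (hh : Measurable h) (hb : ∀ u, ‖h u‖ ≤ 1) :
    (fun w => ∫ u, (κ w u : ℂ) * h u ∂ν) ∈ boundedUniformAlgebra n := by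
  have hc := hκ.const_pos
  have hint : ∀ w, Integrable (fun u => (κ w u : ℂ) * h u) ν := fun w =>
    ⟨((hκ.measurable_mul hh).comp (measurable_const.prodMk measurable_id)).aestronglyMeasurable,
      (hκ.lintegral_enorm_le hα hr (hν w) hb).trans_lt ENNReal.ofReal_lt_top⟩
  have hreal : ∀ (x : ℂ) (M : ℝ), 0 ≤ M → ‖x‖ₑ ≤ ENNReal.ofReal M → ‖x‖ ≤ M := fun x M hM hx => by
    rw [← ofReal_norm] at hx
    exact (ENNReal.ofReal_le_ofReal_iff hM).1 hx
  refine ⟨⟨c * (2 ^ ((n : ℝ) + 1 + α) * C), fun w => hreal _ _ (by positivity)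
    ((enorm_integral_le_lintegral_enorm _).trans (hκ.lintegral_enorm_le hα hr (hν w) hb))⟩,
    fun ε hε => ?_⟩
  set L : ℝ := 7 * c * (2 * (2 ^ ((n : ℝ) + 1 + α) * C)) with hL
  have hL0 : 0 ≤ L := by positivity
  -- The bound 1/100 ensures `ρ ≤ 1/2` and `6ρ < 1/8`, as the two comparisons require; the
  -- difference is then at most `6 L ρ`.
  refine ⟨min (1 / 100) (ε / (6 * L + 1)), by positivity, fun w w' hww' => ?_⟩
  have hρ0 : 0 ≤ pseudoHyperbolicDist w w' := norm_nonneg _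
  have hρ1 := hww'.trans_le (min_le_left _ _)
  have hρ2 := hww'.trans_le (min_le_right _ _)
  rw [lt_div_iff₀ (by positivity)] at hρ2
  set ρ := pseudoHyperbolicDist w w'
  have hg := boxGauge_le_of_pseudoHyperbolicDist_le (z := w) (w := w') (by linarith)
  refine lt_of_le_of_lt (hreal _ (L * (6 * ρ)) (by positivity) ?_) (by nlinarith)
  rw [← integral_sub (hint w) (hint w')]
  calc _ ≤ ∫⁻ u, ‖(κ w u : ℂ) * h u - (κ w' u : ℂ) * h u‖ₑ ∂ν :=
        enorm_integral_le_lintegral_enorm _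
    _ ≤ ∫⁻ u, ENNReal.ofReal (7 * c * (6 * ρ)) * (boxWeight n α w u + boxWeight n α w' u) ∂ν := by
        refine lintegral_mono fun u => le_trans ?_
          (hκ.enorm_sub_le hα hr (by positivity) (by linarith) hg u)
        rw [← sub_mul, ← Complex.ofReal_sub, ← ofReal_norm, ← ofReal_norm, norm_mul, Complex.norm_real]
        exact ENNReal.ofReal_le_ofReal (mul_le_of_le_one_right (norm_nonneg _) (hb u))
    _ = ENNReal.ofReal (7 * c * (6 * ρ)) *
          (∫⁻ u, boxWeight n α w u ∂ν + ∫⁻ u, boxWeight n α w' u ∂ν) := by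
        rw [← lintegral_add_left (measurable_boxWeight w)]
        exact lintegral_const_mul' _ _ ENNReal.ofReal_ne_top
    _ ≤ ENNReal.ofReal (7 * c * (6 * ρ)) * (ENNReal.ofReal (2 ^ ((n : ℝ) + 1 + α) * C) +
          ENNReal.ofReal (2 ^ ((n : ℝ) + 1 + α) * C)) :=
        mul_le_mul_right (add_le_add (lintegral_boxWeight_le (hν w)) (lintegral_boxWeight_le (hν w'))) _
    _ = _ := by
        rw [← ENNReal.ofReal_add (by positivity) (by positivity), ← ENNReal.ofReal_mul (by positivity)]
        congr 1
        rw [hL]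
        ring

end IsHypBoxMollifier

/-- Replacing a measure by its mollification changes the Toeplitz integrals by `O(r)`. -/
theorem exists_enorm_mollified_sub_le (hn : 1 ≤ n) (hα : -1 < α) {ν : Measure (UnitBall n)} [SFinite ν]
    {C : ℝ} (hC : 0 ≤ C) (hν : ∀ w : UnitBall n,
      ν (Subtype.val ⁻¹' hypBox (w : EuclideanSpace ℂ (Fin n)) (1 / 2)) ≤
        ENNReal.ofReal (C * defect (w : EuclideanSpace ℂ (Fin n)) ^ ((n : ℝ) + 1 + α)))
    {h : UnitBall n → ℂ} (hh : Measurable h) (hb : ∀ u, ‖h u‖ ≤ 1) :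
    ∃ A : ℝ, 0 ≤ A ∧ ∀ (r : ℝ) (κ : UnitBall n → UnitBall n → ℝ) (c : ℝ), 0 < r → r < 1 / 32 →
      IsHypBoxMollifier n α r κ c → ∀ (f : BergmanSpace n d α p) (j : Fin d) (z : UnitBall n),
      ‖(∫ w, f w j * bergmanKernel n α z w * (∫ u, (κ w u : ℂ) * h u ∂ν) ∂(weightedVolume n α)) -
        ∫ u, f u j * bergmanKernel n α z u * h u ∂ν‖ₑ ≤
      ENNReal.ofReal (A * r) *
        ∫⁻ w, ‖bergmanKernel n α z w‖ₑ * ‖f w‖ₑ ∂(weightedVolume n α) := by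
  have := isProbabilityMeasure_weightedVolume (n := n) hα
  obtain ⟨D, hD, hosc⟩ := exists_enorm_mul_powKernel_sub_le hn hα
  -- The constant is fixed before `r`, `κ` and `c`: the bound `c` of the mollifier is used for
  -- integrability only.
  refine ⟨D * (4 ^ ((n : ℝ) + 1 + α) * C), by positivity, fun r κ c hr0 hr hκ f j z => ?_⟩
  have hr8 : r ≤ 1 / 8 := by linarith
  set V := weightedVolume n α
  set φ : UnitBall n → ℂ := fun w => f w j * bergmanKernel n α z w with hφ
  have hφc : Continuous φ := (f.continuous_coord j).mul (continuous_bergmanKernel_right z)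
  have hφV : Integrable φ V := bergmanDominated_weightedVolume.integrable hα f j z
  have hφν : Integrable φ ν := (bergmanDominated_of_hypBox_le hn hα hν).integrable hα f j z
  have hκh := hκ.measurable_mul hh
  have hprod : Integrable (fun q : UnitBall n × UnitBall n => φ q.1 * ((κ q.1 q.2 : ℂ) * h q.2))
      (V.prod ν) := by
    have hmeas : Measurable fun q : UnitBall n × UnitBall n => φ q.1 * ((κ q.1 q.2 : ℂ) * h q.2) :=
      (hφc.measurable.comp measurable_fst).mul hκh
    refine ⟨hmeas.aestronglyMeasurable, ?_⟩
    rw [hasFiniteIntegral_iff_enorm, lintegral_prod _ hmeas.enorm.aemeasurable]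
    calc _ ≤ ∫⁻ w, ‖φ w‖ₑ * ENNReal.ofReal (c * (2 ^ ((n : ℝ) + 1 + α) * C)) ∂V := by
          refine lintegral_mono fun w => ?_
          simp only [enorm_mul (φ w)]
          rw [lintegral_const_mul' _ _ enorm_ne_top]
          exact mul_le_mul_right (hκ.lintegral_enorm_le hα hr8 (hν w) hb) _
      _ = (∫⁻ w, ‖φ w‖ₑ ∂V) * ENNReal.ofReal (c * (2 ^ ((n : ℝ) + 1 + α) * C)) :=
          lintegral_mul_const' _ _ ENNReal.ofReal_ne_top
      _ < ∞ := ENNReal.mul_lt_top hφV.2 ENNReal.ofReal_lt_top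
  have hκV : ∀ u, Integrable (fun w => (κ w u : ℂ)) V := fun u => by
    refine Integrable.of_bound (Complex.measurable_ofReal.comp (hκ.measurable.comp
      (measurable_id.prodMk measurable_const))).aestronglyMeasurable
      (c * defect (u : EuclideanSpace ℂ (Fin n)) ^ (-((n : ℝ) + 1 + α)))
      (Eventually.of_forall fun w => ?_)
    rw [Complex.norm_real]
    exact (Real.norm_of_nonneg (hκ.nonneg w u)).le.trans (hκ.le w u)
  have hφκ : ∀ u, Integrable (fun w => φ w * ((κ w u : ℂ) * h u)) V := fun u => by
    refine hφV.mul_bdd (((hκV u).mul_const _).aestronglyMeasurable)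
      (c := c * defect (u : EuclideanSpace ℂ (Fin n)) ^ (-((n : ℝ) + 1 + α)) * 1)
      (Eventually.of_forall fun w => ?_)
    rw [norm_mul, Complex.norm_real, Real.norm_of_nonneg (hκ.nonneg w u)]
    have hpos := mul_pos hκ.const_pos (Real.rpow_pos_of_pos u.defect_pos (-((n : ℝ) + 1 + α)))
    exact mul_le_mul (hκ.le w u) (hb u) (norm_nonneg _) hpos.le
  have e1 : ∫ w, φ w * (∫ u, (κ w u : ℂ) * h u ∂ν) ∂V =
      ∫ u, ∫ w, φ w * ((κ w u : ℂ) * h u) ∂V ∂ν := by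
    simp only [← integral_const_mul]
    exact integral_integral_swap (f := fun w u => φ w * ((κ w u : ℂ) * h u)) hprod
  -- Since `κ(·, u)` has integral 1, the value at `u` can be written as an integral over `w` and
  -- subtracted under the integral sign.
  have e2 : ∀ u, φ u * h u = ∫ w, φ u * ((κ w u : ℂ) * h u) ∂V := fun u => by
    rw [integral_const_mul, integral_mul_const, integral_complex_ofReal, hκ.integral_eq_one u,
      Complex.ofReal_one, one_mul]
  have e3 : (∫ w, φ w * (∫ u, (κ w u : ℂ) * h u ∂ν) ∂V) - ∫ u, φ u * h u ∂ν =
      ∫ u, ∫ w, (φ w - φ u) * ((κ w u : ℂ) * h u) ∂V ∂ν := by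
    rw [e1, ← integral_sub hprod.integral_prod_right
      (hφν.mul_bdd hh.aestronglyMeasurable (Eventually.of_forall hb))]
    refine integral_congr_ae (Eventually.of_forall fun u => ?_)
    simp only [e2 u, sub_mul]
    exact (integral_sub (hφκ u) (((hκV u).mul_const _).const_mul _)).symm
  obtain ⟨F, hF, hFf⟩ := f.2.1.exists_coord j
  have hφF : ∀ w : UnitBall n, φ w = F w * powKernel ((n : ℝ) + 1 + α)
      (z : EuclideanSpace ℂ (Fin n)) (w : EuclideanSpace ℂ (Fin n)) := fun w => by
    rw [hFf w]; rfl
  set G : UnitBall n → ℝ≥0∞ := fun u => ENNReal.ofReal (D * r) *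
    (ENNReal.ofReal (defect (u : EuclideanSpace ℂ (Fin n)) ^ (-((n : ℝ) + 1 + α))) *
      ‖bergmanKernel n α z u‖ₑ *
      ∫⁻ x in Subtype.val ⁻¹' hypBox (u : EuclideanSpace ℂ (Fin n)) (1 / 8), ‖F x‖ₑ ∂V)
  -- Where `κ` is nonzero, `w` lies in the box of `u` and the oscillation bound applies. The bound
  -- `G u` is independent of `w`, so integrating `κ(·, u)` removes the mollifier.
  have hpt : ∀ u w, ‖(φ w - φ u) * ((κ w u : ℂ) * h u)‖ₑ ≤ G u * ENNReal.ofReal (κ w u) := fun u w => by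
    by_cases h0 : κ w u = 0
    · simp [h0]
    · rw [enorm_mul]
      refine mul_le_mul' ?_ ?_
      · rw [hφF w, hφF u]
        exact hosc F hF z u z.norm_lt_one u.norm_lt_one r hr0 hr w (hκ.mem_hypBox w u h0)
      · rw [← ofReal_norm, norm_mul, Complex.norm_real, Real.norm_of_nonneg (hκ.nonneg w u)]
        exact ENNReal.ofReal_le_ofReal (mul_le_of_le_one_right (hκ.nonneg w u) (hb u))
  have hκone : ∀ u, ∫⁻ w, ENNReal.ofReal (κ w u) ∂V = 1 := fun u => by
    have hi : Integrable (fun w => κ w u) V := by simpa using (hκV u).re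
    rw [← ofReal_integral_eq_lintegral_ofReal hi (Eventually.of_forall fun w => hκ.nonneg w u),
      hκ.integral_eq_one u, ENNReal.ofReal_one]
  change ‖(∫ w, φ w * (∫ u, (κ w u : ℂ) * h u ∂ν) ∂V) - ∫ u, φ u * h u ∂ν‖ₑ ≤ _
  rw [e3]
  calc _ ≤ ∫⁻ u, ∫⁻ w, ‖(φ w - φ u) * ((κ w u : ℂ) * h u)‖ₑ ∂V ∂ν :=
        (enorm_integral_le_lintegral_enorm _).trans
          (lintegral_mono fun u => enorm_integral_le_lintegral_enorm _)
    _ ≤ ∫⁻ u, G u ∂ν := by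
        refine lintegral_mono fun u => ?_
        have hmκ : Measurable fun w => ENNReal.ofReal (κ w u) :=
          (hκ.measurable.comp (measurable_id.prodMk measurable_const)).ennreal_ofReal
        calc _ ≤ ∫⁻ w, G u * ENNReal.ofReal (κ w u) ∂V := lintegral_mono (hpt u)
          _ = G u * ∫⁻ w, ENNReal.ofReal (κ w u) ∂V := lintegral_const_mul _ hmκ
          _ = G u := by rw [hκone u, mul_one]
    _ = ENNReal.ofReal (D * r) * ∫⁻ u : UnitBall n,
          (ENNReal.ofReal (defect (u : EuclideanSpace ℂ (Fin n)) ^ (-((n : ℝ) + 1 + α))) *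
          ‖bergmanKernel n α z u‖ₑ *
          ∫⁻ x in Subtype.val ⁻¹' hypBox (u : EuclideanSpace ℂ (Fin n)) (1 / 8), ‖F x‖ₑ ∂V) ∂ν :=
        lintegral_const_mul' _ _ ENNReal.ofReal_ne_top
    _ ≤ ENNReal.ofReal (D * r) * (ENNReal.ofReal (4 ^ ((n : ℝ) + 1 + α) * C) *
          ∫⁻ x : UnitBall n, ‖bergmanKernel n α z x‖ₑ * ‖F x‖ₑ ∂V) :=
        mul_le_mul_right (lintegral_hypBox_swap_le hα hν (measurable_enorm_of_differentiableOn hF) z) _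
    _ ≤ _ := by
        simp only [hFf]
        rw [← mul_assoc, ← ENNReal.ofReal_mul (by positivity)]
        refine (mul_le_mul_right (f.lintegral_coord_mul_le j z) _).trans (le_of_eq ?_)
        congr 2
        ring

end MollifiedMeasure

/-! ### Approximation of Toeplitz operators -/

section Main

variable {n d : ℕ}

theorem MatrixMeasure.variation_entry_le (μ : MatrixMeasure n d) (i j : Fin d) :
    (μ.entry i j).variation ≤ μ.totalVariation := by
  intro s
  rw [MatrixMeasure.totalVariation, Measure.finsetSum_apply]
  refine le_trans ?_ (Finset.single_le_sum (fun _ _ => zero_le) (Finset.mem_univ i))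
  rw [Measure.finsetSum_apply]
  exact Finset.single_le_sum (f := fun j => (μ.entry i j).variation s) (fun _ _ => zero_le)
    (Finset.mem_univ j)

theorem exists_bound_of_boundedUniformAlgebra {B : UnitBall n → Matrix (Fin d) (Fin d) ℂ}
    (hB : ∀ i j, (fun z => B z i j) ∈ boundedUniformAlgebra n) :
    ∃ M : ℝ≥0, ∀ i j z, ‖B z i j‖ ≤ M := by
  choose C hC using fun i j => (hB i j).1
  refine ⟨∑ i, ∑ j, (C i j).toNNReal, fun i j z => (hC i j z).trans ((Real.le_coe_toNNReal _).trans ?_)⟩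
  rw [NNReal.coe_le_coe]
  exact (Finset.single_le_sum (f := fun j => (C i j).toNNReal) (fun _ _ => zero_le)
    (Finset.mem_univ j)).trans
    (Finset.single_le_sum (f := fun i => ∑ j, (C i j).toNNReal) (fun _ _ => zero_le)
      (Finset.mem_univ i))

end Main

end

theorem theorem4p1 (n d : ℕ) (hn : 1 ≤ n) (hd : 1 ≤ d) (α : ℝ) (hα : -1 < α)
    (p : ℝ≥0∞) [Fact (1 ≤ p)] (hp_one : 1 < p) (hp_top : p < ∞)
    (μ : MatrixMeasure n d) (hμ : IsBergmanCarleson n d α p μ.totalVariation) :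
    ∃ B : ℕ → UnitBall n → Matrix (Fin d) (Fin d) ℂ,
      (∀ (k : ℕ) (i j : Fin d), (fun z => B k z i j) ∈ boundedUniformAlgebra n) ∧
      ∃ (T : BergmanSpace n d α p →L[ℂ] BergmanSpace n d α p)
        (S : ℕ → BergmanSpace n d α p →L[ℂ] BergmanSpace n d α p),
        IsToeplitzOfMeasure μ T ∧ (∀ k, IsToeplitzOfSymbol (B k) (S k)) ∧
        Tendsto (fun k => ‖S k - T‖) atTop (𝓝 0) := by
  have hfin := hμ.isFiniteMeasure hα hd
  obtain ⟨C, hC, hbox⟩ := hμ.exists_hypBox_le hn hα hd hp_top.ne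
  have hvfin : ∀ i j, IsFiniteMeasure (μ.entry i j).variation := fun i j =>
    isFiniteMeasure_of_le _ (μ.variation_entry_le i j)
  have hν : ∀ i j (w : UnitBall n), (μ.entry i j).variation
      (Subtype.val ⁻¹' hypBox (w : EuclideanSpace ℂ (Fin n)) (1 / 2)) ≤
        ENNReal.ofReal (C * defect (w : EuclideanSpace ℂ (Fin n)) ^ ((n : ℝ) + 1 + α)) :=
    fun i j w => (μ.variation_entry_le i j _).trans (hbox w)
  have hdom : ∀ i j, BergmanDominated n α (μ.entry i j).variation := fun i j =>
    bergmanDominated_of_hypBox_le hn hα (hν i j)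
  choose h hhm hhb hh using fun i j => ComplexMeasure.exists_density (μ.entry i j)
  -- These sizes tend to 0 and stay below 1/32, as the oscillation estimate requires.
  set r : ℕ → ℝ := fun k => 1 / 64 * (1 / ((k : ℝ) + 1)) with hr
  have hr0 : ∀ k, 0 < r k := fun k => by positivity
  have hr1 : ∀ k, r k < 1 / 32 := fun k => by
    have : 1 / ((k : ℝ) + 1) ≤ 1 := by
      rw [div_le_one (by positivity)]
      linarith [(k.cast_nonneg : (0 : ℝ) ≤ k)]
    simp only [hr]
    linarith
  choose κ c hκ using fun k => exists_isHypBoxMollifier hn hα (hr0 k) ((hr1 k).le.trans (by norm_num))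
  set B : ℕ → UnitBall n → Matrix (Fin d) (Fin d) ℂ := fun k w => Matrix.of fun i j =>
    ∫ u, (κ k w u : ℂ) * h i j u ∂(μ.entry i j).variation
  have hB : ∀ k i j, (fun z => B k z i j) ∈ boundedUniformAlgebra n := fun k i j =>
    (hκ k).mem_boundedUniformAlgebra hα ((hr1 k).le.trans (by norm_num)) hC.le (hν i j) (hhm i j)
      (hhb i j)
  have hBm : ∀ k i j, Measurable fun z => B k z i j := fun k i j =>
    (hκ k).measurable_integral (hhm i j)
  choose M hM using fun k => exists_bound_of_boundedUniformAlgebra (hB k)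
  obtain ⟨T, hT⟩ := exists_toeplitz_clm hn hα hp_one hp_top (fun i j => (μ.entry i j).variation) hdom
    h hhm 1 hhb
  choose S hS using fun k => exists_toeplitz_clm hn hα hp_one hp_top (d := d)
    (fun _ _ => weightedVolume n α) (fun _ _ => bergmanDominated_weightedVolume)
    (fun i j z => B k z i j) (hBm k) (M k) (hM k)
  refine ⟨B, hB, T, S, fun f z i => ⟨fun j => (hdom i j).integrable hα f j z, ?_⟩,
    fun k f z i => ⟨fun j => ?_, ?_⟩, ?_⟩
  · rw [hT f z i]
    exact Finset.sum_congr rfl fun j _ => (ComplexMeasure.integral_mul_eq (hhm i j) (hhb i j)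
      (hh i j) ((hdom i j).integrable hα f j z)).symm
  · have := (bergmanDominated_weightedVolume.integrable hα f j z).bdd_mul
      (hBm k i j).aestronglyMeasurable (Eventually.of_forall (hM k i j))
    simpa only [mul_assoc] using this
  · rw [hS k f z i]
    refine Finset.sum_congr rfl fun j _ => integral_congr_ae (Eventually.of_forall fun w => ?_)
    change _ * _ * B k w i j = B k w i j * _ * _
    ring
  -- The constants `A i j` do not depend on `k`. Summing the entrywise errors bounds the difference
  -- by `Q r_k` times the positive Bergman operator, so its norm is at most `D Q r_k`.
  · choose A hA0 hA using fun i j => exists_enorm_mollified_sub_le (d := d) (p := p) hn hα hC.le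
      (hν i j) (hhm i j) (hhb i j)
    obtain ⟨D, hD⟩ := BergmanSpace.exists_norm_clm_le (d := d) hn hα hp_one hp_top
    set Q := ∑ i, ∑ j, A i j with hQ
    have hQ0 : 0 ≤ Q := Finset.sum_nonneg fun i _ => Finset.sum_nonneg fun j _ => hA0 i j
    have hle : ∀ k, ‖S k - T‖ ≤ D * (Q * r k) := fun k => by
      have := hD (S k - T) (Q * r k).toNNReal fun f z => ?_
      · rwa [Real.coe_toNNReal _ (mul_nonneg hQ0 (hr0 k).le)] at this
      change ‖S k f z - T f z‖ₑ ≤ ENNReal.ofReal (Q * r k) * _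
      refine (CdLp.enorm_le_sum _).trans ?_
      rw [hQ, Finset.sum_mul, ENNReal.ofReal_sum_of_nonneg fun i _ => mul_nonneg
        (Finset.sum_nonneg fun j _ => hA0 i j) (hr0 k).le, Finset.sum_mul]
      refine Finset.sum_le_sum fun i _ => ?_
      rw [Finset.sum_mul, ENNReal.ofReal_sum_of_nonneg fun j _ => mul_nonneg (hA0 i j) (hr0 k).le,
        Finset.sum_mul, PiLp.sub_apply, hS k f z i, hT f z i, ← Finset.sum_sub_distrib]
      exact (enorm_sum_le _ _).trans (Finset.sum_le_sum fun j _ =>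
        hA i j (r k) (κ k) (c k) (hr0 k) (hr1 k) (hκ k) f j z)
    have hlim : Tendsto (fun k => D * (Q * r k)) atTop (𝓝 0) := by
      have := ((tendsto_one_div_add_atTop_nhds_zero_nat (𝕜 := ℝ)).const_mul (1 / 64)).const_mul
        ((D : ℝ) * Q)
      simp only [mul_zero] at this
      simpa only [hr, mul_assoc] using this
    exact squeeze_zero (fun _ => norm_nonneg _) hle hlim
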